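/- **Setting.** A $*$-word is a finite word $w$ over the alphabet $\{G_r\}\cup\{G_r^*\}$, and $w^*$ is obtained from $w$ by reversing the order of the letters and exchanging $G_r\leftrightarrow G_r^*$. Let $b_N\in\mathbb N$, $l_N=\min(2b_N+1,N)$ and $d_N(i,j)=\min(|i-j|,N-|i-j|)$. For each $N$ let $(Z^{(r)}_{i,j})_{r,\,1\le i,j\le N}$ be i.i.d. standard complex Gaussian variables ($X+iY$ with $X,Y$ independent real centred Gaussians of variance $1/2$), and let $G_r$ be the $N\times N$ matrix with entries $l_N^{-1/2}\mathbf 1_{d_N(i,j)\le b_N}Z^{(r)}_{i,j}$. Let $G_w$ be the product of the matrices $G_r$, $G_r^*$ according to the letters of $w$. **Pairings.** For $*$-words $w_1,\dots,w_k$ take $k$ oriented polygons, the edges of the $j$-th being labelled in cyclic order by the letters of $w_j$. An admissible pairing $\phi\in\mathscr P(w_1,\dots,w_k)$ is a perfect matching of all the edges in which every edge labelled $G_r$ is paired with one labelled $G_r^*$. Gluing paired edges with opposite directions gives a closed oriented surface $S_\phi$, whose edges and vertices form a graph $\Gamma_\phi$. The pairing is spherical if $S_\phi$ is a sphere, i.e.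 connected with $V-E+F=2$. Let $a_w$ be the number of spherical pairings in $\mathscr P(w)$. **Volumes.** Let $0\le\lambda\le 1/2$ and let $\phi$ be spherical, $\Gamma_\phi$ having vertices $1,\dots,V$. If $\lambda>0$, let $I_\lambda=[-\frac1{4\lambda},\frac1{4\lambda}]$ and $d(x,y)=\min(|x-y|,\frac1{2\lambda}-|x-y|)$; if $\lambda=0$, let $I_0=\mathbb R$ and $d(x,y)=|x-y|$. Let $\alpha_\phi=\alpha_\phi^{(\lambda)}$ be the $(V-1)$-dimensional volume of $$\{x\in I_\lambda^V:\ x_1=0,\ d(x_i,x_j)<1/2\text{ for every edge }(i,j)\text{ of }\Gamma_\phi\},$$ and set $$b'_w=\sum_{\phi\in\mathscr P(w,w^*)\text{ spherical}}\alpha_\phi,\qquad c'_w=\sum_{\phi\in\mathscr P(w,w)\text{ spherical}}\alpha_\phi .$$ **Theorem.** Let $w$ be a nonempty $*$-word and suppose $N^{-1/3}b_N\to\infty$ as $N\to\infty$. Then $\mathrm{Tr}\,G_w$ is integrable and $$\mathbb E\,\mathrm{Tr}\,G_w=a_wN+O\!\left(\frac N{l_N^2}\right).$$ If moreover $b_N/N\to\lambda$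 for some real $\lambda\ge 0$, then, with $b'_w,c'_w$ taken at the parameter $\min(\lambda,1/2)$, one has $c'_w\le b'_w$ and $$\sqrt{\frac{l_N}{N}}\,\bigl(\mathrm{Tr}\,G_w-a_wN\bigr)\xrightarrow[N\to\infty]{d}X+iY,$$ where $X,Y$ are independent centred real Gaussian variables with variances $\frac{b'_w+c'_w}2$ and $\frac{b'_w-c'_w}2$ respectively. -/

import Mathlib

open MeasureTheory ProbabilityTheory Filter Topology Asymptotics
open scoped Matrix

namespace BandCLT

/-! ### Words and the random matrices they induce -/

/-- A letter of the alphabet `{G_r} ∪ {G_r^*}`: `⟨r, false⟩` is `G_r` and `⟨r, true⟩` is `G_r^*`. -/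
structure Letter where
  index : ℕ
  starred : Bool

/-- The conjugate transpose of a letter. -/
def Letter.star (a : Letter) : Letter := ⟨a.index, !a.starred⟩

/-- The `*`-word `w^*`: reverse the order and take the conjugate transpose of every letter. -/
def starWord (w : List Letter) : List Letter := (w.map Letter.star).reverse

/-- The matrix `G_w`, obtained by replacing each letter by the corresponding matrix. -/
noncomputable def wordMatrix {n : ℕ} (G : ℕ → Matrix (Fin n) (Fin n) ℂ) (w : List Letter) :
    Matrix (Fin n) (Fin n) ℂ :=
  (w.map fun a => if a.starred then (G a.index)ᴴ else G a.index).prod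

/-- The cyclic distance `min (|i - j|, n - |i - j|)`. -/
def cyclicDist {n : ℕ} (i j : Fin n) : ℕ :=
  min (Nat.dist (i : ℕ) (j : ℕ)) (n - Nat.dist (i : ℕ) (j : ℕ))

/-- The number `l = min (2 b + 1, n)` of indices within cyclic distance `b` of a given index. -/
def bandCount (n b : ℕ) : ℕ := min (2 * b + 1) n

/-- The periodic band matrix with entries `l^{-1/2} 1_{d(i,j) ≤ b} Z_{i,j}`. -/
noncomputable def bandMatrix {n : ℕ} (b : ℕ) (Z : Fin n → Fin n → ℂ) :
    Matrix (Fin n) (Fin n) ℂ :=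
  Matrix.of fun i j =>
    ((1 / Real.sqrt (bandCount n b) : ℝ) : ℂ) * (if cyclicDist i j ≤ b then Z i j else 0)

/-- The law of `X + i Y` where `X, Y` are independent centred real Gaussian variables of variance
`1/2`: the standard complex Gaussian distribution, with density `exp (-|z|^2) / π`. -/
noncomputable def stdComplexGaussian : Measure ℂ :=
  ((gaussianReal 0 (1 / 2)).prod (gaussianReal 0 (1 / 2))).map
    fun p : ℝ × ℝ => (p.1 : ℂ) + (p.2 : ℂ) * Complex.I

/-! ### Pairings of the edges of polygonal faces and the glued surfaces

The word `ws j` gives an oriented polygon with `(ws j).length` edges. The edge `⟨j, l⟩` of that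
polygon runs, in the direct sense of the polygon, from the corner `⟨j, l⟩` to the corner
`⟨j, l + 1⟩`, where `l + 1` is taken cyclically. Hence the same type indexes edges and corners. -/

/-- The edges of the polygons of the words `ws`; also the corners, where a corner bears the name
of the edge that starts there. -/
abbrev Edge {k : ℕ} (ws : Fin k → List Letter) : Type := Σ j : Fin k, Fin (ws j).length

section Surface

variable {k : ℕ} {ws : Fin k → List Letter}

/-- The letter that labels an edge. -/
def label (e : Edge ws) : Letter := (ws e.1).get e.2

/-- The next edge around the same polygon; also the corner at which the edge `e` ends. -/
def next (e : Edge ws) : Edge ws := ⟨e.1, finRotate _ e.2⟩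

/-- A pairing of the edges, as an involution, is admissible if the labels of paired edges are
conjugate transposes of each other (which excludes fixed points). -/
def IsAdmissible (φ : Equiv.Perm (Edge ws)) : Prop :=
  (∀ e, φ (φ e) = e) ∧ ∀ e, label (φ e) = (label e).star

/-- The vertices of the surface `S_φ` (and of the graph `Γ_φ`): gluing the edges `e` and `φ e` with
opposite directions identifies the start of `e` with the end of `φ e` (and, applying this to `φ e`,
the end of `e` with the start of `φ e`). -/
abbrev Vertex (φ : Equiv.Perm (Edge ws)) : Type :=
  Quot fun x y : Edge ws => y = next (φ x)

noncomputable instance (φ : Equiv.Perm (Edge ws)) : Fintype (Vertex φ) := Fintype.ofFinite _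

/-- The edges of `S_φ`: the edges of the polygons up to the identification of `e` with `φ e`. -/
abbrev SurfaceEdge (φ : Equiv.Perm (Edge ws)) : Type :=
  Quot fun x y : Edge ws => y = φ x

/-- The connected components of `S_φ`, for nonempty words: the classes of edges under going
around a polygon and crossing to the paired edge. -/
abbrev Component (φ : Equiv.Perm (Edge ws)) : Type :=
  Quot fun x y : Edge ws => y = next x ∨ y = φ x

/-- The Euler characteristic `V - E + F` of `S_φ`; there is one face for each word. -/
noncomputable def eulerChar (φ : Equiv.Perm (Edge ws)) : ℤ :=
  (Nat.card (Vertex φ) : ℤ) - Nat.card (SurfaceEdge φ) + k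

/-- The sum `g` of the genera of the components of the closed oriented surface `S_φ`, determined by
`V - E + F = 2 c - 2 g`. -/
noncomputable def genus (φ : Equiv.Perm (Edge ws)) : ℚ :=
  (Nat.card (Component φ) : ℚ) - (eulerChar φ : ℚ) / 2

/-- `S_φ` is a sphere: it is connected, of genus `0`. -/
def IsSpherical (φ : Equiv.Perm (Edge ws)) : Prop :=
  Nat.card (Component φ) = 1 ∧ genus φ = 0

/-- Adjacency in the graph `Γ_φ`: some edge of a polygon runs from `u` to `v`. -/
def GraphAdj (φ : Equiv.Perm (Edge ws)) (u v : Vertex φ) : Prop :=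
  ∃ e : Edge ws, u = Quot.mk _ e ∧ v = Quot.mk _ (next e)

end Surface

open Classical in
/-- The spherical admissible pairings of the edges of the polygons of the words `ws`. -/
noncomputable def sphericalPairings {k : ℕ} (ws : Fin k → List Letter) :
    Finset (Equiv.Perm (Edge ws)) :=
  Finset.univ.filter fun φ => IsAdmissible φ ∧ IsSpherical φ

/-! ### The polytopes and their volumes -/

/-- The interval `I_lam = [-1/(4 lam), 1/(4 lam)]`, and the whole line for `lam = 0`. -/
noncomputable def bandInterval (lam : ℝ) : Set ℝ :=
  if lam = 0 then Set.univ else Set.Icc (-(1 / (4 * lam))) (1 / (4 * lam))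

/-- The cyclic distance on `I_lam`, whose length is `1/(2 lam)`; the usual distance for
`lam = 0`. -/
noncomputable def bandDist (lam x y : ℝ) : ℝ :=
  if lam = 0 then |x - y| else min |x - y| (1 / (2 * lam) - |x - y|)

/-- The body `D_Γ^(lam)` of a connected graph with vertex set `V` and adjacency relation `Adj`.
The coordinate of the vertex `root` is `0`, and the body is regarded as a subset of the space
`ℝ^(|V|-1)` of the other coordinates. -/
def bandBody {V : Type} [DecidableEq V] (Adj : V → V → Prop) (root : V) (lam : ℝ) :
    Set ({v : V // v ≠ root} → ℝ) :=
  {x | let y : V → ℝ := fun v => if h : v = root then 0 else x ⟨v, h⟩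
    (∀ v, y v ∈ bandInterval lam) ∧ ∀ u v, Adj u v → bandDist lam (y u) (y v) < 1 / 2}

open Classical in
/-- The `(V - 1)`-dimensional volume `α_φ` of the body of the graph `Γ_φ`, for a pairing `φ` whose
surface is connected. The vertex whose coordinate is set to `0` is an arbitrary one. -/
noncomputable def alpha {k : ℕ} {ws : Fin k → List Letter} (lam : ℝ)
    (φ : Equiv.Perm (Edge ws)) : ℝ :=
  if h : Nonempty (Vertex φ) then
    (volume (bandBody (GraphAdj φ) (Classical.choice h) lam)).toReal
  else 0

/-! ### The parameters of a word -/

/-- `a_w`: the number of spherical pairings of the single face `w`. -/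
noncomputable def aParam (w : List Letter) : ℕ := (sphericalPairings ![w]).card

/-- `b'_w`: the sum of the volumes `α_φ` over the spherical pairings of `w` and `w^*`. -/
noncomputable def bParam (lam : ℝ) (w : List Letter) : ℝ :=
  ∑ φ ∈ sphericalPairings ![w, starWord w], alpha lam φ

/-- `c'_w`: the sum of the volumes `α_φ` over the spherical pairings of two copies of `w`. -/
noncomputable def cParam (lam : ℝ) (w : List Letter) : ℝ :=
  ∑ φ ∈ sphericalPairings ![w, w], alpha lam φ

end BandCLT

/-! The proof is the method of moments applied to the genus expansion. Writing a trace as a sum over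
closed walks and applying Wick's formula to the Gaussian entries turns the expectation of a product
of k traces into a sum over admissible pairings of the polygon edges (`prod_integral_traceVar`). A
pairing φ contributes its `weight`: the number of labellings of the vertices of Γ_φ by indices,
neighbours lying in the band, divided by l^E. A spanning forest with C trees bounds this number by
N^C l^(V-C), and the Euler inequality V - E + k ≤ 2C (`card_vertex_add_le`) then bounds the weight
by (N l)^C / l^k (`weight_le`).

For a single face, C = 1. If the surface is a sphere, Γ_φ is a tree, it has exactly N l^E
labellings, and the weight is exactly N. Otherwise, the Euler characteristic being even, the weight
is smaller by a factor l^2. This is the first-order statement.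

For centred traces, inclusion-exclusion removes exactly the pairings that glue some face only to
itself (`prod_integral_centredTrace`), so 2C ≤ k. After scaling by (l/N)^(k/2), only pairings
joining the faces two by two can survive. This is used as an approximate Wick recursion
(`norm_recursion_le`): fix a face j₀ and subtract, for each other face j, the expectation over {j₀,
j} times the expectation over the rest. Both sides expand over the same pairings with the same
weights; the uncancelled ones have 2C < k, and their scaled weight is O(1/l). For k = 2, spherical
weights converge to the volumes α_φ, because a count of labellings is the volume of a union of cubes
of side 1/l filling the body (`tendsto_volume_cellUnion`), and the other weights vanish in the
limit.

A real linear functional of the trace combines the centred traces of w and w^*. Its moments satisfy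
in the limit the Gaussian recursion m_(k+2) = (k+1) v m_k, and a Taylor expansion of exp(ix) to even
order passes from moments to characteristic functions. The inequality c' ≤ b' says that the limiting
variance of the imaginary part is nonnegative. Finally, the growth hypothesis on b gives √(l/N) ·
N/l² = √(N/l³) → 0, which allows the mean to be replaced by a_w N. -/

namespace BandCLT

/-! ### Counting matchings -/

section Matchings

variable {A K : Type*}

/-- `φ` is an involution that exchanges the two values of `s` and preserves `κ`. -/
def Matches (s : A → Bool) (κ : A → K) (φ : Equiv.Perm A) : Prop :=
  (∀ a, φ (φ a) = a) ∧ ∀ a, s (φ a) = !s a ∧ κ (φ a) = κ a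

/-- The number of bijections between sets of `m` and `m'` elements. -/
def pairFactor (m m' : ℕ) : ℕ := if m = m' then m.factorial else 0

theorem card_equiv_eq_pairFactor (X Y : Type*) [Fintype X] [Fintype Y] [DecidableEq X]
    [DecidableEq Y] :
    Fintype.card (X ≃ Y) = pairFactor (Fintype.card X) (Fintype.card Y) := by
  unfold pairFactor
  split_ifs with h
  · exact Fintype.card_equiv (Fintype.equivOfCardEq h)
  · rw [Fintype.card_eq_zero_iff]
    exact ⟨fun e => h (Fintype.card_congr e)⟩

/-- A matching amounts to a bijection from the unstarred to the starred elements of every fibre. -/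
def matchesEquiv [DecidableEq K] (s : A → Bool) (κ : A → K) (Q : Finset K)
    (hQ : ∀ a, κ a ∈ Q) :
    {φ : Equiv.Perm A // Matches s κ φ} ≃
      ∀ q : Q, {a // s a = false ∧ κ a = q} ≃ {a // s a = true ∧ κ a = q} where
  toFun φ q :=
    { toFun := fun a => ⟨φ.1 a.1, by simp [(φ.2.2 a.1).1, (φ.2.2 a.1).2, a.2.1, a.2.2]⟩
      invFun := fun a => ⟨φ.1 a.1, by simp [(φ.2.2 a.1).1, (φ.2.2 a.1).2, a.2.1, a.2.2]⟩
      left_inv := fun a => Subtype.ext (φ.2.1 a.1)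
      right_inv := fun a => Subtype.ext (φ.2.1 a.1) }
  invFun σ := by
    let f : A → A := fun a =>
      if h : s a = false then (σ ⟨κ a, hQ a⟩ ⟨a, h, rfl⟩).1
      else ((σ ⟨κ a, hQ a⟩).symm ⟨a, by simpa using h, rfl⟩).1
    have hf0 : ∀ (q : Q) (a : {a // s a = false ∧ κ a = q}), f a.1 = (σ q a).1 := by
      rintro ⟨q, hq⟩ ⟨a, h, hk⟩
      obtain rfl : κ a = q := hk
      simp [f, h]
    have hf1 : ∀ (q : Q) (a : {a // s a = true ∧ κ a = q}), f a.1 = ((σ q).symm a).1 := by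
      rintro ⟨q, hq⟩ ⟨a, h, hk⟩
      obtain rfl : κ a = q := hk
      simp [f, h]
    have key : ∀ a, f (f a) = a ∧ s (f a) = !s a ∧ κ (f a) = κ a := by
      intro a
      rcases h : s a with _ | _
      · have e := hf0 ⟨κ a, hQ a⟩ ⟨a, h, rfl⟩
        simp only at e
        rw [e, hf1 ⟨κ a, hQ a⟩]
        simp [(σ ⟨κ a, hQ a⟩ ⟨a, h, rfl⟩).2.1, (σ ⟨κ a, hQ a⟩ ⟨a, h, rfl⟩).2.2]
      · have e := hf1 ⟨κ a, hQ a⟩ ⟨a, h, rfl⟩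
        simp only at e
        rw [e, hf0 ⟨κ a, hQ a⟩]
        simp [((σ ⟨κ a, hQ a⟩).symm ⟨a, h, rfl⟩).2.1, ((σ ⟨κ a, hQ a⟩).symm ⟨a, h, rfl⟩).2.2]
    exact ⟨⟨f, f, fun a => (key a).1, fun a => (key a).1⟩,
      fun a => (key a).1, fun a => (key a).2⟩
  left_inv φ := by
    apply Subtype.ext
    apply Equiv.ext
    intro a
    simp
  right_inv σ := by
    funext q
    obtain ⟨q, hq⟩ := q
    apply Equiv.ext
    rintro ⟨a, h, hk⟩
    obtain rfl : κ a = q := hk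
    apply Subtype.ext
    simp [h]

/-- The bijections in different fibres of κ are chosen independently. `Q` may be larger than the
range of κ: an empty fibre contributes 0! = 1. -/
theorem card_matches [Fintype A] [DecidableEq K] (s : A → Bool) (κ : A → K)
    (Q : Finset K) (hQ : ∀ a, κ a ∈ Q) :
    Nat.card {φ : Equiv.Perm A // Matches s κ φ} =
      ∏ q ∈ Q, pairFactor (Finset.univ.filter fun a => s a = false ∧ κ a = q).card
        (Finset.univ.filter fun a => s a = true ∧ κ a = q).card := by
  classical
  rw [Nat.card_congr (matchesEquiv s κ Q hQ), Nat.card_eq_fintype_card, Fintype.card_pi,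
    ← Finset.prod_coe_sort Q]
  refine Finset.prod_congr rfl fun q _ => ?_
  rw [card_equiv_eq_pairFactor, Fintype.card_subtype, Fintype.card_subtype]

end Matchings

/-! ### Moments of complex Gaussian variables -/

section Gaussian

/-- The density depends on the modulus only, which makes both polar integration and invariance under
rotations available for the moments. -/
theorem integral_stdComplexGaussian (f : ℂ → ℂ) (hf : AEStronglyMeasurable f stdComplexGaussian) :
    ∫ z, f z ∂stdComplexGaussian = ∫ z : ℂ, ((Real.pi⁻¹ * Real.exp (-‖z‖ ^ 2) : ℝ) : ℂ) * f z := by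
  have hmeas : Measurable fun p : ℝ × ℝ => (p.1 : ℂ) + (p.2 : ℂ) * Complex.I := by fun_prop
  unfold stdComplexGaussian at hf ⊢
  rw [integral_map hmeas.aemeasurable hf]
  have hv : (1 / 2 : NNReal) ≠ 0 := by norm_num
  rw [gaussianReal_of_var_ne_zero 0 hv, prod_withDensity (measurable_gaussianPDF _ _)
    (measurable_gaussianPDF _ _), integral_withDensity_eq_integral_toReal_smul
    (by fun_prop) (by
      refine Eventually.of_forall fun p => ?_
      exact ENNReal.mul_lt_top gaussianPDF_lt_top gaussianPDF_lt_top)]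
  rw [← Measure.volume_eq_prod, ← Complex.volume_preserving_equiv_real_prod.integral_comp
    (MeasurableEquiv.measurableEmbedding _)]
  refine integral_congr_ae (Eventually.of_forall fun z => ?_)
  simp only [Complex.measurableEquivRealProd_apply, ENNReal.toReal_mul, toReal_gaussianPDF,
    Complex.re_add_im, gaussianPDFReal_def, Complex.real_smul]
  congr 2
  have h2 : (2 * Real.pi * ((1 / 2 : NNReal) : ℝ)) = Real.pi := by push_cast; ring
  have h3 : (2 * ((1 / 2 : NNReal) : ℝ)) = 1 := by push_cast; ring
  rw [h2, h3]
  have h4 : ‖z‖ ^ 2 = z.re ^ 2 + z.im ^ 2 := by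
    rw [Complex.sq_norm, Complex.normSq_apply]; ring
  rw [h4, neg_add, Real.exp_add]
  have h5 : (√Real.pi)⁻¹ * (√Real.pi)⁻¹ = Real.pi⁻¹ := by
    rw [← mul_inv, Real.mul_self_sqrt Real.pi_pos.le]
  rw [← h5]
  simp only [sub_zero, div_one]
  ring

/-- The moments `E Z^m (conj Z)^m'` of a standard complex Gaussian variable. -/
theorem stdComplexGaussian_moment (m m' : ℕ) :
    ∫ z, z ^ m * (starRingEnd ℂ z) ^ m' ∂stdComplexGaussian = (pairFactor m m' : ℂ) := by
  have hcont : Continuous fun z : ℂ => z ^ m * (starRingEnd ℂ z) ^ m' :=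
    (continuous_pow m).mul (Complex.continuous_conj.pow m')
  rw [integral_stdComplexGaussian _ hcont.aestronglyMeasurable]
  unfold pairFactor
  split_ifs with h
  · subst h
    have h1 : ∀ z : ℂ, ((Real.pi⁻¹ * Real.exp (-‖z‖ ^ 2) : ℝ) : ℂ) * (z ^ m * (starRingEnd ℂ z) ^ m)
        = ((Real.pi⁻¹ * (‖z‖ ^ ((2 * m : ℕ) : ℝ) * Real.exp (-‖z‖ ^ (2 : ℝ))) : ℝ) : ℂ) := by
      intro z
      rw [← mul_pow, Complex.mul_conj, Real.rpow_natCast, pow_mul, Complex.sq_norm]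
      have : ‖z‖ ^ (2 : ℝ) = Complex.normSq z := by
        rw [← Complex.sq_norm]; norm_cast
      rw [this]
      push_cast
      ring
    simp_rw [h1]
    rw [integral_complex_ofReal, integral_const_mul,
      Complex.integral_rpow_mul_exp_neg_rpow (by norm_num) (by
        have : (0 : ℝ) ≤ ((2 * m : ℕ) : ℝ) := Nat.cast_nonneg _
        linarith)]
    have h2 : (((2 * m : ℕ) : ℝ) + 2) / 2 = (m : ℝ) + 1 := by push_cast; ring
    rw [h2, Real.Gamma_nat_eq_factorial]
    have := Real.pi_ne_zero
    push_cast
    field_simp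
  · -- invariance under the rotation `z ↦ c z` gives `I = c ^ m * conj c ^ m' * I`
    set I := ∫ z : ℂ, ((Real.pi⁻¹ * Real.exp (-‖z‖ ^ 2) : ℝ) : ℂ) * (z ^ m * (starRingEnd ℂ z) ^ m')
      with hI
    have hrot : ∀ c : Circle, I = (c : ℂ) ^ m * (starRingEnd ℂ (c : ℂ)) ^ m' * I := by
      intro c
      have := ((rotation c).measurePreserving).integral_comp'
        (f := (rotation c).toHomeomorph.toMeasurableEquiv)
        (fun z : ℂ => ((Real.pi⁻¹ * Real.exp (-‖z‖ ^ 2) : ℝ) : ℂ) *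
          (z ^ m * (starRingEnd ℂ z) ^ m'))
      conv_lhs => rw [hI, ← this]
      rw [hI, ← integral_const_mul]
      refine integral_congr_ae (Eventually.of_forall fun z => ?_)
      have hz : (rotation c).toHomeomorph.toMeasurableEquiv z = c * z := rotation_apply c z
      simp only [hz, norm_mul, Circle.norm_coe, one_mul, map_mul, mul_pow]
      ring
    have hc : ∀ x : ℝ, Complex.exp (((m : ℝ) - m' : ℝ) * x * Complex.I) * I = I := by
      intro x
      have := hrot (Circle.exp x)
      rw [Circle.coe_exp, ← Complex.exp_conj, map_mul, Complex.conj_ofReal, Complex.conj_I,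
        ← Complex.exp_nat_mul, ← Complex.exp_nat_mul, ← Complex.exp_add] at this
      conv_rhs => rw [this]
      congr 2
      push_cast
      ring
    have hne : ((m : ℝ) - m' : ℝ) ≠ 0 := sub_ne_zero.2 (by exact_mod_cast h)
    have hpi := hc (Real.pi / ((m : ℝ) - m'))
    rw [← Complex.ofReal_mul, mul_div_cancel₀ _ hne, Complex.exp_pi_mul_I] at hpi
    have : (2 : ℂ) * I = 0 := by linear_combination -hpi
    simpa using this

end Gaussian

/-! ### Variables with all moments -/

section AllMoments

variable {Ω : Type*} [MeasurableSpace Ω]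

/-- All absolute moments of `f` are finite. -/
def AllMoments (f : Ω → ℂ) (μ : Measure Ω) : Prop := ∀ p : ENNReal, p ≠ ⊤ → MemLp f p μ

variable {f g : Ω → ℂ} {μ : Measure Ω}

theorem AllMoments.integrable (hf : AllMoments f μ) : Integrable f μ :=
  memLp_one_iff_integrable.1 (hf 1 (by simp))

theorem AllMoments.aemeasurable (hf : AllMoments f μ) : AEMeasurable f μ :=
  hf.integrable.aemeasurable

/-- Hölder's inequality with exponents 2p, 2p; stability under products is the reason for asking for
all finite exponents at once. -/
theorem AllMoments.mul (hf : AllMoments f μ) (hg : AllMoments g μ) :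
    AllMoments (fun ω => f ω * g ω) μ := fun p hp => by
  have : ENNReal.HolderTriple (2 * p) (2 * p) p := ⟨by
    rw [ENNReal.mul_inv (by simp) (by simp), ← two_mul, ← mul_assoc,
      ENNReal.mul_inv_cancel (by simp) (by simp), one_mul]⟩
  have h2 : 2 * p ≠ ⊤ := ENNReal.mul_ne_top (by simp) hp
  exact (hg (2 * p) h2).mul' (hf (2 * p) h2)

theorem AllMoments.conj (hf : AllMoments f μ) :
    AllMoments (fun ω => starRingEnd ℂ (f ω)) μ := fun p hp => (hf p hp).star

theorem AllMoments.const [IsFiniteMeasure μ] (c : ℂ) : AllMoments (fun _ : Ω => c) μ :=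
  fun _ _ => memLp_const c

theorem AllMoments.sub_const [IsFiniteMeasure μ] (hf : AllMoments f μ) (c : ℂ) :
    AllMoments (fun ω => f ω - c) μ := fun p hp => (hf p hp).sub (memLp_const c)

theorem AllMoments.const_mul (hf : AllMoments f μ) (c : ℂ) :
    AllMoments (fun ω => c * f ω) μ := fun p hp => (hf p hp).const_mul c

theorem AllMoments.prod [IsFiniteMeasure μ] {ι : Type*} (s : Finset ι) {F : ι → Ω → ℂ}
    (hF : ∀ i ∈ s, AllMoments (F i) μ) : AllMoments (fun ω => ∏ i ∈ s, F i ω) μ := by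
  classical
  induction s using Finset.induction_on with
  | empty => simpa using AllMoments.const 1
  | insert a s ha ih =>
    simp only [Finset.prod_insert ha]
    exact (hF a (by simp)).mul (ih fun i hi => hF i (by simp [hi]))

theorem AllMoments.sum {ι : Type*} (s : Finset ι) {F : ι → Ω → ℂ}
    (hF : ∀ i ∈ s, AllMoments (F i) μ) : AllMoments (fun ω => ∑ i ∈ s, F i ω) μ :=
  fun p hp => memLp_finsetSum s fun i hi => hF i hi p hp

theorem allMoments_id_stdComplexGaussian : AllMoments (fun z => z) stdComplexGaussian := by
  intro p hp
  unfold stdComplexGaussian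
  have hmeas : Measurable fun p : ℝ × ℝ => (p.1 : ℂ) + (p.2 : ℂ) * Complex.I := by fun_prop
  rw [memLp_map_measure_iff (by fun_prop) hmeas.aemeasurable]
  have h := memLp_id_gaussianReal' (μ := 0) (v := 1 / 2) p hp
  have h1 : MemLp (fun q : ℝ × ℝ => q.1) p
      ((gaussianReal 0 (1 / 2)).prod (gaussianReal 0 (1 / 2))) :=
    h.comp_measurePreserving measurePreserving_fst
  have h2 : MemLp (fun q : ℝ × ℝ => q.2) p
      ((gaussianReal 0 (1 / 2)).prod (gaussianReal 0 (1 / 2))) :=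
    h.comp_measurePreserving measurePreserving_snd
  have h3 := (h1.ofReal (K := ℂ)).add ((h2.ofReal (K := ℂ)).const_mul Complex.I)
  refine h3.ae_eq (Eventually.of_forall fun q => ?_)
  simp [mul_comm]

end AllMoments

/-! ### Wick's formula -/

section Wick

/-- `z` or its conjugate. -/
noncomputable def conjIf (s : Bool) (z : ℂ) : ℂ := if s then starRingEnd ℂ z else z

variable {Ω : Type*} [MeasurableSpace Ω] {P : Measure Ω} {I A : Type*}
  {Z : I → Ω → ℂ}

theorem allMoments_of_hasLaw {X : Ω → ℂ} (h : HasLaw X stdComplexGaussian P) :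
    AllMoments X P := by
  intro p hp
  have := allMoments_id_stdComplexGaussian p hp
  rw [← h.map_eq, memLp_map_measure_iff (by fun_prop) h.aemeasurable] at this
  exact this

theorem AllMoments.conjIf {X : Ω → ℂ} (h : AllMoments X P) (s : Bool) :
    AllMoments (fun ω => conjIf s (X ω)) P := by
  cases s
  · simpa [BandCLT.conjIf] using h
  · simpa [BandCLT.conjIf] using h.conj

/-- The expectation of a product of independent standard complex Gaussian variables and their
conjugates. -/
theorem integral_prod_conjIf [DecidableEq I]
    (hlaw : ∀ q, HasLaw (Z q) stdComplexGaussian P) (hindep : iIndepFun Z P)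
    (s : A → Bool) (ι : A → I) (S : Finset A) (Q : Finset I) (hQ : ∀ a, ι a ∈ Q) :
    ∫ ω, ∏ a ∈ S, conjIf (s a) (Z (ι a) ω) ∂P =
      ∏ q ∈ Q, (pairFactor (S.filter fun a => s a = false ∧ ι a = q).card
        (S.filter fun a => s a = true ∧ ι a = q).card : ℂ) := by
  classical
  set m : I → ℕ := fun q => (S.filter fun a => s a = false ∧ ι a = q).card
  set m' : I → ℕ := fun q => (S.filter fun a => s a = true ∧ ι a = q).card
  let F : Q → ℂ → ℂ := fun q z => z ^ m q * (starRingEnd ℂ z) ^ m' q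
  have hF : ∀ q, Continuous (F q) := fun q =>
    (continuous_pow _).mul (Complex.continuous_conj.pow _)
  have h1 : ∀ ω, ∏ a ∈ S, conjIf (s a) (Z (ι a) ω) = ∏ q : Q, F q (Z q ω) := by
    intro ω
    rw [Finset.prod_coe_sort Q (fun q => Z q ω ^ m q * (starRingEnd ℂ (Z q ω)) ^ m' q),
      ← Finset.prod_fiberwise_of_maps_to (t := Q) (g := ι) (fun a _ => hQ a)]
    refine Finset.prod_congr rfl fun q _ => ?_
    rw [← Finset.prod_filter_mul_prod_filter_not _ (fun a => s a = false)]
    congr 1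
    · rw [Finset.filter_filter, Finset.prod_congr rfl (g := fun _ => Z q ω),
        Finset.prod_const]
      · congr 2
        ext a; simp [and_comm]
      · intro a ha
        simp only [Finset.mem_filter] at ha
        simp [conjIf, ha.2.1, ha.2.2]
    · rw [Finset.filter_filter, Finset.prod_congr rfl (g := fun _ => starRingEnd ℂ (Z q ω)),
        Finset.prod_const]
      · congr 2
        ext a; simp [and_comm]
      · intro a ha
        simp only [Finset.mem_filter, Bool.not_eq_false] at ha
        simp [conjIf, ha.2.1, ha.2.2]
  simp_rw [h1]
  have hi : iIndepFun (fun q : Q => Z q) P := hindep.precomp Subtype.val_injective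
  rw [hi.integral_fun_prod_comp (fun q => (hlaw q).aemeasurable)
    (fun q => (hF q).aestronglyMeasurable), ← Finset.prod_coe_sort Q]
  refine Finset.prod_congr rfl fun q _ => ?_
  have := (hlaw q).integral_comp (f := F q) (hF q).aestronglyMeasurable
  simp only [Function.comp_def] at this
  rw [this]
  exact stdComplexGaussian_moment _ _

/-- Wick's formula for a product of expectations: the product over `c` of the expectations of the
products of the variables of colour `c` is the number of matchings that respect the colours. -/
theorem prod_integral_prod_conjIf [Fintype A] {C : Type*} [Fintype C] [DecidableEq C]
    (hlaw : ∀ q, HasLaw (Z q) stdComplexGaussian P) (hindep : iIndepFun Z P)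
    (s : A → Bool) (ι : A → I) (col : A → C) :
    ∏ c, ∫ ω, ∏ a ∈ Finset.univ.filter (fun a => col a = c), conjIf (s a) (Z (ι a) ω) ∂P =
      (Nat.card {φ : Equiv.Perm A // Matches s (fun a => (col a, ι a)) φ} : ℂ) := by
  classical
  set Q : Finset I := Finset.univ.image ι
  have hQ : ∀ a, ι a ∈ Q := fun a => Finset.mem_image_of_mem _ (Finset.mem_univ a)
  rw [card_matches s (fun a => (col a, ι a)) (Finset.univ ×ˢ Q) (fun a => by simp [hQ]),
    Finset.prod_product, Nat.cast_prod]
  refine Finset.prod_congr rfl fun c _ => ?_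
  rw [integral_prod_conjIf hlaw hindep s ι _ Q hQ, Nat.cast_prod]
  refine Finset.prod_congr rfl fun q _ => ?_
  simp only [Finset.filter_filter, Prod.mk.injEq]
  congr 3 <;> (ext a; simp; tauto)

end Wick

/-! ### Traces of words as sums over closed walks -/

section Trace

/-- Sum over walks from x to y: `i` lists the intermediate points, so `Fin.cons x i` gives the start
of each step and `Fin.snoc i y` its end. -/
theorem list_prod_apply {ι R : Type*} [Fintype ι] [DecidableEq ι] [CommSemiring R] (n : ℕ)
    (M : Fin (n + 1) → Matrix ι ι R) (x y : ι) :
    (List.ofFn M).prod x y =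
      ∑ i : Fin n → ι, ∏ e : Fin (n + 1),
        M e ((Fin.cons x i : Fin (n + 1) → ι) e) ((Fin.snoc i y : Fin (n + 1) → ι) e) := by
  induction n generalizing x with
  | zero => simp [Fin.snoc]
  | succ n ih =>
    rw [List.ofFn_succ, List.prod_cons, Matrix.mul_apply,
      ← (Fin.consEquiv fun _ : Fin (n + 1) => ι).sum_comp, Fintype.sum_prod_type]
    refine Finset.sum_congr rfl fun z _ => ?_
    rw [ih (fun e => M e.succ) z, Finset.mul_sum]
    refine Finset.sum_congr rfl fun i _ => ?_
    have hs : (Fin.snoc (Fin.cons z i : Fin (n + 1) → ι) y : Fin (n + 1 + 1) → ι) =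
        Fin.cons z (Fin.snoc i y : Fin (n + 1) → ι) :=
      (Fin.cons_snoc_eq_snoc_cons z i y).symm
    change _ = ∏ e, M e ((Fin.cons x (Fin.cons z i : Fin (n + 1) → ι) : Fin (n + 1 + 1) → ι) e)
      ((Fin.snoc (Fin.cons z i : Fin (n + 1) → ι) y : Fin (n + 1 + 1) → ι) e)
    rw [hs, Fin.prod_univ_succ (n := n + 1)]
    simp only [Fin.cons_zero, Fin.cons_succ]

/-- Closing the walk turns the shift from start to end into `finRotate`. The empty product is
excluded: its trace is the size of ι, while the sum on the right is 1. -/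
theorem trace_list_prod {ι R : Type*} [Fintype ι] [DecidableEq ι] [CommSemiring R] {n : ℕ}
    (hn : n ≠ 0) (M : Fin n → Matrix ι ι R) :
    (List.ofFn M).prod.trace = ∑ i : Fin n → ι, ∏ e, M e (i e) (i (finRotate n e)) := by
  obtain ⟨n, rfl⟩ : ∃ m, n = m + 1 := Nat.exists_eq_succ_of_ne_zero hn
  rw [Matrix.trace, ← (Fin.consEquiv fun _ : Fin (n + 1) => ι).sum_comp, Fintype.sum_prod_type]
  refine Finset.sum_congr rfl fun x _ => ?_
  rw [Matrix.diag_apply, list_prod_apply]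
  refine Finset.sum_congr rfl fun i _ => Finset.prod_congr rfl fun e _ => ?_
  simp only [Fin.consEquiv_apply]
  congr 1
  refine Fin.lastCases ?_ (fun j => ?_) e
  · rw [Fin.snoc_last, finRotate_last]; rfl
  · rw [Fin.snoc_castSucc, finRotate_of_lt (by simp)]
    exact (Fin.cons_succ (α := fun _ => ι) x i j).symm

theorem cyclicDist_comm {n : ℕ} (i j : Fin n) : cyclicDist i j = cyclicDist j i := by
  simp [cyclicDist, Nat.dist_comm]

/-- The index of the Gaussian variable in the entry `(x, y)` of the matrix of a letter. -/
def entryIndex {N : ℕ} (a : Letter) (x y : Fin N) : ℕ × Fin N × Fin N :=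
  if a.starred then (a.index, y, x) else (a.index, x, y)

/-- The deterministic factor in the entry `(x, y)` of a band matrix. -/
noncomputable def bandCoeff {N : ℕ} (b : ℕ) (x y : Fin N) : ℝ :=
  1 / √(bandCount N b) * if cyclicDist x y ≤ b then 1 else 0

/-- The trace of a word in the band matrices with entries `Z`. -/
noncomputable def traceVar {N : ℕ} (b : ℕ) (z : ℕ × Fin N × Fin N → ℂ) (w : List Letter) : ℂ :=
  Matrix.trace (wordMatrix (fun r => bandMatrix b (fun i j => z (r, i, j))) w)

theorem traceVar_eq_sum {N b : ℕ} (z : ℕ × Fin N × Fin N → ℂ) {w : List Letter} (hw : w ≠ []) :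
    traceVar b z w = ∑ i : Fin w.length → Fin N, ∏ e,
      ((bandCoeff b (i e) (i (finRotate _ e)) : ℂ) *
        conjIf (w.get e).starred (z (entryIndex (w.get e) (i e) (i (finRotate _ e))))) := by
  have hl : w.length ≠ 0 := by simpa using hw
  set f : Letter → Matrix (Fin N) (Fin N) ℂ := fun a =>
    if a.starred then (bandMatrix b (fun i j => z (a.index, i, j)))ᴴ
      else bandMatrix b (fun i j => z (a.index, i, j)) with hf
  have h1 : w.map f = List.ofFn fun e => f (w.get e) := by
    conv_lhs => rw [← List.ofFn_get w]
    rw [List.map_ofFn]; rfl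
  rw [traceVar, wordMatrix, h1, trace_list_prod hl]
  refine Finset.sum_congr rfl fun i _ => Finset.prod_congr rfl fun e _ => ?_
  generalize w.get e = a
  generalize i (finRotate _ e) = y
  generalize i e = x
  simp only [hf, bandCoeff, entryIndex, conjIf, bandMatrix]
  cases a.starred
  · by_cases h : cyclicDist x y ≤ b <;> simp [h]
  · by_cases h : cyclicDist x y ≤ b <;> simp [h, cyclicDist_comm y x]

/-- Each face has its own sample `z j`, so that faces of different colours can later be given
independent copies of the entries. -/
theorem prod_traceVar_eq_sum {N b k : ℕ} {ws : Fin k → List Letter} (hws : ∀ j, ws j ≠ [])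
    (z : Fin k → ℕ × Fin N × Fin N → ℂ) :
    ∏ j, traceVar b (z j) (ws j) = ∑ i : Edge ws → Fin N,
      ((∏ e, bandCoeff b (i e) (i (next e)) : ℝ) : ℂ) *
        ∏ e, conjIf (label e).starred (z e.1 (entryIndex (label e) (i e) (i (next e)))) := by
  simp_rw [fun j => traceVar_eq_sum (b := b) (z j) (hws j)]
  rw [Finset.prod_univ_sum, Fintype.piFinset_univ,
    ← (Equiv.piCurry fun (j : Fin k) (_ : Fin (ws j).length) => Fin N).sum_comp]
  refine Finset.sum_congr rfl fun i _ => ?_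
  rw [Complex.ofReal_prod, ← Finset.prod_mul_distrib, Fintype.prod_sigma]
  rfl

end Trace

/-! ### The genus expansion -/

section Expansion

variable {k : ℕ} {ws : Fin k → List Letter}

open Classical in
/-- The number of labellings of the vertices of `Γ_φ` by indices with neighbours within cyclic
distance `b`; a labelling is considered as a function of the corners. -/
noncomputable def labelCount (N b : ℕ) (φ : Equiv.Perm (Edge ws)) : ℕ :=
  (Finset.univ.filter fun i : Edge ws → Fin N =>
    (∀ e, i (φ e) = i (next e)) ∧ ∀ e, cyclicDist (i e) (i (next e)) ≤ b).card

/-- The contribution of a pairing to the expectation of a product of traces. -/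
noncomputable def weight (N b : ℕ) (φ : Equiv.Perm (Edge ws)) : ℝ :=
  (1 / √(bandCount N b)) ^ Fintype.card (Edge ws) * labelCount N b φ

/-- A starred letter reads its entry transposed, so equality of the Gaussian indices of e and φ e
identifies the start of each edge with the end of the other: Wick's pairings are the
orientation-reversing gluings. As φ is an involution, one of the two identifications, required for
all e, implies the other. -/
theorem matches_entryIndex_iff {N : ℕ} {C : Type*} (col : Fin k → C) (i : Edge ws → Fin N)
    (φ : Equiv.Perm (Edge ws)) :
    Matches (fun e => (label e).starred)
      (fun e => (col e.1, entryIndex (label e) (i e) (i (next e)))) φ ↔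
      (IsAdmissible φ ∧ ∀ e, col (φ e).1 = col e.1) ∧ ∀ e, i (φ e) = i (next e) := by
  unfold Matches IsAdmissible
  simp only [Prod.mk.injEq]
  constructor
  · rintro ⟨h1, h2⟩
    have h3 : ∀ e, label (φ e) = (label e).star ∧ i (φ e) = i (next e) := by
      intro e
      obtain ⟨hs, -, he⟩ := h2 e
      have hs' : (label (φ e)).starred = (label e).star.starred := hs
      have he' : (label (φ e)).index = (label e).index ∧ i (φ e) = i (next e) := by
        cases h : (label e).starred
        · simp_all [entryIndex]
        · simp_all [entryIndex]
      refine ⟨?_, he'.2⟩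
      calc label (φ e) = ⟨(label (φ e)).index, (label (φ e)).starred⟩ := rfl
        _ = _ := by rw [he'.1, hs']; rfl
    exact ⟨⟨⟨h1, fun e => (h3 e).1⟩, fun e => (h2 e).2.1⟩, fun e => (h3 e).2⟩
  · rintro ⟨⟨⟨h1, h2⟩, h3⟩, h4⟩
    refine ⟨h1, fun e => ?_⟩
    have h5 : i (next (φ e)) = i e := by rw [← h4, h1]
    rw [h2, h3, h4, h5]
    cases h : (label e).starred <;> simp [Letter.star, entryIndex, h]

theorem prod_bandCoeff {N b : ℕ} (i : Edge ws → Fin N) :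
    ∏ e, bandCoeff b (i e) (i (next e)) = (1 / √(bandCount N b)) ^ Fintype.card (Edge ws) *
      if ∀ e, cyclicDist (i e) (i (next e)) ≤ b then 1 else 0 := by
  simp only [bandCoeff, Finset.prod_mul_distrib, Finset.prod_const, Finset.card_univ]
  congr 1
  split_ifs with h
  · exact Finset.prod_eq_one fun e _ => by simp [h e]
  · push Not at h
    obtain ⟨e, he⟩ := h
    exact Finset.prod_eq_zero (Finset.mem_univ e) (by simp [he])

variable {Ω : Type*} [MeasurableSpace Ω] {P : Measure Ω} [IsProbabilityMeasure P]

theorem prod_coloured {A C Ω : Type*} [Fintype C] [DecidableEq C] (S : Finset A) (col : A → C)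
    (g : A → Ω → ℂ) (x : C → Ω) :
    ∏ a ∈ S, g a (x (col a)) = ∏ c, ∏ a ∈ S.filter (fun a => col a = c), g a (x c) := by
  rw [← Finset.prod_fiberwise_of_maps_to (t := Finset.univ) (g := col)
    (fun a _ => Finset.mem_univ _)]
  refine Finset.prod_congr rfl fun c _ => Finset.prod_congr rfl fun a ha => ?_
  rw [(Finset.mem_filter.1 ha).2]

/-- A product of expectations over colour classes is an expectation over independent copies. -/
theorem integral_pi_coloured {A C : Type*} [Fintype C] [DecidableEq C] (S : Finset A)
    (col : A → C) (g : A → Ω → ℂ) :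
    ∫ x : C → Ω, ∏ a ∈ S, g a (x (col a)) ∂(Measure.pi fun _ => P) =
      ∏ c, ∫ ω, ∏ a ∈ S.filter (fun a => col a = c), g a ω ∂P := by
  simp_rw [prod_coloured S col g]
  exact integral_fintype_prod_eq_prod
    (fun (c : C) ω => ∏ a ∈ S.filter (fun a => col a = c), g a ω)

theorem integrable_pi_coloured {A C : Type*} [Fintype C] [DecidableEq C] (S : Finset A)
    (col : A → C) {g : A → Ω → ℂ} (hg : ∀ a, AllMoments (g a) P) :
    Integrable (fun x : C → Ω => ∏ a ∈ S, g a (x (col a))) (Measure.pi fun _ => P) := by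
  simp_rw [prod_coloured S col g]
  exact Integrable.fintype_prod
    (f := fun (c : C) ω => ∏ a ∈ S.filter (fun a => col a = c), g a ω)
    fun c => (AllMoments.prod _ fun a _ => hg a).integrable

variable {N b : ℕ} {Z : ℕ × Fin N × Fin N → Ω → ℂ}

theorem allMoments_traceVar (hlaw : ∀ q, HasLaw (Z q) stdComplexGaussian P) {w : List Letter}
    (hw : w ≠ []) : AllMoments (fun ω => traceVar b (fun q => Z q ω) w) P := by
  simp_rw [fun ω => traceVar_eq_sum (b := b) (fun q => Z q ω) hw]
  refine AllMoments.sum _ fun i _ => AllMoments.prod _ fun e _ => AllMoments.const_mul ?_ _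
  exact (allMoments_of_hasLaw (hlaw _)).conjIf _

open Classical in
/-- The genus expansion for a product of expectations of products of traces. -/
theorem prod_integral_traceVar (hws : ∀ j, ws j ≠ [])
    (hlaw : ∀ q, HasLaw (Z q) stdComplexGaussian P) (hindep : iIndepFun Z P)
    {C : Type*} [Fintype C] [DecidableEq C] (col : Fin k → C) :
    ∏ c, ∫ ω, ∏ j ∈ Finset.univ.filter (fun j => col j = c),
        traceVar b (fun q => Z q ω) (ws j) ∂P =
      ∑ φ : Equiv.Perm (Edge ws), if IsAdmissible φ ∧ ∀ e, col (φ e).1 = col e.1 then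
        (weight N b φ : ℂ) else 0 := by
  rw [← integral_pi_coloured Finset.univ col
    (fun j ω => traceVar b (fun q => Z q ω) (ws j))]
  simp_rw [fun x : C → Ω => prod_traceVar_eq_sum (b := b) hws (fun j q => Z q (x (col j)))]
  rw [integral_finsetSum]
  · simp_rw [integral_const_mul]
    have h1 : ∀ i : Edge ws → Fin N,
        ∫ x : C → Ω, ∏ e, conjIf (label e).starred
          (Z (entryIndex (label e) (i e) (i (next e))) (x (col e.1))) ∂(Measure.pi fun _ => P) =
        ∑ φ : Equiv.Perm (Edge ws), if (IsAdmissible φ ∧ ∀ e, col (φ e).1 = col e.1) ∧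
          ∀ e, i (φ e) = i (next e) then (1 : ℂ) else 0 := by
      intro i
      rw [integral_pi_coloured Finset.univ (fun e : Edge ws => col e.1)
        (fun e ω => conjIf (label e).starred (Z (entryIndex (label e) (i e) (i (next e))) ω)),
        prod_integral_prod_conjIf hlaw hindep (fun e : Edge ws => (label e).starred)
          (fun e => entryIndex (label e) (i e) (i (next e))) (fun e => col e.1)]
      simp_rw [matches_entryIndex_iff]
      rw [Nat.card_eq_fintype_card, Fintype.card_subtype, Finset.sum_boole]
    simp_rw [h1, Finset.mul_sum]
    rw [Finset.sum_comm]
    refine Finset.sum_congr rfl fun φ _ => ?_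
    split_ifs with h
    · simp only [h, true_and]
      simp_rw [prod_bandCoeff]
      rw [weight, labelCount, ← Finset.sum_boole, Complex.ofReal_mul, Complex.ofReal_sum,
        Finset.mul_sum]
      refine Finset.sum_congr rfl fun i _ => ?_
      by_cases h2 : ∀ e, i (φ e) = i (next e) <;>
        by_cases h3 : ∀ e, cyclicDist (i e) (i (next e)) ≤ b <;> simp [h2, h3]
    · simp [h]
  · intro i _
    refine Integrable.const_mul ?_ _
    exact integrable_pi_coloured Finset.univ (fun e : Edge ws => col e.1)
      (fun e => (allMoments_of_hasLaw (hlaw _)).conjIf _)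

/-! ### Centred traces and pairings without isolated faces. -/

/-- No face is glued to itself only. -/
def NoIsolatedFace (φ : Equiv.Perm (Edge ws)) : Prop :=
  ∀ j, ∃ e : Edge ws, e.1 = j ∧ (φ e).1 ≠ j

/-- The centred trace of a word. -/
noncomputable def centredTrace (P : Measure Ω) (b : ℕ) (Z : ℕ × Fin N × Fin N → Ω → ℂ)
    (w : List Letter) (ω : Ω) : ℂ :=
  traceVar b (fun q => Z q ω) w - ∫ ω', traceVar b (fun q => Z q ω') w ∂P

/-- Giving each face of `U` a private colour forces it to be glued to itself. The other faces then
cannot be glued to `U`, because φ is an involution. -/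
theorem respects_split_iff {C : Type*} (col : Fin k → C) (U : Finset (Fin k))
    {φ : Equiv.Perm (Edge ws)} (hφ : ∀ e, φ (φ e) = e) :
    (∀ e, (if (φ e).1 ∈ U then Sum.inr (φ e).1 else Sum.inl (col (φ e).1) : C ⊕ Fin k) =
      if e.1 ∈ U then Sum.inr e.1 else Sum.inl (col e.1)) ↔
    (∀ e, col (φ e).1 = col e.1) ∧ ∀ j ∈ U, ∀ e : Edge ws, e.1 = j → (φ e).1 = j := by
  constructor
  · intro h
    refine ⟨fun e => ?_, ?_⟩
    · have := h e
      split_ifs at this with h1 h2 <;> simp_all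
    · rintro j hj e rfl
      have := h e
      split_ifs at this with h1
      · simp_all
  · rintro ⟨h1, h2⟩ e
    by_cases he : e.1 ∈ U
    · have := h2 _ he e rfl
      simp [this, he]
    · have : (φ e).1 ∉ U := fun h3 => by
        have := h2 _ h3 (φ e) rfl
        rw [hφ] at this
        exact he (this ▸ h3)
      simp [this, he, h1]

open Classical in
/-- The genus expansion for a product of expectations of products of centred traces: the pairings
with isolated faces cancel. -/
theorem prod_integral_centredTrace (hws : ∀ j, ws j ≠ [])
    (hlaw : ∀ q, HasLaw (Z q) stdComplexGaussian P) (hindep : iIndepFun Z P)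
    {C : Type*} [Fintype C] [DecidableEq C] (col : Fin k → C) :
    ∏ c, ∫ ω, ∏ j ∈ Finset.univ.filter (fun j => col j = c), centredTrace P b Z (ws j) ω ∂P =
      ∑ φ : Equiv.Perm (Edge ws),
        if (IsAdmissible φ ∧ ∀ e, col (φ e).1 = col e.1) ∧ NoIsolatedFace φ then
          (weight N b φ : ℂ) else 0 := by
  set T : Fin k → Ω → ℂ := fun j ω => traceVar b (fun q => Z q ω) (ws j) with hT
  set m : Fin k → ℂ := fun j => ∫ ω, T j ω ∂P with hm
  have hmom : ∀ j, AllMoments (T j) P := fun j => allMoments_traceVar hlaw (hws j)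
  rw [← integral_pi_coloured Finset.univ col (fun j ω => centredTrace P b Z (ws j) ω)]
  have h1 : ∀ x : C → Ω, ∏ j, centredTrace P b Z (ws j) (x (col j)) =
      ∑ U ∈ Finset.univ.powerset, ((-1) ^ U.card * ∏ j ∈ U, m j) *
        ∏ j ∈ Finset.univ \ U, T j (x (col j)) := by
    intro x
    have : ∀ j, centredTrace P b Z (ws j) (x (col j)) = -1 * m j + T j (x (col j)) := by
      intro j; simp [centredTrace, hm, hT]; ring
    simp_rw [this]
    rw [Finset.prod_add]
    refine Finset.sum_congr rfl fun U _ => ?_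
    rw [Finset.prod_mul_distrib, Finset.prod_const]
  simp_rw [h1]
  rw [integral_finsetSum _ fun U _ =>
    (integrable_pi_coloured (Finset.univ \ U) col hmom).const_mul _]
  simp_rw [integral_const_mul]
  have h2 : ∀ U : Finset (Fin k), ((-1 : ℂ) ^ U.card * ∏ j ∈ U, m j) *
      ∫ x : C → Ω, ∏ j ∈ Finset.univ \ U, T j (x (col j)) ∂(Measure.pi fun _ => P) =
      (-1) ^ U.card * ∑ φ : Equiv.Perm (Edge ws), if IsAdmissible φ ∧
        ((∀ e, col (φ e).1 = col e.1) ∧ ∀ j ∈ U, ∀ e : Edge ws, e.1 = j → (φ e).1 = j) then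
        (weight N b φ : ℂ) else 0 := by
    intro U
    rw [mul_assoc]
    congr 1
    rw [integral_pi_coloured]
    -- With private colours for the faces of `U`, their expectations split off as the factors `m j`;
    -- the remaining faces keep their colours.
    have h3 := prod_integral_traceVar (b := b) hws hlaw hindep
      (fun j => (if j ∈ U then Sum.inr j else Sum.inl (col j) : C ⊕ Fin k))
    rw [Fintype.prod_sum_type] at h3
    have h4 : ∀ φ : Equiv.Perm (Edge ws), (IsAdmissible φ ∧ ∀ e,
        (if (φ e).1 ∈ U then Sum.inr (φ e).1 else Sum.inl (col (φ e).1) : C ⊕ Fin k) =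
          if e.1 ∈ U then Sum.inr e.1 else Sum.inl (col e.1)) ↔ IsAdmissible φ ∧
        ((∀ e, col (φ e).1 = col e.1) ∧ ∀ j ∈ U, ∀ e : Edge ws, e.1 = j → (φ e).1 = j) :=
      fun φ => and_congr_right fun h => respects_split_iff col U h.1
    simp_rw [h4] at h3
    rw [← h3, mul_comm]
    congr 1
    · refine Finset.prod_congr rfl fun c _ => ?_
      congr 1
      funext ω
      refine Finset.prod_congr ?_ fun _ _ => rfl
      ext j
      by_cases hj : j ∈ U <;> simp [hj]
    · rw [← Finset.prod_subset (Finset.subset_univ U)]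
      · refine Finset.prod_congr rfl fun j hj => ?_
        have : (Finset.univ.filter fun i =>
            (if i ∈ U then Sum.inr i else Sum.inl (col i) : C ⊕ Fin k) = Sum.inr j) = {j} := by
          ext i
          by_cases hi : i ∈ U
          · simp [hi]
          · simp [hi]
            rintro rfl; exact hi hj
        rw [this]
        simp [hm, hT]
      · intro j _ hj
        have : (Finset.univ.filter fun i =>
            (if i ∈ U then Sum.inr i else Sum.inl (col i) : C ⊕ Fin k) = Sum.inr j) = ∅ := by
          ext i
          by_cases hi : i ∈ U
          · simp only [hi, if_true, Sum.inr.injEq, Finset.mem_filter, Finset.mem_univ, true_and,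
              Finset.notMem_empty, iff_false]
            rintro rfl; exact hj hi
          · simp [hi]
        rw [this]
        simp
  simp_rw [h2, Finset.mul_sum]
  rw [Finset.sum_comm]
  refine Finset.sum_congr rfl fun φ _ => ?_
  by_cases hA : IsAdmissible φ ∧ ∀ e, col (φ e).1 = col e.1
  · set Iso : Finset (Fin k) :=
      Finset.univ.filter fun j => ∀ e : Edge ws, e.1 = j → (φ e).1 = j with hIso
    have h5 : ∀ U : Finset (Fin k), (IsAdmissible φ ∧
        ((∀ e, col (φ e).1 = col e.1) ∧ ∀ j ∈ U, ∀ e : Edge ws, e.1 = j → (φ e).1 = j)) ↔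
        U ⊆ Iso := by
      intro U
      simp only [hA.1, hA.2, true_and, implies_true, hIso, Finset.subset_iff, Finset.mem_filter,
        Finset.mem_univ]
    simp_rw [h5, mul_ite, mul_zero]
    rw [← Finset.sum_filter]
    have h6 : (Finset.univ.powerset.filter fun U => U ⊆ Iso) = Iso.powerset := by
      ext U; simp
    have h7 : Iso = ∅ ↔ NoIsolatedFace φ := by
      simp only [hIso, Finset.filter_eq_empty_iff, NoIsolatedFace, Finset.mem_univ, true_implies]
      push Not
      rfl
    -- For a fixed φ the sets `U` that occur are the subsets of its set of isolated faces, so the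
    -- alternating sum vanishes unless there are none.
    have h8 := Finset.sum_powerset_neg_one_pow_card (x := Iso)
    rw [h6, ← Finset.sum_mul]
    have h9 : ∑ U ∈ Iso.powerset, (-1 : ℂ) ^ U.card = if Iso = ∅ then 1 else 0 := by
      have := congrArg (Int.cast : ℤ → ℂ) h8
      push_cast at this
      exact this
    rw [h9]
    by_cases hN : NoIsolatedFace φ
    · rw [if_pos (h7.2 hN), if_pos ⟨hA, hN⟩, one_mul]
    · rw [if_neg fun h => hN (h7.1 h), if_neg fun h => hN h.2, zero_mul]
  · have h5 : ∀ U : Finset (Fin k), ¬ (IsAdmissible φ ∧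
        ((∀ e, col (φ e).1 = col e.1) ∧ ∀ j ∈ U, ∀ e : Edge ws, e.1 = j → (φ e).1 = j)) :=
      fun U h => hA ⟨h.1, h.2.1⟩
    rw [if_neg fun h => hA h.1]
    simp [h5]

end Expansion

/-! ### Topology of the glued surface -/

section Topology

/-- The parity of a permutation in terms of the number of its orbits. -/
theorem sign_eq_neg_one_pow_card_quot {A : Type*} [Fintype A] [DecidableEq A]
    (σ : Equiv.Perm A) :
    Equiv.Perm.sign σ = (-1) ^ (Fintype.card A + Nat.card (Quot fun x y => y = σ x)) := by
  classical
  -- An orbit is either a fixed point or the support of one of the cycle factors; `K` induces this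
  -- bijection on orbits.
  let K : A → {x // σ x = x} ⊕ σ.cycleFactorsFinset := fun x =>
    if h : σ x = x then Sum.inl ⟨x, h⟩
    else Sum.inr ⟨σ.cycleOf x, Equiv.Perm.cycleOf_mem_cycleFactorsFinset_iff.2
      (Equiv.Perm.mem_support.2 h)⟩
  have hK : ∀ x y, y = σ x → K x = K y := by
    rintro x y rfl
    by_cases h : σ x = x
    · rw [h]
    · have h' : ¬ σ (σ x) = σ x := fun h' => h (σ.injective h')
      simp only [K, h, h', dif_neg, not_false_eq_true, Sum.inr.injEq, Subtype.mk.injEq]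
      exact Equiv.Perm.SameCycle.cycleOf_eq (Equiv.Perm.SameCycle.refl σ x).apply_right
  have hpow : ∀ (n : ℕ) (x : A), (Quot.mk (fun x y => y = σ x) ((σ ^ n) x)) = Quot.mk _ x := by
    intro n x
    induction n with
    | zero => simp
    | succ n ih =>
      rw [← ih, pow_succ', Equiv.Perm.mul_apply]
      symm
      apply Quot.sound
      rfl
  have hcard : Nat.card (Quot fun x y => y = σ x) =
      Nat.card ({x // σ x = x} ⊕ σ.cycleFactorsFinset) := by
    refine Nat.card_eq_of_bijective (Quot.lift K hK) ⟨?_, ?_⟩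
    · intro u v huv
      obtain ⟨x, rfl⟩ := Quot.exists_rep u
      obtain ⟨y, rfl⟩ := Quot.exists_rep v
      change K x = K y at huv
      by_cases hx : σ x = x <;> by_cases hy : σ y = y <;> simp only [K, hx, hy, dif_pos, dif_neg,
        not_false_eq_true, Sum.inl.injEq, Subtype.mk.injEq, Sum.inr.injEq, reduceCtorEq] at huv
      · rw [huv]
      · have := (Equiv.Perm.sameCycle_iff_cycleOf_eq_of_mem_support
          (Equiv.Perm.mem_support.2 hx) (Equiv.Perm.mem_support.2 hy)).2 huv
        obtain ⟨n, -, -, rfl⟩ := this.exists_pow_eq''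
        exact (hpow n x).symm
    · rintro (⟨x, hx⟩ | ⟨c, hc⟩)
      · exact ⟨Quot.mk _ x, dif_pos hx⟩
      · obtain ⟨x, hx⟩ := (Equiv.Perm.mem_cycleFactorsFinset_iff.1 hc).1.nonempty_support
        have hxc := Equiv.Perm.cycle_is_cycleOf hx hc
        have hx' : ¬ σ x = x := by
          rw [← ne_eq, ← Equiv.Perm.mem_support, ← Equiv.Perm.cycleOf_mem_cycleFactorsFinset_iff, ← hxc]
          exact hc
        refine ⟨Quot.mk _ x, ?_⟩
        change K x = _
        simp [K, hx', ← hxc]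
  have hcyc : σ.cycleType.card = σ.cycleFactorsFinset.card := by
    rw [Equiv.Perm.cycleType_def, Multiset.card_map]; rfl
  have hsupp : (Finset.univ.filter fun x => σ x = x).card + σ.support.card = Fintype.card A := by
    rw [← Finset.card_univ]
    exact Finset.card_filter_add_card_filter_not (fun x => σ x = x)
  rw [Equiv.Perm.sign_of_cycleType, Equiv.Perm.sum_cycleType, hcard, ← hsupp, Nat.card_sum,
    Nat.card_eq_fintype_card, Nat.card_eq_fintype_card, Fintype.card_subtype, Fintype.card_coe,
    hcyc]
  generalize σ.support.card = a
  generalize σ.cycleFactorsFinset.card = c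
  generalize (Finset.univ.filter fun x => σ x = x).card = d
  -- With d fixed points, support of size a and c nontrivial cycles, the sign is (-1)^(a+c), while
  -- the size of A plus the number of orbits is (d+a) + (d+c).
  have : d + a + (d + c) = a + c + (d + d) := by ring
  rw [this, pow_add _ (a + c), Even.neg_one_pow (n := d + d) ⟨d, rfl⟩, mul_one]

theorem even_iff_of_neg_one_pow_eq {m n : ℕ} (h : (-1 : ℤˣ) ^ m = (-1) ^ n) :
    Even m ↔ Even n := by
  rcases Nat.even_or_odd m with hm | hm <;> rcases Nat.even_or_odd n with hn | hn
  · simp [hm, hn]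
  · rw [hm.neg_one_pow, hn.neg_one_pow] at h
    exact absurd h (by decide)
  · rw [hm.neg_one_pow, hn.neg_one_pow] at h
    exact absurd h (by decide)
  · simp [Nat.not_even_iff_odd.2 hm, Nat.not_even_iff_odd.2 hn]

variable {k : ℕ} {ws : Fin k → List Letter}

/-- Going to the next edge, as a permutation. -/
def nextPerm : Equiv.Perm (Edge ws) := Equiv.sigmaCongrRight fun j => finRotate (ws j).length

/-- The rotation of a polygon is transitive on its edges. -/
theorem eq_of_next_invariant {α : Type*} {f : Edge ws → α} (hf : ∀ e, f (next e) = f e)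
    {e e' : Edge ws} (h : e.1 = e'.1) : f e = f e' := by
  obtain ⟨j, x⟩ := e
  obtain ⟨j', x'⟩ := e'
  obtain rfl : j = j' := h
  have key : ∀ (n : ℕ) (g : Fin n → α), (∀ x, g (finRotate n x) = g x) → ∀ x x', g x = g x' := by
    intro n g hg x x'
    cases n with
    | zero => exact x.elim0
    | succ n =>
      have h0 : ∀ x, g x = g 0 := by
        intro x
        induction x using Fin.induction with
        | zero => rfl
        | succ i ih =>
          rw [← ih, ← hg i.castSucc, finRotate_of_lt (by simp)]
          rfl
      rw [h0, h0 x']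
  exact key _ (fun x => f ⟨j, x⟩) (fun x => hf ⟨j, x⟩) x x'

variable {φ : Equiv.Perm (Edge ws)}

theorem IsAdmissible.apply_ne (h : IsAdmissible φ) (e : Edge ws) : φ e ≠ e := fun he => by
  have := h.2 e
  rw [he] at this
  have := congrArg Letter.starred this
  simp [Letter.star] at this

theorem vertex_next (e : Edge ws) :
    (Quot.mk _ (next (φ e)) : Vertex φ) = Quot.mk _ e := by
  symm; apply Quot.sound; rfl

theorem vertex_apply (h : IsAdmissible φ) (e : Edge ws) :
    (Quot.mk _ (φ e) : Vertex φ) = Quot.mk _ (next e) := by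
  rw [← vertex_next (φ e), h.1]

theorem component_next (e : Edge ws) :
    (Quot.mk _ (next e) : Component φ) = Quot.mk _ e := by
  symm; apply Quot.sound; exact Or.inl rfl

theorem component_apply (e : Edge ws) :
    (Quot.mk _ (φ e) : Component φ) = Quot.mk _ e := by
  symm; apply Quot.sound; exact Or.inr rfl

theorem component_eq_of_fst_eq {e e' : Edge ws} (h : e.1 = e'.1) :
    (Quot.mk _ e : Component φ) = Quot.mk _ e' :=
  eq_of_next_invariant (f := fun e => (Quot.mk _ e : Component φ)) component_next h

theorem surfaceEdge_eq_iff (h : IsAdmissible φ) (e e' : Edge ws) :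
    (Quot.mk _ e : SurfaceEdge φ) = Quot.mk _ e' ↔ e' = e ∨ e' = φ e := by
  constructor
  · intro he
    have := Quot.eqvGen_exact he
    clear he
    induction this with
    | rel x y h => exact Or.inr h
    | refl x => exact Or.inl rfl
    | symm x y _ ih =>
      rcases ih with rfl | rfl
      · exact Or.inl rfl
      · exact Or.inr (h.1 _).symm
    | trans x y z _ _ h1 h2 =>
      rcases h1 with rfl | rfl <;> rcases h2 with rfl | rfl <;> simp [h.1]
  · rintro (rfl | rfl)
    · rfl
    · exact Quot.sound rfl

noncomputable instance : Fintype (SurfaceEdge φ) := Fintype.ofFinite _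
noncomputable instance : Fintype (Component φ) := Fintype.ofFinite _

theorem two_mul_card_surfaceEdge (h : IsAdmissible φ) :
    2 * Nat.card (SurfaceEdge φ) = Fintype.card (Edge ws) := by
  classical
  rw [Nat.card_eq_fintype_card, ← Finset.card_univ (α := Edge ws), Finset.card_eq_sum_card_fiberwise
    (f := fun e => (Quot.mk _ e : SurfaceEdge φ)) (t := Finset.univ) (fun _ _ => Finset.mem_univ _)]
  rw [Finset.sum_const_nat (m := 2), Finset.card_univ, mul_comm]
  intro s _
  obtain ⟨e, rfl⟩ := Quot.exists_rep s
  have : (Finset.univ.filter fun e' => (Quot.mk _ e' : SurfaceEdge φ) = Quot.mk _ e) = {e, φ e} := by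
    ext e'
    simp only [Finset.mem_filter, Finset.mem_univ, true_and, Finset.mem_insert,
      Finset.mem_singleton]
    rw [eq_comm, surfaceEdge_eq_iff h]
  rw [this, Finset.card_pair (h.apply_ne e).symm]

theorem fst_surjective (hws : ∀ j, ws j ≠ []) (j : Fin k) : ∃ e : Edge ws, e.1 = j :=
  ⟨⟨j, ⟨0, List.length_pos_iff.2 (hws j)⟩⟩, rfl⟩

/-- The Euler characteristic is even. -/
theorem even_card_vertex_add (hws : ∀ j, ws j ≠ []) (h : IsAdmissible φ) :
    Even (Nat.card (Vertex φ) + Nat.card (SurfaceEdge φ) + k) := by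
  -- Vertices, surface edges and faces are the orbits of `nextPerm * φ`, φ and `nextPerm`.
  -- Multiplicativity of the sign relates the three parities, and the number of polygon edges, 2E,
  -- is even.
  have h1 := sign_eq_neg_one_pow_card_quot (nextPerm * φ)
  have h2 := sign_eq_neg_one_pow_card_quot φ
  have h3 := sign_eq_neg_one_pow_card_quot (nextPerm (ws := ws))
  have hk : Nat.card (Quot fun x y : Edge ws => y = nextPerm x) = k := by
    refine Eq.trans ?_ (Nat.card_fin k)
    refine Nat.card_eq_of_bijective
      (Quot.lift (fun e : Edge ws => e.1) (fun x y hxy => by rw [hxy]; rfl)) ⟨?_, ?_⟩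
    · intro a b hab
      obtain ⟨x, rfl⟩ := Quot.exists_rep a
      obtain ⟨y, rfl⟩ := Quot.exists_rep b
      exact eq_of_next_invariant (f := fun e => Quot.mk (fun x y : Edge ws => y = nextPerm x) e)
        (fun e => by symm; apply Quot.sound; rfl) hab
    · intro j
      obtain ⟨e, he⟩ := fst_surjective hws j
      exact ⟨Quot.mk _ e, he⟩
  rw [hk] at h3
  rw [map_mul, h2, h3, ← pow_add] at h1
  have h4 := even_iff_of_neg_one_pow_eq h1
  have h5 := two_mul_card_surfaceEdge h
  have h6 : Even (Fintype.card (Edge ws)) := ⟨_, by rw [← h5, two_mul]⟩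
  change Even (Fintype.card (Edge ws) + k +
    (Fintype.card (Edge ws) + Nat.card (SurfaceEdge φ))) ↔
    Even (Fintype.card (Edge ws) + Nat.card (Vertex φ)) at h4
  simp only [Nat.even_add, h6, true_iff] at h4 ⊢
  tauto

/-- The genus is nonnegative: `V - E + F ≤ 2 C`. The proof shows the injectivity of a linear map
between spaces of functions on the cells of the surface. -/
theorem card_vertex_add_le (hws : ∀ j, ws j ≠ []) (h : IsAdmissible φ) :
    Nat.card (Vertex φ) + k ≤ Nat.card (SurfaceEdge φ) + 2 * Nat.card (Component φ) := by
  classical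
  let mkV : Edge ws → Vertex φ := fun e => Quot.mk _ e
  -- A discrete Cauchy-Riemann operator: the increment of a vertex function along an edge plus the
  -- jump of a face function across it. It is antisymmetric under φ, so one representative per
  -- surface edge determines it; the two component coordinates of `L` fix the additive constants.
  let d (p : (Vertex φ → ℚ) × (Fin k → ℚ)) (e : Edge ws) : ℚ :=
    (p.1 (mkV (next e)) - p.1 (mkV e)) + (p.2 e.1 - p.2 (φ e).1)
  let L : ((Vertex φ → ℚ) × (Fin k → ℚ)) →ₗ[ℚ]
      ((SurfaceEdge φ → ℚ) × (Component φ → ℚ) × (Component φ → ℚ)) :=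
    { toFun := fun p => (fun s => d p s.out, fun c => p.1 (mkV c.out), fun c => p.2 c.out.1)
      map_add' := fun p q => by
        ext <;> simp [d]
        ring
      map_smul' := fun r p => by
        ext <;> simp [d]
        ring }
  have hinj : Function.Injective L := by
    rw [injective_iff_map_eq_zero]
    intro p hp
    obtain ⟨f, g⟩ := p
    have h1 : ∀ s : SurfaceEdge φ, d (f, g) s.out = 0 := fun s =>
      congrFun (congrArg Prod.fst hp) s
    have h2 : ∀ c : Component φ, f (mkV c.out) = 0 := fun c =>
      congrFun (congrArg (fun q => q.2.1) hp) c
    have h3 : ∀ c : Component φ, g c.out.1 = 0 := fun c =>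
      congrFun (congrArg (fun q => q.2.2) hp) c
    have hV1 : ∀ e, mkV (next (φ e)) = mkV e := vertex_next
    have hV2 : ∀ e, mkV (φ e) = mkV (next e) := vertex_apply h
    have hanti : ∀ e, d (f, g) (φ e) = -d (f, g) e := by
      intro e
      simp only [d, hV1, hV2, h.1]
      ring
    have hd : ∀ e, d (f, g) e = 0 := by
      intro e
      rcases (surfaceEdge_eq_iff h _ _).1 (Quot.out_eq (Quot.mk _ e : SurfaceEdge φ)) with he | he
      · rw [he]; exact h1 _
      · rw [he, hanti, h1, neg_zero]
    set a : Edge ws → ℚ := fun e => f (mkV (next e)) - f (mkV e) with ha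
    have haφ : ∀ e, a (φ e) = -a e := by
      intro e; simp only [ha, hV1, hV2]; ring
    have ha2 : ∀ e, a e = -(g e.1 - g (φ e).1) := fun e => by
      have := hd e
      simp only [d] at this
      simp only [ha]; linarith
    -- The increments of f around each polygon sum to zero, so df is orthogonal to every function of
    -- the face. If d vanishes, df is minus the jump of g, hence orthogonal to itself.
    have hag : ∑ e, a e * g e.1 = 0 := by
      simp only [ha, sub_mul, Finset.sum_sub_distrib]
      rw [sub_eq_zero]
      exact Equiv.sum_comp (nextPerm (ws := ws)) (fun e => f (mkV e) * g e.1)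
    have hag' : ∑ e, a e * g (φ e).1 = 0 := by
      rw [← Equiv.sum_comp φ]
      simp only [haφ, h.1, neg_mul, Finset.sum_neg_distrib, hag, neg_zero]
    have hsq : ∑ e, a e * a e = 0 := by
      have : ∀ e, a e * a e = a e * g (φ e).1 - a e * g e.1 := fun e => by
        conv_lhs => rw [ha2 e]
        conv_rhs => rw [ha2 e]
        ring
      simp_rw [this]
      rw [Finset.sum_sub_distrib, hag, hag', sub_zero]
    have ha0 : ∀ e, a e = 0 := fun e => by
      have := (Finset.sum_eq_zero_iff_of_nonneg (fun e _ => mul_self_nonneg (a e))).1 hsq e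
        (Finset.mem_univ e)
      simpa using this
    have hf1 : ∀ e, f (mkV (next e)) = f (mkV e) := fun e => sub_eq_zero.1 (ha0 e)
    have hg1 : ∀ e : Edge ws, g (φ e).1 = g e.1 := fun e => by
      have := ha2 e
      rw [ha0] at this
      linarith
    have hconst : ∀ F : Edge ws → ℚ, (∀ e, F (next e) = F e) → (∀ e, F (φ e) = F e) →
        (∀ c : Component φ, F c.out = 0) → ∀ e, F e = 0 := by
      intro F hF1 hF2 hF0 e
      let F' : Component φ → ℚ := Quot.lift F (by
        rintro x y (rfl | rfl)
        · exact (hF1 x).symm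
        · exact (hF2 x).symm)
      have : F' (Quot.mk _ (Quot.mk _ e : Component φ).out) = F' (Quot.mk _ e) := by
        rw [Quot.out_eq]
      exact this.symm.trans (hF0 _)
    have hf0 := hconst (fun e => f (mkV e)) hf1 (fun e => by simp only [hV2, hf1]) h2
    have hg0 := hconst (fun e => g e.1) (fun e => rfl) hg1 h3
    refine Prod.ext (funext fun v => ?_) (funext fun j => ?_)
    · obtain ⟨e, rfl⟩ := Quot.exists_rep v
      exact hf0 e
    · obtain ⟨e, rfl⟩ := fst_surjective hws j
      exact hg0 e
  have := LinearMap.finrank_le_finrank_of_injective hinj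
  simp only [Module.finrank_prod, Module.finrank_fintype_fun_eq_card, Fintype.card_fin] at this
  simp only [Nat.card_eq_fintype_card]
  omega

/-! ### Faces and connected components. -/

theorem card_component_eq_one_of_single {w : List Letter} (hw : w ≠ [])
    (φ : Equiv.Perm (Edge ![w])) : Nat.card (Component φ) = 1 := by
  rw [Nat.card_eq_one_iff_unique]
  refine ⟨⟨fun a b => ?_⟩, ?_⟩
  · obtain ⟨x, rfl⟩ := Quot.exists_rep a
    obtain ⟨y, rfl⟩ := Quot.exists_rep b
    exact component_eq_of_fst_eq (Subsingleton.elim _ _)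
  · obtain ⟨e, -⟩ := fst_surjective (ws := ![w]) (fun j => by fin_cases j; exact hw) 0
    exact ⟨Quot.mk _ e⟩

/-- The faces in a component. -/
theorem sum_card_faces (hws : ∀ j, ws j ≠ []) (φ : Equiv.Perm (Edge ws)) :
    ∃ F : Fin k → Component φ, (∀ e : Edge ws, F e.1 = Quot.mk _ e) ∧
      Function.Surjective F := by
  choose e he using fst_surjective hws
  refine ⟨fun j => Quot.mk _ (e j), fun x => component_eq_of_fst_eq (he _), fun c => ?_⟩
  obtain ⟨x, rfl⟩ := Quot.exists_rep c
  exact ⟨x.1, component_eq_of_fst_eq (he _)⟩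

theorem two_mul_card_component_le (hws : ∀ j, ws j ≠ []) (hφ : NoIsolatedFace φ) :
    2 * Nat.card (Component φ) ≤ k := by
  classical
  obtain ⟨F, hF, hsurj⟩ := sum_card_faces hws φ
  have h2 : ∀ c ∈ (Finset.univ : Finset (Component φ)),
      2 ≤ (Finset.univ.filter fun j => F j = c).card := by
    intro c _
    obtain ⟨j, rfl⟩ := hsurj c
    obtain ⟨e, rfl, he⟩ := hφ j
    refine Finset.one_lt_card.2 ⟨e.1, by simp, (φ e).1, ?_, fun h => he h.symm⟩
    simp [hF, component_apply]
  have := Finset.card_nsmul_le_sum _ _ _ h2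
  rw [← Finset.card_eq_sum_card_fiberwise (s := Finset.univ) (f := F) (fun _ _ => by simp),
    Finset.card_univ, Finset.card_univ, Fintype.card_fin, ← Nat.card_eq_fintype_card] at this
  simpa [mul_comm] using this

/-- If moreover the component of the face `j₀` has more than two faces, there are fewer than `k / 2`
components. -/
theorem two_mul_card_component_lt (hws : ∀ j, ws j ≠ []) (hφ : NoIsolatedFace φ) (j₀ : Fin k)
    (h : ∀ j, j ≠ j₀ → ∃ e : Edge ws, (e.1 = j₀ ∨ e.1 = j) ∧ (φ e).1 ≠ j₀ ∧ (φ e).1 ≠ j) :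
    2 * Nat.card (Component φ) + 1 ≤ k := by
  classical
  obtain ⟨F, hF, hsurj⟩ := sum_card_faces hws φ
  have hFφ : ∀ e : Edge ws, F (φ e).1 = F e.1 := fun e => by rw [hF, hF, component_apply]
  have h2 : ∀ c ∈ (Finset.univ : Finset (Component φ)),
      2 ≤ (Finset.univ.filter fun j => F j = c).card := by
    intro c _
    obtain ⟨j, rfl⟩ := hsurj c
    obtain ⟨e, rfl, he⟩ := hφ j
    refine Finset.one_lt_card.2 ⟨e.1, by simp, (φ e).1, ?_, fun h => he h.symm⟩
    simp [hFφ]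
  -- An edge leaving j₀ reaches a second face of the component, and the hypothesis for that face
  -- supplies an edge leaving the two towards a third.
  have h3 : 2 < (Finset.univ.filter fun j => F j = F j₀).card := by
    obtain ⟨e, he0, he⟩ := hφ j₀
    obtain ⟨e', he', hne0, hne⟩ := h (φ e).1 he
    have hFe : F (φ e).1 = F j₀ := by rw [hFφ, he0]
    rw [Finset.two_lt_card]
    refine ⟨j₀, by simp, (φ e).1, by simp [hFe], (φ e').1, ?_, he.symm, hne0.symm, hne.symm⟩
    simp only [Finset.mem_filter, Finset.mem_univ, true_and]
    rw [hFφ]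
    rcases he' with h' | h' <;> simp [h', hFe]
  have := Finset.sum_lt_sum h2 ⟨F j₀, Finset.mem_univ _, h3⟩
  rw [← Finset.card_eq_sum_card_fiberwise (s := Finset.univ) (f := F) (fun _ _ => by simp),
    Finset.sum_const,
    Finset.card_univ, Finset.card_univ, Fintype.card_fin, ← Nat.card_eq_fintype_card] at this
  rw [smul_eq_mul] at this
  omega

/-- Were face j glued only to itself, belonging to j would be constant on components and would
separate the two faces. -/
theorem noIsolatedFace_of_connected {w₁ w₂ : List Letter} (h1 : w₁ ≠ []) (h2 : w₂ ≠ [])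
    {φ : Equiv.Perm (Edge ![w₁, w₂])} (hφ : IsAdmissible φ)
    (hC : Nat.card (Component φ) = 1) : NoIsolatedFace φ := by
  have hws : ∀ j, (![w₁, w₂] : Fin 2 → List Letter) j ≠ [] := by
    intro j; fin_cases j <;> assumption
  intro j
  by_contra hcon
  push Not at hcon
  have hinv : ∀ e : Edge ![w₁, w₂], (φ e).1 = j ↔ e.1 = j := fun e =>
    ⟨fun h => by have := hcon _ h; rwa [hφ.1] at this, hcon e⟩
  let F : Component φ → Prop := Quot.lift (fun e => e.1 = j) (by
    rintro x y (rfl | rfl)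
    · rfl
    · exact propext (hinv x).symm)
  obtain ⟨j', hj'⟩ : ∃ j', j' ≠ j := exists_ne j
  obtain ⟨e, he⟩ := fst_surjective hws j
  obtain ⟨e', he'⟩ := fst_surjective hws j'
  rw [Nat.card_eq_one_iff_unique] at hC
  have := hC.1.elim (Quot.mk _ e) (Quot.mk _ e')
  have hF : (e.1 = j) = (e'.1 = j) := congrArg F this
  exact hj' (he' ▸ hF ▸ he)

end Topology

/-! ### Counting labellings -/

section Labelling

theorem cyclicDist_zero_sub {N : ℕ} [NeZero N] (x y : Fin N) :
    cyclicDist 0 (y - x) = cyclicDist x y := by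
  have hx := x.2
  have hy := y.2
  simp only [cyclicDist, Nat.dist, Fin.val_zero, Fin.sub_def]
  rcases le_or_gt (x : ℕ) y with h | h
  · have : (N - (x : ℕ) + y) % N = y - x := by
      rw [show N - (x : ℕ) + y = (y - x) + N by omega, Nat.add_mod_right, Nat.mod_eq_of_lt (by omega)]
    rw [this]; omega
  · have : (N - (x : ℕ) + y) % N = N - x + y := Nat.mod_eq_of_lt (by omega)
    rw [this]; omega

theorem card_cyclicDist_zero_le {N : ℕ} [NeZero N] (b : ℕ) :
    (Finset.univ.filter fun y : Fin N => cyclicDist 0 y ≤ b).card = bandCount N b := by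
  have hN := NeZero.pos N
  unfold bandCount
  rcases le_or_gt N (2 * b + 1) with h | h
  · rw [min_eq_right h, Finset.filter_true_of_mem, Finset.card_univ, Fintype.card_fin]
    intro y _
    have := y.2
    simp only [cyclicDist, Nat.dist, Fin.val_zero]
    omega
  · rw [min_eq_left h.le, ← Finset.card_map Fin.valEmbedding]
    have : (Finset.univ.filter fun y : Fin N => cyclicDist 0 y ≤ b).map Fin.valEmbedding =
        Finset.range (b + 1) ∪ Finset.Ico (N - b) N := by
      ext z
      simp only [Finset.mem_map, Finset.mem_filter, Finset.mem_univ, true_and, Finset.mem_union,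
        Finset.mem_range, Finset.mem_Ico, Fin.valEmbedding_apply]
      constructor
      · rintro ⟨y, hy, rfl⟩
        have := y.2
        simp only [cyclicDist, Nat.dist, Fin.val_zero] at hy
        omega
      · intro hz
        have hzN : z < N := by omega
        refine ⟨⟨z, hzN⟩, ?_, rfl⟩
        simp only [cyclicDist, Nat.dist, Fin.val_zero]
        omega
    rw [this, Finset.card_union_of_disjoint, Finset.card_range, Nat.card_Ico]
    · omega
    · rw [Finset.disjoint_left]
      intro z
      simp only [Finset.mem_range, Finset.mem_Ico]
      omega

/-- The labellings of the vertices of a graph by indices, neighbours being within cyclic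
distance `b`. -/
def IsBandLabelling {V : Type*} {N : ℕ} (b : ℕ) (Adj : V → V → Prop) (y : V → Fin N) : Prop :=
  ∀ u v, Adj u v → cyclicDist (y u) (y v) ≤ b

/-! ### Labellings described by increments along a rooted forest. -/

section Forest

variable {V : Type*} {N : ℕ} [NeZero N]

open Classical in
/-- The increments of a labelling along the edges of a rooted forest. -/
noncomputable def increments (root parent : V → V) (y : V → Fin N) (v : V) : Fin N :=
  if v = root v then y v else y v - y (parent v)

/-- Induction on the depth: the label of a vertex is recovered from that of its parent and the
increment. -/
theorem increments_injective {root parent : V → V} {depth : V → ℕ}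
    (hd : ∀ v, v ≠ root v → depth (parent v) < depth v) :
    Function.Injective (increments (N := N) root parent) := by
  intro y y' h
  have key : ∀ n v, depth v < n → y v = y' v := by
    intro n
    induction n with
    | zero => intro v hv; omega
    | succ n ih =>
      intro v hv
      have hv' := congrFun h v
      unfold increments at hv'
      split_ifs at hv' with hr
      · exact hv'
      · have := ih (parent v) (by have := hd v hr; omega)
        rw [this] at hv'
        exact sub_left_injective hv'
  exact funext fun v => key _ v (Nat.lt_succ_self _)

variable [Fintype V]

open Classical in
/-- The possible increments of a labelling. -/
noncomputable def incrementSet (b : ℕ) (root : V → V) : Finset (V → Fin N) :=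
  Fintype.piFinset fun v => if v = root v then Finset.univ else
    Finset.univ.filter fun z => cyclicDist 0 z ≤ b

theorem card_incrementSet (b : ℕ) (root : V → V) {c : ℕ}
    (hc : Nat.card {v // v = root v} = c) :
    (incrementSet (N := N) b root).card = N ^ c * bandCount N b ^ (Fintype.card V - c) := by
  classical
  rw [incrementSet, Fintype.card_piFinset]
  have : ∀ v, (if v = root v then Finset.univ else
      Finset.univ.filter fun z : Fin N => cyclicDist 0 z ≤ b).card =
      if v = root v then N else bandCount N b := by
    intro v
    split_ifs
    · simp
    · exact card_cyclicDist_zero_le b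
  rw [← hc, Nat.card_eq_fintype_card, Fintype.card_subtype]
  simp_rw [this]
  rw [Finset.prod_ite, Finset.prod_const, Finset.prod_const]
  congr 2
  have := Finset.card_filter_add_card_filter_not (s := Finset.univ) (fun v => v = root v)
  rw [Finset.card_univ] at this
  omega

theorem increments_mem {b : ℕ} {Adj : V → V → Prop} {root parent : V → V}
    (hp : ∀ v, v ≠ root v → Adj v (parent v)) {y : V → Fin N}
    (hy : IsBandLabelling b Adj y) : increments root parent y ∈ incrementSet b root := by
  classical
  rw [incrementSet, Fintype.mem_piFinset]
  intro v
  unfold increments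
  split_ifs with h
  · simp
  · simp only [Finset.mem_filter, Finset.mem_univ, true_and]
    rw [cyclicDist_zero_sub, cyclicDist_comm]
    exact hy _ _ (hp v h)

/-- The number of band labellings is at most `N ^ C * l ^ (V - C)`. -/
theorem card_bandLabelling_le {b : ℕ} {Adj : V → V → Prop} {root parent : V → V} {depth : V → ℕ}
    (hd : ∀ v, v ≠ root v → depth (parent v) < depth v)
    (hp : ∀ v, v ≠ root v → Adj v (parent v)) {c : ℕ} (hc : Nat.card {v // v = root v} = c) :
    Nat.card {y : V → Fin N // IsBandLabelling b Adj y} ≤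
      N ^ c * bandCount N b ^ (Fintype.card V - c) := by
  classical
  rw [← card_incrementSet b root hc, Nat.card_eq_fintype_card, Fintype.card_subtype]
  refine Finset.card_le_card_of_injOn (increments root parent) (fun y hy => ?_)
    ((increments_injective hd).injOn)
  exact increments_mem hp (Finset.mem_filter.1 hy).2

/-- For a forest the bound is attained. -/
theorem card_bandLabelling_eq {b : ℕ} {Adj : V → V → Prop} {root parent : V → V} {depth : V → ℕ}
    (hd : ∀ v, v ≠ root v → depth (parent v) < depth v)
    (hp : ∀ v, v ≠ root v → Adj v (parent v)) {c : ℕ} (hc : Nat.card {v // v = root v} = c)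
    (htree : ∀ u v, Adj u v → (u ≠ root u ∧ v = parent u) ∨ (v ≠ root v ∧ u = parent v)) :
    Nat.card {y : V → Fin N // IsBandLabelling b Adj y} =
      N ^ c * bandCount N b ^ (Fintype.card V - c) := by
  classical
  have hbij : Function.Bijective (increments (N := N) root parent) :=
    Finite.injective_iff_bijective.1 (increments_injective hd)
  rw [← card_incrementSet b root hc, Nat.card_eq_fintype_card, Fintype.card_subtype]
  refine Finset.card_bij (fun y _ => increments root parent y)
    (fun y hy => increments_mem hp (Finset.mem_filter.1 hy).2) (fun y _ y' _ h => hbij.1 h)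
    fun z hz => ?_
  obtain ⟨y, rfl⟩ := hbij.2 z
  refine ⟨y, ?_, rfl⟩
  simp only [Finset.mem_filter, Finset.mem_univ, true_and]
  have key : ∀ v, v ≠ root v → cyclicDist (y v) (y (parent v)) ≤ b := by
    intro v hv
    have := Fintype.mem_piFinset.1 hz v
    simp only [increments, hv, if_false, Finset.mem_filter, Finset.mem_univ, true_and,
      cyclicDist_zero_sub] at this
    rwa [cyclicDist_comm]
  intro u v huv
  rcases htree u v huv with ⟨h1, rfl⟩ | ⟨h1, rfl⟩
  · exact key _ h1
  · rw [cyclicDist_comm]; exact key _ h1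

end Forest

/-! ### The spanning forest of Γ_φ and the count of its labellings. -/

variable {k : ℕ} {ws : Fin k → List Letter} {φ : Equiv.Perm (Edge ws)}

/-- For an involution, the condition `i (φ e) = i (next e)` for all e is invariance under `e ↦ next
(φ e)`, i.e. the labelling descends to vertices. -/
theorem labelCount_eq (h : IsAdmissible φ) (N b : ℕ) :
    labelCount N b φ = Nat.card {y : Vertex φ → Fin N // IsBandLabelling b (GraphAdj φ) y} := by
  classical
  rw [labelCount, ← Fintype.card_subtype, ← Nat.card_eq_fintype_card]
  refine Nat.card_congr
    { toFun := fun i => ⟨Quot.lift i.1 ?_, ?_⟩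
      invFun := fun y => ⟨fun e => y.1 (Quot.mk _ e), ?_, ?_⟩
      left_inv := fun i => rfl
      right_inv := fun y => ?_ }
  · rintro x y rfl
    rw [← i.2.1, h.1]
  · rintro u v ⟨e, rfl, rfl⟩
    exact i.2.2 e
  · intro e
    exact congrArg y.1 (vertex_apply h e)
  · intro e
    exact y.2 _ _ ⟨e, rfl, rfl⟩
  · apply Subtype.ext
    funext v
    obtain ⟨e, rfl⟩ := Quot.exists_rep v
    rfl

theorem GraphAdj.symm (h : IsAdmissible φ) {u v : Vertex φ} (huv : GraphAdj φ u v) :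
    GraphAdj φ v u := by
  obtain ⟨e, rfl, rfl⟩ := huv
  exact ⟨φ e, (vertex_apply h e).symm, (vertex_next e).symm⟩

/-- The component of a vertex. -/
def vertexComponent (φ : Equiv.Perm (Edge ws)) : Vertex φ → Component φ :=
  Quot.lift (fun e => Quot.mk _ e) (by
    rintro x y rfl
    rw [component_next, component_apply])

/-- A chosen vertex in the component of a vertex. -/
noncomputable def rootVertex (φ : Equiv.Perm (Edge ws)) (v : Vertex φ) : Vertex φ :=
  Quot.mk _ (vertexComponent φ v).out

theorem vertexComponent_mk_out (c : Component φ) :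
    vertexComponent φ (Quot.mk _ c.out) = c := Quot.out_eq c

theorem card_rootVertex (φ : Equiv.Perm (Edge ws)) :
    Nat.card {v // v = rootVertex φ v} = Nat.card (Component φ) := by
  refine Nat.card_eq_of_bijective (fun v => vertexComponent φ v.1) ⟨?_, ?_⟩
  · rintro ⟨u, hu⟩ ⟨v, hv⟩ huv
    apply Subtype.ext
    simp only at huv ⊢
    rw [hu, hv, rootVertex, rootVertex, huv]
  · intro c
    refine ⟨⟨Quot.mk _ c.out, ?_⟩, vertexComponent_mk_out c⟩
    rw [rootVertex, vertexComponent_mk_out]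

/-- Both ways of staying in a component move along an edge of Γ_φ: passing to the next edge follows
e, and φ e starts where e ends. -/
theorem reflTransGen_of_component_eq (h : IsAdmissible φ) {u v : Vertex φ}
    (huv : vertexComponent φ u = vertexComponent φ v) :
    Relation.ReflTransGen (GraphAdj φ) u v := by
  have : Std.Symm (GraphAdj φ) := ⟨fun _ _ => GraphAdj.symm h⟩
  have hsymm : ∀ {u v}, Relation.ReflTransGen (GraphAdj φ) u v →
      Relation.ReflTransGen (GraphAdj φ) v u := fun hr =>
    (Relation.ReflTransGen.stdSymm).symm _ _ hr
  obtain ⟨x, rfl⟩ := Quot.exists_rep u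
  obtain ⟨y, rfl⟩ := Quot.exists_rep v
  have := Quot.eqvGen_exact (show (Quot.mk _ x : Component φ) = Quot.mk _ y from huv)
  clear huv
  induction this with
  | rel x y hxy =>
    rcases hxy with rfl | rfl
    · exact Relation.ReflTransGen.single ⟨x, rfl, rfl⟩
    · exact Relation.ReflTransGen.single ⟨x, rfl, vertex_apply h x⟩
  | refl x => exact Relation.ReflTransGen.refl
  | symm x y _ ih => exact hsymm ih
  | trans x y z _ _ h1 h2 => exact h1.trans h2

theorem vertexComponent_eq_of_adj {u v : Vertex φ} (huv : GraphAdj φ u v) :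
    vertexComponent φ u = vertexComponent φ v := by
  obtain ⟨e, rfl, rfl⟩ := huv
  exact (component_next e).symm

theorem rootVertex_eq_of_adj {u v : Vertex φ} (huv : GraphAdj φ u v) :
    rootVertex φ u = rootVertex φ v := by
  rw [rootVertex, rootVertex, vertexComponent_eq_of_adj huv]

/-- A spanning forest of `Γ_φ`. -/
theorem exists_parent (h : IsAdmissible φ) :
    ∃ (parent : Vertex φ → Vertex φ) (depth : Vertex φ → ℕ),
      (∀ v, v ≠ rootVertex φ v → depth (parent v) < depth v) ∧
      ∀ v, v ≠ rootVertex φ v → GraphAdj φ v (parent v) := by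
  classical
  -- `R n v` says that some walk of n steps leads from v to its root; `depth` is the least such n,
  -- and a first step of a shortest walk goes to the parent.
  let R : ℕ → Vertex φ → Prop := fun n => Nat.rec (fun v => v = rootVertex φ v)
    (fun _ ih v => ∃ u, GraphAdj φ v u ∧ ih u) n
  have hR : ∀ v, ∃ n, R n v := by
    intro v
    have hv : vertexComponent φ v = vertexComponent φ (rootVertex φ v) :=
      (vertexComponent_mk_out _).symm
    have hgen := reflTransGen_of_component_eq h hv
    generalize hw : rootVertex φ v = w at hgen
    induction hgen using Relation.ReflTransGen.head_induction_on with
    | refl => exact ⟨0, hw.symm⟩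
    | head huc _ ih =>
      obtain ⟨n, hn⟩ := ih ((vertexComponent_mk_out _).symm)
        ((rootVertex_eq_of_adj huc).symm.trans hw)
      exact ⟨n + 1, _, huc, hn⟩
  let depth : Vertex φ → ℕ := fun v => sInf {n | R n v}
  have hstep : ∀ v, v ≠ rootVertex φ v →
      ∃ u : Vertex φ, GraphAdj φ v u ∧ depth u < depth v := by
    intro v hv
    have hspec : R (depth v) v := Nat.sInf_mem (hR v)
    generalize hm : depth v = m at hspec
    cases m with
    | zero => exact absurd hspec hv
    | succ m =>
      obtain ⟨u, hu, hum⟩ := hspec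
      exact ⟨u, hu, Nat.lt_succ_of_le (Nat.sInf_le hum)⟩
  choose! parent hp using hstep
  exact ⟨parent, depth, fun v hv => (hp v hv).2, fun v hv => (hp v hv).1⟩

theorem labelCount_le (h : IsAdmissible φ) (N b : ℕ) [NeZero N] :
    labelCount N b φ ≤ N ^ Nat.card (Component φ) *
      bandCount N b ^ (Nat.card (Vertex φ) - Nat.card (Component φ)) := by
  obtain ⟨parent, depth, hd, hp⟩ := exists_parent h
  rw [labelCount_eq h, Nat.card_eq_fintype_card (α := Vertex φ)]
  exact card_bandLabelling_le hd hp (card_rootVertex φ)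

theorem card_component_le_card_vertex (φ : Equiv.Perm (Edge ws)) :
    Nat.card (Component φ) ≤ Nat.card (Vertex φ) := by
  rw [← card_rootVertex φ]
  exact Nat.card_le_card_of_injective _ Subtype.val_injective

/-- If `Γ_φ` is a tree, the number of labellings is `N * l ^ (V - 1)`. -/
theorem labelCount_eq_of_tree (h : IsAdmissible φ) (N b : ℕ) [NeZero N]
    (hE : Nat.card (Vertex φ) = Nat.card (SurfaceEdge φ) + Nat.card (Component φ)) :
    labelCount N b φ = N ^ Nat.card (Component φ) * bandCount N b ^ Nat.card (SurfaceEdge φ) := by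
  classical
  obtain ⟨parent, depth, hd, hp⟩ := exists_parent h
  have hsub : Nat.card (SurfaceEdge φ) = Fintype.card (Vertex φ) - Nat.card (Component φ) := by
    rw [← Nat.card_eq_fintype_card]; omega
  rw [labelCount_eq h, hsub]
  refine card_bandLabelling_eq hd hp (card_rootVertex φ) ?_
  choose f hf1 hf2 using hp
  -- Sends a vertex to its parent edge. Two vertices sharing this edge in opposite directions would
  -- be parents of each other, contradicting the decrease of the depth.
  let F : {v // v ≠ rootVertex φ v} → SurfaceEdge φ := fun v => Quot.mk _ (f v.1 v.2)
  have hinj : Function.Injective F := by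
    rintro ⟨u, hu⟩ ⟨v, hv⟩ huv
    apply Subtype.ext
    rcases (surfaceEdge_eq_iff h _ _).1 huv with he | he
    · exact (hf1 u hu).trans ((congrArg _ he.symm).trans (hf1 v hv).symm)
    · exfalso
      have h1 : v = parent u :=
        (hf1 v hv).trans (by rw [he, vertex_apply h]; exact (hf2 u hu).symm)
      have h2 : parent v = u :=
        (hf2 v hv).trans (by rw [he, vertex_next]; exact (hf1 u hu).symm)
      have h3 := hd u hu
      have h4 := hd v hv
      rw [h2, h1] at h4
      omega
  have hcard : Fintype.card {v // v ≠ rootVertex φ v} = Fintype.card (SurfaceEdge φ) := by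
    rw [Fintype.card_subtype_compl, ← Nat.card_eq_fintype_card (α := {v // v = rootVertex φ v}),
      card_rootVertex, ← hsub, Nat.card_eq_fintype_card]
  -- Since V - C = E, the injection is onto: every edge of Γ_φ joins a vertex to its parent.
  have hbij := (Fintype.bijective_iff_injective_and_card F).2 ⟨hinj, hcard⟩
  rintro u v ⟨e, rfl, rfl⟩
  obtain ⟨⟨v, hv⟩, hve⟩ := hbij.2 (Quot.mk _ e)
  rcases (surfaceEdge_eq_iff h _ _).1 hve with he | he
  · left
    have h1 : (Quot.mk _ e : Vertex φ) = v := by rw [he]; exact (hf1 v hv).symm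
    rw [h1, he]
    exact ⟨hv, (hf2 v hv).symm⟩
  · right
    have h1 : (Quot.mk _ (next e) : Vertex φ) = v := by
      rw [he, vertex_next]; exact (hf1 v hv).symm
    rw [h1, he, vertex_apply h]
    exact ⟨hv, (hf2 v hv).symm⟩

end Labelling

/-! ### Volumes as limits of counts -/

section Volume

/-- The representative of an index of least absolute value modulo `N`. -/
def centre {N : ℕ} (y : Fin N) : ℤ := if 2 * (y : ℕ) < N then (y : ℤ) else (y : ℤ) - N

/-- The cyclic distance of representatives. -/
def intDist (N : ℕ) (z z' : ℤ) : ℤ := min |z - z'| (N - |z - z'|)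

theorem centre_injective {N : ℕ} : Function.Injective (centre (N := N)) := by
  intro x y h
  have hx := x.2
  have hy := y.2
  unfold centre at h
  apply Fin.ext
  split_ifs at h <;> omega

theorem centre_mem {N : ℕ} (y : Fin N) : -(N : ℤ) ≤ 2 * centre y ∧ 2 * centre y < N := by
  have hy := y.2
  unfold centre
  split_ifs <;> omega

theorem exists_centre_eq {N : ℕ} {z : ℤ} (h1 : -(N : ℤ) ≤ 2 * z) (h2 : 2 * z < N) :
    ∃ y : Fin N, centre y = z := by
  rcases le_or_gt 0 z with h | h
  · refine ⟨⟨z.toNat, by omega⟩, ?_⟩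
    unfold centre
    split_ifs <;> simp at * <;> omega
  · refine ⟨⟨(z + N).toNat, by omega⟩, ?_⟩
    unfold centre
    split_ifs <;> simp at * <;> omega

theorem intDist_centre {N : ℕ} (x y : Fin N) :
    intDist N (centre x) (centre y) = cyclicDist x y := by
  have hx := x.2
  have hy := y.2
  simp only [intDist, cyclicDist, centre, Nat.dist, abs_eq_max_neg]
  split_ifs <;> omega

/-- The truncation in l = min(2b+1, N) is harmless, as twice a cyclic distance never exceeds N; and
2d ≤ 2b+1 means d ≤ b. This puts the band condition in the scale-free form d/l ≤ 1/2. -/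
theorem cyclicDist_le_iff {N b : ℕ} (x y : Fin N) :
    cyclicDist x y ≤ b ↔ 2 * intDist N (centre x) (centre y) ≤ bandCount N b := by
  have hx := x.2
  have hy := y.2
  rw [intDist_centre]
  simp only [cyclicDist, bandCount, Nat.dist]
  omega

/-- Cyclic distance is translation invariant, so the label of the root is free and can be normalized
to 0. -/
theorem card_bandLabelling_eq_mul {V : Type*} (Adj : V → V → Prop) (root : V) {N b : ℕ} [NeZero N] :
    Nat.card {y : V → Fin N // IsBandLabelling b Adj y} =
      N * Nat.card {y : V → Fin N // IsBandLabelling b Adj y ∧ y root = 0} := by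
  have e : {y : V → Fin N // IsBandLabelling b Adj y} ≃
      Fin N × {y : V → Fin N // IsBandLabelling b Adj y ∧ y root = 0} :=
    { toFun := fun y => (y.1 root, ⟨fun v => y.1 v - y.1 root, fun u v huv => by
          rw [← cyclicDist_zero_sub, sub_sub_sub_cancel_right, cyclicDist_zero_sub]
          exact y.2 u v huv, sub_self _⟩)
      invFun := fun p => ⟨fun v => p.2.1 v + p.1, fun u v huv => by
          rw [← cyclicDist_zero_sub, add_sub_add_right_eq_sub, cyclicDist_zero_sub]
          exact p.2.2.1 u v huv⟩
      left_inv := fun y => by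
        apply Subtype.ext
        funext v
        exact sub_add_cancel _ _
      right_inv := fun p => by
        refine Prod.ext ?_ (Subtype.ext ?_)
        · simp [p.2.2.2]
        · funext v
          simp [p.2.2.2] }
  rw [Nat.card_congr e, Nat.card_prod, Nat.card_fin]

variable {V : Type} [DecidableEq V] (Adj : V → V → Prop) (root : V)

/-- The coordinate of a vertex, `0` for the root. -/
noncomputable def coord (v : V) : ({v : V // v ≠ root} → ℝ) →ₗ[ℝ] ℝ :=
  if h : v = root then 0 else LinearMap.proj ⟨v, h⟩

theorem coord_root (x : {v : V // v ≠ root} → ℝ) : coord root root x = 0 := by simp [coord]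

theorem coord_of_ne (x : {v : V // v ≠ root} → ℝ) (v : {v : V // v ≠ root}) :
    coord root v x = x v := by simp [coord, v.2]

theorem mem_bandBody_iff (lam : ℝ) (x : {v : V // v ≠ root} → ℝ) :
    x ∈ bandBody Adj root lam ↔ (∀ v, coord root v x ∈ bandInterval lam) ∧
      ∀ u v, Adj u v → bandDist lam (coord root u x) (coord root v x) < 1 / 2 := by
  have h : ∀ v, (if h : v = root then 0 else x ⟨v, h⟩) = coord root v x := by
    intro v
    by_cases h : v = root <;> simp [coord, h]
  simp only [bandBody, Set.mem_ofPred_eq, h]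

/-- The union of the cells of side `1 / l` that correspond to the rooted labellings. -/
def cellUnion (N l : ℕ) : Set ({v : V // v ≠ root} → ℝ) :=
  {x | (∀ v, -(N : ℤ) ≤ 2 * ⌊l * coord root v x⌋ ∧ 2 * ⌊l * coord root v x⌋ < N) ∧
    ∀ u v, Adj u v → 2 * intDist N ⌊l * coord root u x⌋ ⌊l * coord root v x⌋ ≤ l}

/-- Induction along a path from the root: each edge increases the absolute value by at most l. This
holds also when the edge wraps around the circle, since both endpoints then lie near the ends of the
window and have nearly equal absolute values. The constant does not depend on N. -/
theorem exists_floor_bound (hconn : ∀ v, Relation.ReflTransGen Adj root v) (v : V) :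
    ∃ m : ℕ, ∀ (N l : ℕ) (x : {v : V // v ≠ root} → ℝ), x ∈ cellUnion Adj root N l →
      |⌊l * coord root v x⌋| ≤ m * l := by
  induction hconn v with
  | refl => exact ⟨0, fun N l x _ => by simp [coord_root]⟩
  | @tail u v _ huv ih =>
    obtain ⟨m, hm⟩ := ih
    refine ⟨m + 1, fun N l x hx => ?_⟩
    have h1 := hm N l x hx
    have h2 := hx.2 u v huv
    have h3 := hx.1 v
    have h4 := hx.1 u
    generalize ⌊l * coord root v x⌋ = a at *
    generalize ⌊l * coord root u x⌋ = c at *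
    have h5 : ((m + 1 : ℕ) : ℤ) * l = m * l + l := by push_cast; ring
    rw [h5]
    generalize (m : ℤ) * l = q at *
    simp only [intDist, abs_eq_max_neg] at h1 h2 ⊢
    omega

variable [Fintype V]

theorem measurable_coord (v : V) : Measurable (coord root v) :=
  (LinearMap.continuous_of_finiteDimensional _).measurable

theorem measurable_bandDist (lam : ℝ) : Measurable fun p : ℝ × ℝ => bandDist lam p.1 p.2 := by
  unfold bandDist
  split_ifs <;> fun_prop

theorem measurableSet_bandBody (lam : ℝ) : MeasurableSet (bandBody Adj root lam) := by
  have : bandBody Adj root lam = (⋂ v, {x | coord root v x ∈ bandInterval lam}) ∩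
      ⋂ u, ⋂ v, ⋂ _ : Adj u v, {x | bandDist lam (coord root u x) (coord root v x) < 1 / 2} := by
    ext x
    simp [mem_bandBody_iff]
  rw [this]
  refine MeasurableSet.inter (MeasurableSet.iInter fun v => ?_)
    (MeasurableSet.iInter fun u => MeasurableSet.iInter fun v => MeasurableSet.iInter fun _ => ?_)
  · refine measurable_coord root v ?_
    unfold bandInterval
    split_ifs
    · exact MeasurableSet.univ
    · exact measurableSet_Icc
  · exact measurableSet_lt ((measurable_bandDist lam).comp
      ((measurable_coord root u).prodMk (measurable_coord root v))) measurable_const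

-- A rooted labelling corresponds to the half-open cube of side 1/l whose lowest corner has the
-- centred labels divided by l as coordinates.
open Classical in
theorem cellUnion_eq {N b : ℕ} [NeZero N] :
    cellUnion Adj root N (bandCount N b) =
      ⋃ y ∈ Finset.univ.filter fun y : V → Fin N => IsBandLabelling b Adj y ∧ y root = 0,
        Set.univ.pi fun v : {v : V // v ≠ root} =>
          Set.Ico ((centre (y v) : ℝ) / bandCount N b) ((centre (y v) + 1 : ℝ) / bandCount N b) := by
  have hN := NeZero.pos N
  have hl : (0 : ℝ) < bandCount N b := by
    have : 0 < bandCount N b := by unfold bandCount; omega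
    exact_mod_cast this
  have hc0 : centre (0 : Fin N) = 0 := by simp [centre, hN]
  have hcell : ∀ (x : {v : V // v ≠ root} → ℝ) (y : V → Fin N), y root = 0 →
      ((x ∈ Set.univ.pi fun v : {v : V // v ≠ root} =>
          Set.Ico ((centre (y v) : ℝ) / bandCount N b) ((centre (y v) + 1 : ℝ) / bandCount N b)) ↔
        ∀ v, ⌊bandCount N b * coord root v x⌋ = centre (y v)) := by
    intro x y hy
    simp only [Set.mem_pi, Set.mem_univ, true_implies, Set.mem_Ico, div_le_iff₀ hl, lt_div_iff₀ hl]
    constructor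
    · intro h v
      by_cases hv : v = root
      · subst hv
        simp [coord_root, hy, hc0]
      · have := h ⟨v, hv⟩
        rw [Int.floor_eq_iff, coord_of_ne root x ⟨v, hv⟩, mul_comm]
        exact this
    · intro h v
      have := h v
      rw [Int.floor_eq_iff, coord_of_ne root x v, mul_comm] at this
      exact this
  ext x
  simp only [Set.mem_iUnion, exists_prop, Finset.mem_filter, Finset.mem_univ, true_and]
  constructor
  · rintro ⟨h1, h2⟩
    choose y hy using fun v => exists_centre_eq (h1 v).1 (h1 v).2
    have hy0 : y root = 0 := centre_injective (by rw [hy, hc0, coord_root]; simp)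
    refine ⟨y, ⟨fun u v huv => ?_, hy0⟩, (hcell x y hy0).2 fun v => (hy v).symm⟩
    rw [cyclicDist_le_iff, hy, hy]
    exact h2 u v huv
  · rintro ⟨y, ⟨hlab, hy0⟩, hx⟩
    have := (hcell x y hy0).1 hx
    refine ⟨fun v => ?_, fun u v huv => ?_⟩
    · rw [this]; exact centre_mem _
    · rw [this, this, ← cyclicDist_le_iff]; exact hlab u v huv

/-- The cubes are disjoint, because the centred representatives are the floors of l times the
coordinates, and each has volume l^(-(V-1)). -/
theorem volume_cellUnion {N b : ℕ} [NeZero N] :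
    (volume (cellUnion Adj root N (bandCount N b))).toReal =
      Nat.card {y : V → Fin N // IsBandLabelling b Adj y ∧ y root = 0} /
        (bandCount N b : ℝ) ^ (Fintype.card V - 1) := by
  classical
  have hN := NeZero.pos N
  have hl : (0 : ℝ) < bandCount N b := by
    have : 0 < bandCount N b := by unfold bandCount; omega
    exact_mod_cast this
  rw [cellUnion_eq, measure_biUnion_finset]
  · have hvol : ∀ y : V → Fin N, volume (Set.univ.pi fun v : {v : V // v ≠ root} =>
        Set.Ico ((centre (y v) : ℝ) / bandCount N b) ((centre (y v) + 1 : ℝ) / bandCount N b)) =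
        ENNReal.ofReal ((1 / (bandCount N b : ℝ)) ^ (Fintype.card V - 1)) := by
      intro y
      rw [Real.volume_pi_Ico]
      have : ∀ v : {v : V // v ≠ root}, ENNReal.ofReal ((centre (y v) + 1 : ℝ) / bandCount N b -
          (centre (y v) : ℝ) / bandCount N b) = ENNReal.ofReal (1 / (bandCount N b : ℝ)) := by
        intro v
        congr 1
        ring
      simp_rw [this]
      rw [Finset.prod_const, Finset.card_univ, Fintype.card_subtype_compl, Fintype.card_subtype_eq,
        ENNReal.ofReal_pow (by positivity)]
    simp_rw [hvol]
    rw [Finset.sum_const, nsmul_eq_mul, ENNReal.toReal_mul, ENNReal.toReal_natCast,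
      ENNReal.toReal_ofReal (by positivity), Nat.card_eq_fintype_card, Fintype.card_subtype,
      one_div, inv_pow, div_eq_mul_inv]
  · intro y hy y' hy' hne
    simp only [Finset.coe_filter, Finset.mem_univ, true_and, Set.mem_ofPred_eq] at hy hy'
    rw [Function.onFun, Set.disjoint_left]
    intro x hx hx'
    apply hne
    funext v
    by_cases hv : v = root
    · rw [hv, hy.2, hy'.2]
    · have h1 := hx ⟨v, hv⟩ trivial
      have h2 := hx' ⟨v, hv⟩ trivial
      simp only [Set.mem_Ico, div_le_iff₀ hl, lt_div_iff₀ hl] at h1 h2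
      apply centre_injective
      have e1 := Int.floor_eq_iff.2 h1
      have e2 := Int.floor_eq_iff.2 h2
      exact e1.symm.trans e2
  · intro y _
    exact MeasurableSet.univ_pi fun v => measurableSet_Ico

theorem exists_cellUnion_subset (hconn : ∀ v, Relation.ReflTransGen Adj root v) :
    ∃ R : ℝ, ∀ N l : ℕ, 0 < l → cellUnion Adj root N l ⊆ Metric.closedBall 0 R := by
  choose m hm using exists_floor_bound Adj root hconn
  -- The bound m l on the floor of l x gives |x| ≤ m + 1/l ≤ m + 1; the sum dominates all the
  -- constants `m v`.
  refine ⟨∑ v, (m v : ℝ) + 1, fun N l hl x hx => ?_⟩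
  have hl' : (1 : ℝ) ≤ l := by exact_mod_cast hl
  have hnn : ∀ v ∈ Finset.univ, (0 : ℝ) ≤ m v := fun _ _ => by positivity
  rw [mem_closedBall_zero_iff, pi_norm_le_iff_of_nonneg
    (add_nonneg (Finset.sum_nonneg hnn) zero_le_one)]
  intro v
  have h1 := hm v N l x hx
  rw [coord_of_ne] at h1
  have h2 : |(⌊l * x v⌋ : ℝ)| ≤ m v * l := by exact_mod_cast h1
  have h3 : (m v : ℝ) ≤ ∑ v, (m v : ℝ) := Finset.single_le_sum hnn (Finset.mem_univ _)
  have h4 := Int.floor_le (l * x v)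
  have h5 := Int.lt_floor_add_one (l * x v)
  rw [Real.norm_eq_abs]
  have h6 : |x v| ≤ m v + 1 := by
    rw [abs_le] at h2 ⊢
    constructor <;> by_contra hcon <;> push Not at hcon <;> nlinarith
  linarith

/-- A proper affine subspace is null. Requiring c ≠ 0 instead of L ≠ 0 also covers the zero
functional, whose level set is empty; it occurs as the coordinate of the root and as the difference
of a coordinate with itself. -/
theorem volume_coord_eq (L : ({v : V // v ≠ root} → ℝ) →ₗ[ℝ] ℝ) {c : ℝ} (hc : c ≠ 0) :
    volume {x | L x = c} = 0 := by
  let A : AffineSubspace ℝ ({v : V // v ≠ root} → ℝ) :=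
    (AffineSubspace.mk' c ⊥).comap L.toAffineMap
  have hA : (A : Set ({v : V // v ≠ root} → ℝ)) = {x | L x = c} := by
    ext x
    simp [A, AffineSubspace.mem_mk', sub_eq_zero]
  rw [← hA]
  refine Measure.addHaar_affineSubspace _ _ fun h => ?_
  have : (0 : {v : V // v ≠ root} → ℝ) ∈ (A : Set ({v : V // v ≠ root} → ℝ)) := by rw [h]; trivial
  rw [hA] at this
  simp only [Set.mem_ofPred_eq, map_zero] at this
  exact hc this.symm

/-! ### Convergence of the cells to the body as the mesh 1/l tends to zero. -/

section Limit

variable {l : ℕ → ℕ} {lam : ℝ}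

theorem tendsto_floor_mul_div (hl : Tendsto (fun N => (l N : ℝ)) atTop atTop) (t : ℝ) :
    Tendsto (fun N => (⌊(l N : ℝ) * t⌋ : ℝ) / l N) atTop (𝓝 t) := by
  have h1 : Tendsto (fun N => t - 1 / (l N : ℝ)) atTop (𝓝 t) := by
    simpa using tendsto_const_nhds.sub (tendsto_inv_atTop_zero.comp hl)
  refine tendsto_of_tendsto_of_tendsto_of_le_of_le' h1 tendsto_const_nhds ?_ ?_
  · filter_upwards [hl.eventually_gt_atTop 0] with N hN
    rw [le_div_iff₀ hN, sub_mul, one_div, inv_mul_cancel₀ hN.ne']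
    have := Int.sub_one_lt_floor ((l N : ℝ) * t)
    linarith [mul_comm t (l N : ℝ)]
  · filter_upwards [hl.eventually_gt_atTop 0] with N hN
    rw [div_le_iff₀ hN, mul_comm t]
    exact Int.floor_le _

theorem tendsto_ratio_of_pos (hlam : 0 < lam)
    (hr : Tendsto (fun N : ℕ => (l N : ℝ) / N) atTop (𝓝 (2 * lam))) :
    Tendsto (fun N : ℕ => (N : ℝ) / l N) atTop (𝓝 (1 / (2 * lam))) := by
  have := hr.inv₀ (by positivity)
  simpa [inv_div, one_div] using this

theorem tendsto_ratio_of_zero (hl : Tendsto (fun N => (l N : ℝ)) atTop atTop)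
    (hr : Tendsto (fun N : ℕ => (l N : ℝ) / N) atTop (𝓝 0)) :
    Tendsto (fun N : ℕ => (N : ℝ) / l N) atTop atTop := by
  have : Tendsto (fun N : ℕ => (l N : ℝ) / N) atTop (𝓝[>] 0) := by
    refine tendsto_nhdsWithin_iff.2 ⟨hr, ?_⟩
    filter_upwards [hl.eventually_gt_atTop 0, eventually_gt_atTop 0] with N hN hN'
    have : (0 : ℝ) < N := by exact_mod_cast hN'
    exact div_pos hN this
  refine this.inv_tendsto_nhdsGT_zero.congr fun N => ?_
  simp [inv_div]

/-- After division by l the discrete window tends to `bandInterval`, since N/l tends to 1/(2λ), or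
to infinity when λ = 0. Away from the endpoints it is irrelevant which inequalities are strict. -/
theorem eventually_window_iff (hlam : 0 ≤ lam)
    (hl : Tendsto (fun N => (l N : ℝ)) atTop atTop)
    (hr : Tendsto (fun N : ℕ => (l N : ℝ) / N) atTop (𝓝 (2 * lam))) {t : ℝ}
    (ht : lam ≠ 0 → |t| ≠ 1 / (4 * lam)) :
    ∀ᶠ N : ℕ in atTop, (-(N : ℤ) ≤ 2 * ⌊(l N : ℝ) * t⌋ ∧ 2 * ⌊(l N : ℝ) * t⌋ < N) ↔
      t ∈ bandInterval lam := by
  have hz := tendsto_floor_mul_div hl t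
  have key : ∀ N : ℕ, (0 : ℝ) < l N →
      ((0 < (N : ℝ) / l N + 2 * ((⌊(l N : ℝ) * t⌋ : ℝ) / l N) →
        -(N : ℤ) ≤ 2 * ⌊(l N : ℝ) * t⌋) ∧
      ((N : ℝ) / l N + 2 * ((⌊(l N : ℝ) * t⌋ : ℝ) / l N) < 0 →
        ¬ -(N : ℤ) ≤ 2 * ⌊(l N : ℝ) * t⌋)) ∧
      ((0 < (N : ℝ) / l N - 2 * ((⌊(l N : ℝ) * t⌋ : ℝ) / l N) →
        2 * ⌊(l N : ℝ) * t⌋ < N) ∧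
      ((N : ℝ) / l N - 2 * ((⌊(l N : ℝ) * t⌋ : ℝ) / l N) < 0 →
        ¬ 2 * ⌊(l N : ℝ) * t⌋ < N)) := by
    intro N hN
    generalize ⌊(l N : ℝ) * t⌋ = z
    rw [show (N : ℝ) / l N + 2 * ((z : ℝ) / l N) = (N + 2 * z) / l N by ring,
      show (N : ℝ) / l N - 2 * ((z : ℝ) / l N) = (N - 2 * z) / l N by ring]
    simp only [div_pos_iff_of_pos_right hN, div_lt_iff₀ hN, zero_mul]
    refine ⟨⟨fun h => ?_, fun h => ?_⟩, fun h => ?_, fun h => ?_⟩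
    · have : (0 : ℤ) < N + 2 * z := by exact_mod_cast h
      omega
    · have : (N : ℤ) + 2 * z < 0 := by exact_mod_cast h
      omega
    · have : (0 : ℤ) < N - 2 * z := by exact_mod_cast h
      omega
    · have : (N : ℤ) - 2 * z < 0 := by exact_mod_cast h
      omega
  rcases hlam.eq_or_lt with rfl | hpos
  · have hN := tendsto_ratio_of_zero hl (by simpa using hr)
    have h1 := (hN.atTop_add (hz.const_mul 2)).eventually_gt_atTop 0
    have h2 := (hN.atTop_add (hz.const_mul 2).neg).eventually_gt_atTop 0
    filter_upwards [h1, h2, hl.eventually_gt_atTop 0] with N h1 h2 hN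
    obtain ⟨⟨k1, -⟩, k2, -⟩ := key N hN
    simp only [bandInterval, if_true, Set.mem_univ, iff_true]
    exact ⟨k1 h1, k2 (by linarith)⟩
  · have hN := tendsto_ratio_of_pos hpos hr
    have h1 := hN.add (hz.const_mul 2)
    have h2 := hN.sub (hz.const_mul 2)
    have h4 : 1 / (2 * lam) = 2 * (1 / (4 * lam)) := by field_simp; norm_num
    simp only [bandInterval, if_neg hpos.ne', Set.mem_Icc]
    rcases lt_or_gt_of_ne (ht hpos.ne') with h | h
    · rw [abs_lt] at h
      filter_upwards [h1.eventually_const_lt (show 0 < 1 / (2 * lam) + 2 * t by linarith),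
        h2.eventually_const_lt (show 0 < 1 / (2 * lam) - 2 * t by linarith), hl.eventually_gt_atTop 0] with N h1 h2 hN
      obtain ⟨⟨k1, -⟩, k2, -⟩ := key N hN
      exact iff_of_true ⟨k1 h1, k2 h2⟩ ⟨h.1.le, h.2.le⟩
    · rcases lt_abs.1 h with h | h
      · filter_upwards [h2.eventually_lt_const (show 1 / (2 * lam) - 2 * t < 0 by linarith),
          hl.eventually_gt_atTop 0] with N h2 hN
        exact iff_of_false (fun h' => (key N hN).2.2 h2 h'.2) fun h' => absurd h'.2 (not_le.2 h)
      · filter_upwards [h1.eventually_lt_const (show 1 / (2 * lam) + 2 * t < 0 by linarith),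
          hl.eventually_gt_atTop 0] with N h1 hN
        exact iff_of_false (fun h' => (key N hN).1.2 h1 h'.1) fun h' => by linarith [h'.1]

/-- The rescaled cyclic distance converges to `bandDist`; excluding the value 1/2 reconciles the
weak discrete inequality with the strict continuous one. -/
theorem eventually_dist_iff (hlam : 0 ≤ lam)
    (hl : Tendsto (fun N => (l N : ℝ)) atTop atTop)
    (hr : Tendsto (fun N : ℕ => (l N : ℝ) / N) atTop (𝓝 (2 * lam))) {s t : ℝ}
    (hst : bandDist lam s t ≠ 1 / 2) :
    ∀ᶠ N : ℕ in atTop, (2 * intDist N ⌊(l N : ℝ) * s⌋ ⌊(l N : ℝ) * t⌋ ≤ l N) ↔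
      bandDist lam s t < 1 / 2 := by
  have hd := ((tendsto_floor_mul_div hl s).sub (tendsto_floor_mul_div hl t)).abs
  have key : ∀ N : ℕ, (0 : ℝ) < l N →
      ((2 * intDist N ⌊(l N : ℝ) * s⌋ ⌊(l N : ℝ) * t⌋ ≤ l N) ↔
        min |(⌊(l N : ℝ) * s⌋ : ℝ) / l N - (⌊(l N : ℝ) * t⌋ : ℝ) / l N|
          ((N : ℝ) / l N - |(⌊(l N : ℝ) * s⌋ : ℝ) / l N - (⌊(l N : ℝ) * t⌋ : ℝ) / l N|) ≤ 1 / 2) := by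
    intro N hN
    generalize ⌊(l N : ℝ) * s⌋ = z
    generalize ⌊(l N : ℝ) * t⌋ = z'
    rw [div_sub_div_same, abs_div, abs_of_pos hN, div_sub_div_same, min_div_div_right hN.le,
      div_le_iff₀ hN, ← @Int.cast_le ℝ, intDist]
    push_cast
    constructor <;> intro h <;> linarith
  rcases hlam.eq_or_lt with rfl | hpos
  · have hN := tendsto_ratio_of_zero hl (by simpa using hr)
    simp only [bandDist, if_true] at hst ⊢
    have h2 := (hN.atTop_add hd.neg).eventually_gt_atTop (1 / 2)
    rcases lt_or_gt_of_ne hst with h | h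
    · filter_upwards [hd.eventually_lt_const h, hl.eventually_gt_atTop 0] with N h1 hN
      rw [key N hN]
      exact iff_of_true ((min_le_left _ _).trans h1.le) h
    · filter_upwards [hd.eventually_const_lt h, h2, hl.eventually_gt_atTop 0] with N h1 h2 hN
      rw [key N hN]
      exact iff_of_false (not_le.2 (lt_min h1 (by linarith))) (not_lt.2 h.le)
  · have hN := tendsto_ratio_of_pos hpos hr
    have hm := hd.min (hN.sub hd)
    simp only [bandDist, if_neg hpos.ne'] at hst ⊢
    rcases lt_or_gt_of_ne hst with h | h
    · filter_upwards [hm.eventually_lt_const h, hl.eventually_gt_atTop 0] with N h1 hN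
      rw [key N hN]
      exact iff_of_true h1.le h
    · filter_upwards [hm.eventually_const_lt h, hl.eventually_gt_atTop 0] with N h1 hN
      rw [key N hN]
      exact iff_of_false (not_le.2 h1) (not_lt.2 h.le)

theorem measurableSet_cellUnion (N l : ℕ) : MeasurableSet (cellUnion Adj root N l) := by
  have hfl : ∀ v, Measurable fun x => ⌊(l : ℝ) * coord root v x⌋ := fun v =>
    ((measurable_coord root v).const_mul _).floor
  have : cellUnion Adj root N l =
      (⋂ v, {x | -(N : ℤ) ≤ 2 * ⌊l * coord root v x⌋ ∧ 2 * ⌊l * coord root v x⌋ < N}) ∩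
      ⋂ u, ⋂ v, ⋂ _ : Adj u v,
        {x | 2 * intDist N ⌊l * coord root u x⌋ ⌊l * coord root v x⌋ ≤ l} := by
    ext x
    simp [cellUnion]
  rw [this]
  refine MeasurableSet.inter (MeasurableSet.iInter fun v => ?_)
    (MeasurableSet.iInter fun u => MeasurableSet.iInter fun v => MeasurableSet.iInter fun _ => ?_)
  · exact hfl v (MeasurableSet.of_discrete (s := {z : ℤ | -(N : ℤ) ≤ 2 * z ∧ 2 * z < N}))
  · exact ((hfl u).prodMk (hfl v))
      (MeasurableSet.of_discrete (s := {p : ℤ × ℤ | 2 * intDist N p.1 p.2 ≤ l}))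

/-- The cells fill the body `D_Γ` in the limit. -/
theorem tendsto_volume_cellUnion (hconn : ∀ v, Relation.ReflTransGen Adj root v)
    (hlam : 0 ≤ lam) (hlam' : lam ≤ 1 / 2)
    (hl : Tendsto (fun N => (l N : ℝ)) atTop atTop)
    (hr : Tendsto (fun N : ℕ => (l N : ℝ) / N) atTop (𝓝 (2 * lam))) :
    Tendsto (fun N => volume (cellUnion Adj root N (l N))) atTop
      (𝓝 (volume (bandBody Adj root lam))) := by
  obtain ⟨R, hR⟩ := exists_cellUnion_subset Adj root hconn
  refine tendsto_measure_of_ae_tendsto_indicator atTop (measurableSet_bandBody Adj root lam)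
    (fun N => measurableSet_cellUnion Adj root N (l N)) (B := Metric.closedBall 0 R)
    measurableSet_closedBall measure_closedBall_lt_top.ne ?_ ?_
  · filter_upwards [hl.eventually_gt_atTop 0] with N hN
    exact hR N (l N) (by exact_mod_cast hN)
  · have hne : ∀ (L : ({v : V // v ≠ root} → ℝ) →ₗ[ℝ] ℝ) (c : ℝ), c ≠ 0 →
        ∀ᵐ x, L x ≠ c := fun L c hc => by
      rw [ae_iff]
      simpa using volume_coord_eq root L hc
    have habs : ∀ (L : ({v : V // v ≠ root} → ℝ) →ₗ[ℝ] ℝ) (c : ℝ), c ≠ 0 →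
        ∀ᵐ x, |L x| ≠ c := fun L c hc => by
      filter_upwards [hne L c hc, hne L (-c) (neg_ne_zero.2 hc)] with x h1 h2 h3
      rcases eq_or_eq_neg_of_abs_eq h3 with h | h
      · exact h1 h
      · exact h2 h
    have hw : ∀ᵐ x, ∀ v, lam ≠ 0 → |coord root v x| ≠ 1 / (4 * lam) := by
      rw [ae_all_iff]
      intro v
      by_cases h : lam = 0
      · simp [h]
      · filter_upwards [habs (coord root v) (1 / (4 * lam)) (by positivity)] with x hx _
        exact hx
    have hd : ∀ᵐ x, ∀ u v, bandDist lam (coord root u x) (coord root v x) ≠ 1 / 2 := by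
      rw [ae_all_iff]
      intro u
      rw [ae_all_iff]
      intro v
      have h1 := habs (coord root u - coord root v) (1 / 2) (by norm_num)
      by_cases h : lam = 0
      · filter_upwards [h1] with x hx
        simpa [bandDist, h] using hx
      · have hpos : 0 < lam := lt_of_le_of_ne hlam (Ne.symm h)
        -- The bound λ ≤ 1/2 keeps the second boundary value of |x_u - x_v|, where the wrapped
        -- distance equals 1/2, away from 0, so that its level set is null even for u = v.
        have hc : 1 / (2 * lam) - 1 / 2 ≠ 0 := by
          have : 1 ≤ 1 / (2 * lam) := by rw [le_div_iff₀ (by positivity)]; linarith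
          intro h'; linarith
        filter_upwards [h1, habs (coord root u - coord root v) _ hc] with x hx hx' heq
        simp only [bandDist, if_neg h] at heq
        simp only [LinearMap.sub_apply] at hx hx'
        rcases min_choice |coord root u x - coord root v x|
          (1 / (2 * lam) - |coord root u x - coord root v x|) with h' | h'
        · exact hx (h'.symm.trans heq)
        · exact hx' (by linarith [h'.symm.trans heq])
    filter_upwards [hw, hd] with x hx1 hx2
    have e1 : ∀ᶠ N : ℕ in atTop, ∀ v, (-(N : ℤ) ≤ 2 * ⌊l N * coord root v x⌋ ∧
        2 * ⌊l N * coord root v x⌋ < N) ↔ coord root v x ∈ bandInterval lam :=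
      eventually_all.2 fun v => eventually_window_iff hlam hl hr (hx1 v)
    have e2 : ∀ᶠ N : ℕ in atTop, ∀ u v,
        (2 * intDist N ⌊l N * coord root u x⌋ ⌊l N * coord root v x⌋ ≤ l N) ↔
          bandDist lam (coord root u x) (coord root v x) < 1 / 2 :=
      eventually_all.2 fun u => eventually_all.2 fun v => eventually_dist_iff hlam hl hr (hx2 u v)
    filter_upwards [e1, e2] with N h1 h2
    rw [mem_bandBody_iff]
    simp only [cellUnion, Set.mem_ofPred_eq, h1, h2]

/-- The approximating cells stay in a fixed ball. Finiteness is what allows the limit to pass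
through `ENNReal.toReal`. -/
theorem volume_bandBody_lt_top (hconn : ∀ v, Relation.ReflTransGen Adj root v)
    (hlam : 0 ≤ lam) (hlam' : lam ≤ 1 / 2)
    (hl : Tendsto (fun N => (l N : ℝ)) atTop atTop)
    (hr : Tendsto (fun N : ℕ => (l N : ℝ) / N) atTop (𝓝 (2 * lam))) :
    volume (bandBody Adj root lam) ≠ ⊤ := by
  obtain ⟨R, hR⟩ := exists_cellUnion_subset Adj root hconn
  have h := tendsto_volume_cellUnion Adj root hconn hlam hlam' hl hr
  have hle : volume (bandBody Adj root lam) ≤ volume (Metric.closedBall (0 : {v : V // v ≠ root} → ℝ) R) := by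
    refine le_of_tendsto h ?_
    filter_upwards [hl.eventually_gt_atTop 0] with N hN
    exact measure_mono (hR N (l N) (by exact_mod_cast hN))
  exact (hle.trans_lt measure_closedBall_lt_top).ne

/-- The normalized number of labellings of a connected graph tends to the volume of its body. -/
theorem tendsto_card_bandLabelling (hconn : ∀ v, Relation.ReflTransGen Adj root v) {b : ℕ → ℕ}
    (hlam : 0 ≤ lam) (hlam' : lam ≤ 1 / 2)
    (hl : Tendsto (fun N => (bandCount N (b N) : ℝ)) atTop atTop)
    (hr : Tendsto (fun N : ℕ => (bandCount N (b N) : ℝ) / N) atTop (𝓝 (2 * lam))) :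
    Tendsto (fun N : ℕ => (Nat.card {y : V → Fin N // IsBandLabelling (b N) Adj y} : ℝ) /
      (N * (bandCount N (b N) : ℝ) ^ (Fintype.card V - 1))) atTop
      (𝓝 (volume (bandBody Adj root lam)).toReal) := by
  have h := (ENNReal.tendsto_toReal (volume_bandBody_lt_top Adj root hconn hlam hlam' hl hr)).comp
    (tendsto_volume_cellUnion Adj root hconn hlam hlam' hl hr)
  refine h.congr' ?_
  filter_upwards [eventually_gt_atTop 0] with N hN
  have : NeZero N := ⟨hN.ne'⟩
  have hN' : (N : ℝ) ≠ 0 := by exact_mod_cast hN.ne'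
  rw [Function.comp_apply, volume_cellUnion, card_bandLabelling_eq_mul Adj root, Nat.cast_mul,
    mul_div_mul_left _ _ hN']

end Limit

end Volume

/-! ### Asymptotics of the genus expansion -/

section Asymptotics

theorem bandCount_pos {N : ℕ} (hN : N ≠ 0) (b : ℕ) : 0 < bandCount N b := by
  unfold bandCount; omega

theorem bandCount_le (N b : ℕ) : bandCount N b ≤ N := min_le_right _ _

variable {k : ℕ} {ws : Fin k → List Letter} {φ : Equiv.Perm (Edge ws)}

/-- Each surface edge carries two factors l^(-1/2), one for each polygon edge. -/
theorem weight_eq (h : IsAdmissible φ) (N b : ℕ) :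
    weight N b φ = labelCount N b φ / (bandCount N b : ℝ) ^ Nat.card (SurfaceEdge φ) := by
  rw [weight, ← two_mul_card_surfaceEdge h, pow_mul, div_pow, one_pow,
    Real.sq_sqrt (Nat.cast_nonneg _), div_pow, one_pow]
  ring

theorem weight_nonneg (N b : ℕ) : 0 ≤ weight N b φ := by
  unfold weight; positivity

/-- The forest bound N^C l^(V-C), divided by l^E. The integer m records the available Euler
inequality: m = k in general, and more when the surface is known not to be a sphere. -/
theorem weight_le (h : IsAdmissible φ) {N : ℕ} (hN : N ≠ 0) (b : ℕ) {m : ℕ}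
    (hm : Nat.card (Vertex φ) + m ≤ Nat.card (SurfaceEdge φ) + 2 * Nat.card (Component φ)) :
    weight N b φ ≤ (N * bandCount N b : ℝ) ^ Nat.card (Component φ) / (bandCount N b : ℝ) ^ m := by
  have : NeZero N := ⟨hN⟩
  have hl : (1 : ℝ) ≤ bandCount N b := by exact_mod_cast bandCount_pos hN b
  have h1 : (labelCount N b φ : ℝ) ≤ (N : ℝ) ^ Nat.card (Component φ) *
      (bandCount N b : ℝ) ^ (Nat.card (Vertex φ) - Nat.card (Component φ)) := by
    exact_mod_cast labelCount_le h N b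
  have h2 := card_component_le_card_vertex φ
  rw [weight_eq h, div_le_div_iff₀ (by positivity) (by positivity)]
  generalize Nat.card (Component φ) = c at *
  generalize Nat.card (Vertex φ) = v at *
  generalize Nat.card (SurfaceEdge φ) = e at *
  calc (labelCount N b φ : ℝ) * (bandCount N b : ℝ) ^ m
      ≤ ((N : ℝ) ^ c * (bandCount N b : ℝ) ^ (v - c)) * (bandCount N b : ℝ) ^ m := by gcongr
    _ = (N : ℝ) ^ c * (bandCount N b : ℝ) ^ (v - c + m) := by rw [mul_assoc, ← pow_add]
    _ ≤ (N : ℝ) ^ c * (bandCount N b : ℝ) ^ (c + e) := by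
        exact mul_le_mul_of_nonneg_left (pow_le_pow_right₀ hl (by omega)) (by positivity)
    _ = _ := by rw [mul_pow, pow_add, mul_assoc]

theorem isSpherical_iff (φ : Equiv.Perm (Edge ws)) :
    IsSpherical φ ↔ Nat.card (Component φ) = 1 ∧
      Nat.card (Vertex φ) + k = Nat.card (SurfaceEdge φ) + 2 := by
  unfold IsSpherical genus eulerChar
  refine and_congr_right fun h => ?_
  rw [h]
  push_cast
  constructor
  · intro h
    have : (Nat.card (Vertex φ) + k : ℚ) = Nat.card (SurfaceEdge φ) + 2 := by linarith
    exact_mod_cast this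
  · intro h
    have : (Nat.card (Vertex φ) + k : ℚ) = Nat.card (SurfaceEdge φ) + 2 := by exact_mod_cast h
    linarith

open Classical in
theorem sum_sphericalPairings (f : Equiv.Perm (Edge ws) → ℝ) :
    ∑ φ ∈ sphericalPairings ws, f φ =
      ∑ φ : Equiv.Perm (Edge ws), if IsAdmissible φ ∧ IsSpherical φ then f φ else 0 := by
  rw [sphericalPairings, Finset.sum_filter]

variable {N : ℕ} {Ω : Type*} [MeasurableSpace Ω] {P : Measure Ω} [IsProbabilityMeasure P]
  {Z : ℕ × Fin N × Fin N → Ω → ℂ}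

theorem forall_single_ne_nil {w : List Letter} (hw : w ≠ []) : ∀ j, (![w]) j ≠ [] := fun j => by
  rw [Subsingleton.elim j 0]; exact hw

/-- The expected trace is `a_w N` up to an error of order `N / l ^ 2`. -/
theorem norm_integral_traceVar_sub_le (hN : N ≠ 0) (b : ℕ) {w : List Letter} (hw : w ≠ [])
    (hlaw : ∀ q, HasLaw (Z q) stdComplexGaussian P) (hindep : iIndepFun Z P) :
    ‖(∫ ω, traceVar b (fun q => Z q ω) w ∂P) - (aParam w : ℂ) * N‖ ≤
      Fintype.card (Equiv.Perm (Edge ![w])) * ((N : ℝ) / (bandCount N b : ℝ) ^ 2) := by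
  classical
  have : NeZero N := ⟨hN⟩
  have hl : (0 : ℝ) < bandCount N b := by exact_mod_cast bandCount_pos hN b
  have hws := forall_single_ne_nil hw
  have h1 := prod_integral_traceVar (b := b) hws hlaw hindep (fun _ => ())
  simp only [Finset.univ_unique, Finset.prod_singleton, implies_true, and_true,
    Finset.filter_true] at h1
  have h2 : (∫ ω, traceVar b (fun q => Z q ω) w ∂P) =
      ((∑ φ : Equiv.Perm (Edge ![w]), if IsAdmissible φ then weight N b φ else 0 : ℝ) : ℂ) := by
    push_cast
    simpa [apply_ite Complex.ofReal] using h1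
  have h3 : (aParam w : ℝ) * N =
      ∑ φ : Equiv.Perm (Edge ![w]), if IsAdmissible φ ∧ IsSpherical φ then (N : ℝ) else 0 := by
    rw [← sum_sphericalPairings, Finset.sum_const, nsmul_eq_mul, aParam]
  rw [h2, show (aParam w : ℂ) * N = (((aParam w : ℝ) * N : ℝ) : ℂ) by push_cast; rfl, h3,
    ← Complex.ofReal_sub, Complex.norm_real, ← Finset.sum_sub_distrib]
  refine (norm_sum_le _ _).trans ?_
  rw [← Finset.card_univ, ← nsmul_eq_mul, ← Finset.sum_const]
  refine Finset.sum_le_sum fun φ _ => ?_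
  by_cases hA : IsAdmissible φ
  · have hC := card_component_eq_one_of_single hw φ
    have hpar := even_card_vertex_add hws hA
    have hgen := card_vertex_add_le hws hA
    by_cases hS : IsSpherical φ
    · have hE := ((isSpherical_iff φ).1 hS).2
      rw [if_pos hA, if_pos ⟨hA, hS⟩, weight_eq hA,
        labelCount_eq_of_tree hA N b (by rw [hC]; omega), hC]
      push_cast
      rw [pow_one, mul_div_assoc, div_self (by positivity), mul_one, sub_self, norm_zero]
      positivity
    · have hE : ¬ Nat.card (Vertex φ) + 1 = Nat.card (SurfaceEdge φ) + 2 := fun h =>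
        hS ((isSpherical_iff φ).2 ⟨hC, h⟩)
      -- V + 1 is at most E + 2, differs from it and has the same parity, so V + 3 ≤ E + 2. This
      -- gives the weight bound N l / l^3.
      have hle := weight_le hA hN b (m := 3) (by
        rw [hC] at hgen ⊢
        obtain ⟨r, hr⟩ := hpar
        omega)
      rw [hC, pow_one] at hle
      rw [if_pos hA, if_neg fun h => hS h.2, sub_zero, Real.norm_of_nonneg (weight_nonneg N b)]
      refine hle.trans (le_of_eq ?_)
      field_simp
  · rw [if_neg hA, if_neg fun h => hA h.1, sub_self, norm_zero]
    positivity

/-! ### Limits of covariances. -/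

section Covariance

variable {w₁ w₂ : List Letter}

open Classical in
theorem integral_centredTrace_mul (hw1 : w₁ ≠ []) (hw2 : w₂ ≠ [])
    (hlaw : ∀ q, HasLaw (Z q) stdComplexGaussian P) (hindep : iIndepFun Z P) (b : ℕ) :
    ∫ ω, centredTrace P b Z w₁ ω * centredTrace P b Z w₂ ω ∂P =
      ((∑ φ : Equiv.Perm (Edge ![w₁, w₂]),
        if IsAdmissible φ ∧ NoIsolatedFace φ then weight N b φ else 0 : ℝ) : ℂ) := by
  have hws : ∀ j, (![w₁, w₂] : Fin 2 → List Letter) j ≠ [] := by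
    intro j; fin_cases j <;> assumption
  have h1 := prod_integral_centredTrace (b := b) hws hlaw hindep (fun _ => ())
  simp only [Finset.univ_unique, Finset.prod_singleton, implies_true, and_true,
    Finset.filter_true, Fin.prod_univ_two] at h1
  push_cast
  simp only [apply_ite Complex.ofReal, Complex.ofReal_zero]
  exact h1

theorem tendsto_alpha {φ : Equiv.Perm (Edge ws)} (h : IsAdmissible φ)
    (hC : Nat.card (Component φ) = 1) {b : ℕ → ℕ} {lam : ℝ} (hlam : 0 ≤ lam) (hlam' : lam ≤ 1 / 2)
    (hl : Tendsto (fun N => (bandCount N (b N) : ℝ)) atTop atTop)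
    (hr : Tendsto (fun N : ℕ => (bandCount N (b N) : ℝ) / N) atTop (𝓝 (2 * lam))) :
    Tendsto (fun N : ℕ => (labelCount N (b N) φ : ℝ) /
      (N * (bandCount N (b N) : ℝ) ^ (Nat.card (Vertex φ) - 1))) atTop (𝓝 (alpha lam φ)) := by
  classical
  have hne : Nonempty (Vertex φ) := by
    have : 0 < Nat.card (Vertex φ) := by
      have := card_component_le_card_vertex φ
      omega
    exact (Nat.card_pos_iff.1 this).1
  have hconn : ∀ v, Relation.ReflTransGen (GraphAdj φ) (Classical.choice hne) v := fun v =>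
    reflTransGen_of_component_eq h ((Nat.card_eq_one_iff_unique.1 hC).1.elim _ _)
  have := tendsto_card_bandLabelling (GraphAdj φ) (Classical.choice hne) hconn hlam hlam' hl hr
  simp_rw [labelCount_eq h, Nat.card_eq_fintype_card (α := Vertex φ)]
  rw [alpha, dif_pos hne]
  convert this

/-- The covariances of the traces, multiplied by `l / N`, tend to sums of volumes. -/
theorem tendsto_covariance (hw1 : w₁ ≠ []) (hw2 : w₂ ≠ []) {b : ℕ → ℕ}
    {lam : ℝ} (hlam : 0 ≤ lam) (hlam' : lam ≤ 1 / 2)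
    (hl : Tendsto (fun N => (bandCount N (b N) : ℝ)) atTop atTop)
    (hr : Tendsto (fun N : ℕ => (bandCount N (b N) : ℝ) / N) atTop (𝓝 (2 * lam)))
    {Ω : ℕ → Type*} [∀ N, MeasurableSpace (Ω N)]
    {P : (N : ℕ) → Measure (Ω N)} [∀ N, IsProbabilityMeasure (P N)]
    {Z : (N : ℕ) → ℕ × Fin N × Fin N → Ω N → ℂ}
    (hlaw : ∀ N q, HasLaw (Z N q) stdComplexGaussian (P N))
    (hindep : ∀ N, iIndepFun (Z N) (P N)) :
    Tendsto (fun N : ℕ => ((bandCount N (b N) / N : ℝ) : ℂ) *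
      ∫ ω, centredTrace (P N) (b N) (Z N) w₁ ω * centredTrace (P N) (b N) (Z N) w₂ ω ∂(P N)) atTop
      (𝓝 ((∑ φ ∈ sphericalPairings ![w₁, w₂], alpha lam φ : ℝ) : ℂ)) := by
  classical
  have hws : ∀ j, (![w₁, w₂] : Fin 2 → List Letter) j ≠ [] := by
    intro j; fin_cases j <;> assumption
  simp_rw [fun N => integral_centredTrace_mul hw1 hw2 (hlaw N) (hindep N) (b N),
    ← Complex.ofReal_mul]
  refine (Complex.continuous_ofReal.tendsto _).comp ?_
  rw [sum_sphericalPairings]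
  simp_rw [Finset.mul_sum]
  refine tendsto_finsetSum _ fun φ _ => ?_
  by_cases hA : IsAdmissible φ
  swap
  · simp [hA]
  by_cases hS : IsSpherical φ
  · obtain ⟨hC, hE⟩ := (isSpherical_iff φ).1 hS
    have hI := noIsolatedFace_of_connected hw1 hw2 hA hC
    simp only [hA, hS, hI, and_self, if_true]
    refine (tendsto_alpha hA hC hlam hlam' hl hr).congr' ?_
    filter_upwards [eventually_gt_atTop 0] with N hN
    have hl' : (0 : ℝ) < bandCount N (b N) := by exact_mod_cast bandCount_pos hN.ne' (b N)
    have hN' : (0 : ℝ) < N := by exact_mod_cast hN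
    -- A sphere with two faces has V = E, so the factor l/N turns the denominator l^E into N
    -- l^(V-1), the normalization under which labellings converge to a volume.
    have hV : Nat.card (SurfaceEdge φ) = (Nat.card (Vertex φ) - 1) + 1 := by
      have := card_component_le_card_vertex φ
      omega
    rw [weight_eq hA, hV, pow_succ]
    field_simp
  · by_cases hI : NoIsolatedFace φ
    swap
    · simp [hI, hS]
    simp only [hA, hS, hI, and_true, and_false, if_true, if_false]
    have hgen := card_vertex_add_le hws hA
    have h2C := two_mul_card_component_le hws hI
    obtain ⟨e, -⟩ := fst_surjective hws 0
    have hC1 : 0 < Nat.card (Component φ) := by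
      have : Nonempty (Component φ) := ⟨Quot.mk _ e⟩
      exact Nat.card_pos
    have hC : Nat.card (Component φ) = 1 := by omega
    have hE : ¬ Nat.card (Vertex φ) + 2 = Nat.card (SurfaceEdge φ) + 2 := fun h =>
      hS ((isSpherical_iff φ).2 ⟨hC, h⟩)
    have hinv : Tendsto (fun N : ℕ => (bandCount N (b N) : ℝ)⁻¹) atTop (𝓝 0) :=
      tendsto_inv_atTop_zero.comp hl
    refine squeeze_zero' (Eventually.of_forall fun N => ?_) ?_ hinv
    · have := weight_nonneg (φ := φ) N (b N)
      positivity
    · filter_upwards [eventually_gt_atTop 0] with N hN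
      have hl' : (0 : ℝ) < bandCount N (b N) := by exact_mod_cast bandCount_pos hN.ne' (b N)
      have hN' : (0 : ℝ) < N := by exact_mod_cast hN
      -- The genus inequality V + 2 ≤ E + 2 is strict here, hence V + 3 ≤ E + 2; the single power of
      -- l gained suffices, without the parity argument.
      have hle := weight_le hA hN.ne' (b N) (m := 3) (by omega)
      rw [hC, pow_one] at hle
      calc (bandCount N (b N) : ℝ) / N * weight N (b N) φ
          ≤ (bandCount N (b N) : ℝ) / N * ((N * bandCount N (b N) : ℝ) / bandCount N (b N) ^ 3) := by
            gcongr
        _ = _ := by field_simp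

end Covariance

/-! ### The approximate Wick recursion. -/

section Recursion

/-- The colouring that separates the faces `j₀`, `j` from the others. -/
def pairColour {n : ℕ} (j₀ j i : Fin n) : Bool := decide (i = j₀ ∨ i = j)

theorem exists_leaving_of_not_respects (h : ∀ e, φ (φ e) = e) {j₀ j : Fin k}
    (hn : ¬ ∀ e, pairColour j₀ j (φ e).1 = pairColour j₀ j e.1) :
    ∃ e : Edge ws, (e.1 = j₀ ∨ e.1 = j) ∧ (φ e).1 ≠ j₀ ∧ (φ e).1 ≠ j := by
  push Not at hn
  obtain ⟨e, he⟩ := hn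
  simp only [pairColour, ne_eq, decide_eq_decide] at he
  by_cases h1 : e.1 = j₀ ∨ e.1 = j
  · refine ⟨e, h1, ?_⟩
    rw [← not_or]
    exact fun h2 => he (iff_of_true h2 h1)
  · have h2 : (φ e).1 = j₀ ∨ (φ e).1 = j := by
      by_contra h2
      exact he (iff_of_false h2 h1)
    refine ⟨φ e, h2, ?_⟩
    rw [h, ← not_or]
    exact h1

/-- Some edge of j₀ is glued to another face, which must be the partner in either pair. Hence each
pairing is counted at most once in the subtracted sum. -/
theorem not_respects_two (hI : NoIsolatedFace φ) {j₀ j j' : Fin k} (hj : j ≠ j')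
    (h1 : ∀ e, pairColour j₀ j (φ e).1 = pairColour j₀ j e.1)
    (h2 : ∀ e, pairColour j₀ j' (φ e).1 = pairColour j₀ j' e.1) : False := by
  obtain ⟨e, he, hne⟩ := hI j₀
  have e1 := h1 e
  have e2 := h2 e
  simp only [pairColour, decide_eq_decide, he, true_or, iff_true] at e1 e2
  rcases e1 with e1 | e1
  · exact hne e1
  · rcases e2 with e2 | e2
    · exact hne e2
    · exact hj (e1.symm.trans e2)

/-- The approximate recursion of Wick type for the joint moments of the centred traces. -/
theorem norm_recursion_le (hN : N ≠ 0) (b : ℕ) (hws : ∀ j, ws j ≠ [])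
    (hlaw : ∀ q, HasLaw (Z q) stdComplexGaussian P) (hindep : iIndepFun Z P) (j₀ : Fin k) :
    ‖((√(bandCount N b / N) : ℝ) : ℂ) ^ k * ((∫ ω, ∏ j, centredTrace P b Z (ws j) ω ∂P) -
      ∑ j ∈ Finset.univ.erase j₀, ∏ c : Bool, ∫ ω, ∏ i ∈ Finset.univ.filter
        (fun i => pairColour j₀ j i = c), centredTrace P b Z (ws i) ω ∂P)‖ ≤
      Fintype.card (Equiv.Perm (Edge ws)) * (bandCount N b : ℝ)⁻¹ := by
  classical
  have hl : (1 : ℝ) ≤ bandCount N b := by exact_mod_cast bandCount_pos hN b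
  have hN' : (0 : ℝ) < N := by exact_mod_cast Nat.pos_of_ne_zero hN
  have h1 := prod_integral_centredTrace (b := b) hws hlaw hindep (fun _ => ())
  simp only [Finset.univ_unique, Finset.prod_singleton, implies_true, and_true,
    Finset.filter_true] at h1
  simp_rw [prod_integral_centredTrace (b := b) hws hlaw hindep]
  rw [h1, Finset.sum_comm, ← Finset.sum_sub_distrib, Finset.mul_sum]
  refine (norm_sum_le _ _).trans ?_
  rw [← Finset.card_univ, ← nsmul_eq_mul, ← Finset.sum_const]
  refine Finset.sum_le_sum fun φ _ => ?_
  have hnn : 0 ≤ (bandCount N b : ℝ)⁻¹ := by positivity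
  by_cases hAI : IsAdmissible φ ∧ NoIsolatedFace φ
  swap
  · rw [if_neg hAI, Finset.sum_eq_zero fun j _ => if_neg fun h => hAI ⟨h.1.1, h.2⟩]
    simp
  obtain ⟨hA, hI⟩ := hAI
  simp only [hA, hI, true_and, and_true, if_true]
  -- If j₀ and some j form a union of components, the term cancels exactly against the one for that
  -- j. Otherwise the component of j₀ has at least three faces.
  by_cases hR : ∃ j, j ≠ j₀ ∧ ∀ e, pairColour j₀ j (φ e).1 = pairColour j₀ j e.1
  · obtain ⟨j, hj, hR⟩ := hR
    rw [Finset.sum_eq_single_of_mem j (by simp [hj])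
      (fun j' _ hj' => if_neg fun h => not_respects_two hI hj' h hR), if_pos hR]
    simp
  · push Not at hR
    rw [Finset.sum_eq_zero fun j hj => if_neg fun h => by
      obtain ⟨e, he⟩ := hR j (by simpa using hj)
      exact he (h e)]
    have hC := two_mul_card_component_lt hws hI j₀ fun j hj =>
      exists_leaving_of_not_respects hA.1 fun h => by
        obtain ⟨e, he⟩ := hR j hj
        exact he (h e)
    have hle := weight_le hA hN b (card_vertex_add_le hws hA)
    rw [sub_zero, ← Complex.ofReal_pow, ← Complex.ofReal_mul, Complex.norm_real,
      Real.norm_of_nonneg (mul_nonneg (by positivity) (weight_nonneg N b))]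
    generalize Nat.card (Component φ) = c at *
    -- The excess k - 2C is positive. The powers (l/N)^C and (N l)^C cancel against l^(2C), leaving
    -- √(l/N)/l to the power k - 2C.
    obtain ⟨r, hr⟩ : ∃ r, k = 2 * c + (r + 1) := ⟨k - 2 * c - 1, by omega⟩
    have hs1 : √(bandCount N b / N : ℝ) ≤ 1 := by
      refine Real.sqrt_le_one.2 ?_
      rw [div_le_one hN']
      exact_mod_cast bandCount_le N b
    have hs2 : √(bandCount N b / N : ℝ) ^ (2 * c) = (bandCount N b / N : ℝ) ^ c := by
      rw [pow_mul, Real.sq_sqrt (by positivity)]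
    calc √(bandCount N b / N : ℝ) ^ k * weight N b φ
        ≤ √(bandCount N b / N : ℝ) ^ k *
          ((N * bandCount N b : ℝ) ^ c / (bandCount N b : ℝ) ^ k) := by gcongr
      _ = (√(bandCount N b / N : ℝ) / bandCount N b) ^ (r + 1) := by
          have hk : ∀ x : ℝ, x ^ k = x ^ (2 * c) * x ^ (r + 1) := fun x => by rw [hr, pow_add]
          rw [hk, hk, hs2, div_pow, div_pow, mul_pow, pow_mul]
          field_simp
          ring
      _ ≤ (√(bandCount N b / N : ℝ) / bandCount N b) ^ 1 := by
          refine pow_le_pow_of_le_one (by positivity) ?_ (by omega)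
          rw [div_le_one (by positivity)]
          exact hs1.trans hl
      _ ≤ _ := by
          rw [pow_one, div_eq_mul_inv]
          exact mul_le_of_le_one_left hnn hs1

end Recursion

end Asymptotics

/-! ### The method of moments -/

section Moments

theorem hasDerivAt_sum_exp (n : ℕ) (x : ℝ) :
    HasDerivAt (fun x : ℝ => ∑ k ∈ Finset.range (n + 1), (Complex.I * x) ^ k / (k.factorial : ℂ))
      (Complex.I * ∑ k ∈ Finset.range n, (Complex.I * x) ^ k / (k.factorial : ℂ)) x := by
  induction n with
  | zero => simpa using hasDerivAt_const x (1 : ℂ)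
  | succ n ih =>
    simp_rw [Finset.sum_range_succ _ (n + 1)]
    rw [Finset.sum_range_succ _ n, mul_add]
    refine ih.add ?_
    have h1 : HasDerivAt (fun x : ℝ => Complex.I * (x : ℂ)) Complex.I x := by
      simpa using (Complex.ofRealCLM.hasDerivAt (x := x)).const_mul Complex.I
    refine ((h1.pow (n + 1)).div_const ((n + 1).factorial : ℂ)).congr_deriv ?_
    have : ((n : ℂ) + 1) ≠ 0 := by exact_mod_cast Nat.succ_ne_zero n
    rw [Nat.factorial_succ]
    push_cast
    field_simp

/-- The remainder in the expansion of `exp (i x)`. -/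
theorem norm_exp_I_mul_sub_sum_le (n : ℕ) (x : ℝ) :
    ‖Complex.exp (Complex.I * x) - ∑ k ∈ Finset.range n, (Complex.I * x) ^ k / (k.factorial : ℂ)‖ ≤
      |x| ^ n / n.factorial := by
  set f : ℕ → ℝ → ℂ := fun n x => Complex.exp (Complex.I * x) -
    ∑ k ∈ Finset.range n, (Complex.I * x) ^ k / (k.factorial : ℂ) with hf
  have hpos : ∀ n x, 0 ≤ x → ‖f n x‖ ≤ x ^ n / n.factorial := by
    intro n
    induction n with
    | zero =>
      intro x _
      simp only [hf, Finset.range_zero, Finset.sum_empty, sub_zero, pow_zero, Nat.factorial_zero,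
        Nat.cast_one, div_one]
      rw [mul_comm, Complex.norm_exp_ofReal_mul_I]
    | succ n ih =>
      intro x hx
      have hd : ∀ y, HasDerivAt (f (n + 1)) (Complex.I * f n y) y := by
        intro y
        have h1 : HasDerivAt (fun x : ℝ => Complex.I * (x : ℂ)) Complex.I y := by
          simpa using (Complex.ofRealCLM.hasDerivAt (x := y)).const_mul Complex.I
        refine (h1.cexp.sub (hasDerivAt_sum_exp n y)).congr_deriv ?_
        simp only [hf]; ring
      have hB : ∀ y : ℝ, HasDerivAt (fun y : ℝ => y ^ (n + 1) / ((n + 1).factorial : ℝ))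
          (y ^ n / n.factorial) y := by
        intro y
        refine ((hasDerivAt_pow (n + 1) y).div_const ((n + 1).factorial : ℝ)).congr_deriv ?_
        rw [Nat.factorial_succ]
        push_cast
        field_simp
      -- The remainder of order n+1 vanishes at 0 and has derivative i times the remainder of order
      -- n, so the inductive bound integrates.
      refine image_norm_le_of_norm_deriv_right_le_deriv_boundary (a := 0) (b := x)
        (fun y _ => (hd y).continuousAt.continuousWithinAt)
        (fun y _ => (hd y).hasDerivWithinAt) ?_ hB (fun y hy => ?_) ⟨hx, le_refl x⟩
      · simp [hf, Finset.sum_range_succ']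
      · rw [norm_mul, Complex.norm_I, one_mul]
        exact ih y hy.1
  change ‖f n x‖ ≤ _
  rcases le_or_gt 0 x with h | h
  · rw [abs_of_nonneg h]; exact hpos n x h
  · have hconj : f n x = starRingEnd ℂ (f n (-x)) := by
      simp only [hf, map_sub, map_sum, map_div₀, map_pow, map_mul, ← Complex.exp_conj,
        Complex.conj_I, Complex.conj_ofReal, map_natCast]
      push_cast
      simp
    rw [hconj, RCLike.norm_conj, abs_of_neg h]
    exact hpos n (-x) (by linarith)

/-- The moments of a centred Gaussian variable of variance `v`. -/
noncomputable def gaussMoment (v : ℝ) : ℕ → ℝ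
  | 0 => 1
  | 1 => 0
  | (k + 2) => (k + 1) * v * gaussMoment v k

theorem gaussMoment_odd (v : ℝ) (m : ℕ) : gaussMoment v (2 * m + 1) = 0 := by
  induction m with
  | zero => rfl
  | succ m ih =>
    rw [show 2 * (m + 1) + 1 = (2 * m + 1) + 2 by ring, gaussMoment, ih, mul_zero]

/-- The recursion solved in the form of an exponential series: it identifies the limit and shows
that the Taylor remainders are small. -/
theorem gaussMoment_even (v : ℝ) (m : ℕ) :
    gaussMoment v (2 * m) / (2 * m).factorial = (v / 2) ^ m / m.factorial := by
  induction m with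
  | zero => simp [gaussMoment]
  | succ m ih =>
    rw [show 2 * (m + 1) = 2 * m + 2 by ring, gaussMoment, Nat.factorial_succ, Nat.factorial_succ,
      Nat.factorial_succ, pow_succ]
    have h1 : ((2 * m).factorial : ℝ) ≠ 0 := by positivity
    have h2 : (m.factorial : ℝ) ≠ 0 := by positivity
    rw [div_eq_div_iff h1 h2] at ih
    push_cast
    rw [div_eq_div_iff (by positivity) (by positivity)]
    linear_combination ((m : ℝ) + 1) * (2 * m + 1) * v * ih

/-- The odd moments vanish, so the truncated moment series is a partial sum of the series of
exp(-v/2). -/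
theorem sum_gaussMoment (v : ℝ) (m : ℕ) :
    ∑ k ∈ Finset.range (2 * m), Complex.I ^ k / (k.factorial : ℂ) * (gaussMoment v k : ℂ) =
      ∑ j ∈ Finset.range m, (-(v : ℂ) / 2) ^ j / (j.factorial : ℂ) := by
  induction m with
  | zero => simp
  | succ m ih =>
    rw [show 2 * (m + 1) = 2 * m + 1 + 1 by ring, Finset.sum_range_succ, Finset.sum_range_succ, ih,
      Finset.sum_range_succ, gaussMoment_odd]
    have h := congrArg (Complex.ofReal) (gaussMoment_even v m)
    push_cast at h
    rw [Complex.ofReal_zero, mul_zero, add_zero, div_mul_eq_mul_div, mul_div_assoc, h, pow_mul,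
      Complex.I_sq, neg_div, neg_pow ((v : ℂ) / 2)]
    ring

variable {Ω : ℕ → Type*} [∀ N, MeasurableSpace (Ω N)] {P : (N : ℕ) → Measure (Ω N)}
  [∀ N, IsProbabilityMeasure (P N)]

theorem AllMoments.pow {Ω : Type*} [MeasurableSpace Ω] {P : Measure Ω} [IsFiniteMeasure P]
    {f : Ω → ℂ} (hf : AllMoments f P) (k : ℕ) : AllMoments (fun ω => f ω ^ k) P := by
  have := AllMoments.prod (Finset.univ : Finset (Fin k)) (F := fun _ => f) (fun _ _ => hf)
  simpa using this

/-- The characteristic functions converge if the moments converge to those of a Gaussian. -/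
theorem tendsto_integral_exp_of_moments {X : (N : ℕ) → Ω N → ℝ} {v : ℝ}
    (hX : ∀ N, AllMoments (fun ω => (X N ω : ℂ)) (P N))
    (hm : ∀ k, Tendsto (fun N => ∫ ω, (X N ω : ℂ) ^ k ∂(P N)) atTop
      (𝓝 (gaussMoment v k : ℂ))) :
    Tendsto (fun N => ∫ ω, Complex.exp (Complex.I * X N ω) ∂(P N)) atTop
      (𝓝 (Complex.exp (-(v : ℂ) / 2))) := by
  have hint : ∀ N k, Integrable (fun ω => (X N ω : ℂ) ^ k) (P N) := fun N k =>
    ((hX N).pow k).integrable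
  have hexp : ∀ N, Integrable (fun ω => Complex.exp (Complex.I * X N ω)) (P N) := by
    intro N
    refine Integrable.of_bound (C := 1) ?_ (Eventually.of_forall fun ω => ?_)
    · exact (Complex.continuous_exp.measurable.comp_aemeasurable
        ((hX N).aemeasurable.const_mul _)).aestronglyMeasurable
    · rw [mul_comm, Complex.norm_exp_ofReal_mul_I]
  have hbound : ∀ m N, ‖(∫ ω, Complex.exp (Complex.I * X N ω) ∂(P N)) -
      ∑ k ∈ Finset.range (2 * m), Complex.I ^ k / (k.factorial : ℂ) *
        ∫ ω, (X N ω : ℂ) ^ k ∂(P N)‖ ≤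
      ‖∫ ω, (X N ω : ℂ) ^ (2 * m) ∂(P N)‖ / (2 * m).factorial := by
    intro m N
    simp_rw [← integral_const_mul]
    rw [← integral_finsetSum _ fun k _ => (hint N k).const_mul _,
      ← integral_sub (hexp N) (integrable_finsetSum _ fun k _ => (hint N k).const_mul _)]
    -- The order is even so that the absolute moment in the remainder is an ordinary moment, whose
    -- limit is known.
    have h1 : (∫ ω, (X N ω : ℂ) ^ (2 * m) ∂(P N)) = ((∫ ω, |X N ω| ^ (2 * m) ∂(P N) : ℝ) : ℂ) := by
      rw [← integral_complex_ofReal]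
      refine integral_congr_ae (Eventually.of_forall fun ω => ?_)
      simp only [pow_mul, sq_abs]
      push_cast
      rfl
    rw [h1, Complex.norm_real, Real.norm_of_nonneg (integral_nonneg fun ω => by positivity),
      ← integral_div]
    have h2 : Integrable (fun ω => |X N ω| ^ (2 * m) / ((2 * m).factorial : ℝ)) (P N) := by
      have := ((hint N (2 * m)).norm).div_const ((2 * m).factorial : ℝ)
      simpa using this
    refine norm_integral_le_of_norm_le h2 (Eventually.of_forall fun ω => ?_)
    refine le_trans (le_of_eq ?_) (norm_exp_I_mul_sub_sum_le (2 * m) (X N ω))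
    congr 2
    refine Finset.sum_congr rfl fun k _ => ?_
    rw [mul_pow]; ring
  have hT : Tendsto (fun m => ∑ j ∈ Finset.range m, (-(v : ℂ) / 2) ^ j / (j.factorial : ℂ)) atTop
      (𝓝 (Complex.exp (-(v : ℂ) / 2))) := by
    rw [Complex.exp_eq_exp_ℂ]
    exact (NormedSpace.expSeries_div_hasSum_exp (-(v : ℂ) / 2)).tendsto_sum_nat
  have hR : Tendsto (fun m => (|v| / 2) ^ m / (m.factorial : ℝ)) atTop (𝓝 0) :=
    FloorSemiring.tendsto_pow_div_factorial_atTop _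
  rw [Metric.tendsto_atTop]
  intro ε hε
  -- The order m is fixed first, making both the tail of the limiting series and the limiting
  -- remainder small; only then does N tend to infinity.
  obtain ⟨m, hm1, hm2⟩ := ((hT.eventually (Metric.ball_mem_nhds _ (by positivity : 0 < ε / 3))).and
    (hR.eventually_lt_const (by positivity : 0 < ε / 3))).exists
  have hS : Tendsto (fun N => ∑ k ∈ Finset.range (2 * m), Complex.I ^ k / (k.factorial : ℂ) *
        ∫ ω, (X N ω : ℂ) ^ k ∂(P N)) atTop
      (𝓝 (∑ j ∈ Finset.range m, (-(v : ℂ) / 2) ^ j / (j.factorial : ℂ))) := by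
    rw [← sum_gaussMoment]
    exact tendsto_finsetSum _ fun k _ => (hm k).const_mul _
  have hrem : Tendsto (fun N => ‖∫ ω, (X N ω : ℂ) ^ (2 * m) ∂(P N)‖ / (2 * m).factorial) atTop
      (𝓝 ((|v| / 2) ^ m / (m.factorial : ℝ))) := by
    have h1 := (hm (2 * m)).norm.div_const ((2 * m).factorial : ℝ)
    have h2 : ‖(gaussMoment v (2 * m) : ℂ)‖ / ((2 * m).factorial : ℝ) =
        (|v| / 2) ^ m / (m.factorial : ℝ) := by
      have := congrArg abs (gaussMoment_even v m)
      rw [abs_div, abs_div, abs_pow, abs_div, Nat.abs_cast, Nat.abs_cast, abs_two] at this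
      rw [Complex.norm_real, Real.norm_eq_abs, this]
    rwa [h2] at h1
  obtain ⟨N₀, hN₀⟩ := eventually_atTop.1 ((hS.eventually (Metric.ball_mem_nhds _
    (by positivity : 0 < ε / 3))).and (hrem.eventually_lt_const hm2))
  refine ⟨N₀, fun N hN => ?_⟩
  obtain ⟨h1, h2⟩ := hN₀ N hN
  have h3 := (hbound m N).trans_lt h2
  rw [← dist_eq_norm] at h3
  have h4 := dist_triangle4 (∫ ω, Complex.exp (Complex.I * X N ω) ∂(P N)) _ _
    (Complex.exp (-(v : ℂ) / 2)) |>.trans_lt (add_lt_add (add_lt_add h3 h1) hm1)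
  linarith

end Moments

/-! ### Moments of the real linear functionals of the centred trace -/

section StarWord

theorem wordMatrix_starWord {n : ℕ} (G : ℕ → Matrix (Fin n) (Fin n) ℂ) (w : List Letter) :
    wordMatrix G (starWord w) = (wordMatrix G w)ᴴ := by
  rw [wordMatrix, wordMatrix, starWord, Matrix.conjTranspose_list_prod, List.map_reverse,
    List.map_map, List.map_map]
  congr 3
  funext a
  cases h : a.starred <;> simp [Letter.star, h]

theorem starWord_ne_nil {w : List Letter} (hw : w ≠ []) : starWord w ≠ [] := by
  simpa [starWord] using hw

variable {Ω : Type*} [MeasurableSpace Ω] {P : Measure Ω} {N : ℕ}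

theorem traceVar_starWord (b : ℕ) (z : ℕ × Fin N × Fin N → ℂ) (w : List Letter) :
    traceVar b z (starWord w) = starRingEnd ℂ (traceVar b z w) := by
  rw [traceVar, wordMatrix_starWord, Matrix.trace_conjTranspose]; rfl

theorem centredTrace_starWord (P : Measure Ω) (b : ℕ) (Z : ℕ × Fin N × Fin N → Ω → ℂ)
    (w : List Letter) (ω : Ω) :
    centredTrace P b Z (starWord w) ω = starRingEnd ℂ (centredTrace P b Z w ω) := by
  simp_rw [centredTrace, traceVar_starWord, integral_conj, map_sub]

/-- The word `w`, or `w^*` if the flag is set. -/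
def signedWord (w : List Letter) (ε : Bool) : List Letter := if ε then starWord w else w

theorem signedWord_ne_nil {w : List Letter} (hw : w ≠ []) (ε : Bool) : signedWord w ε ≠ [] := by
  cases ε
  · exact hw
  · exact starWord_ne_nil hw

end StarWord

/-! ### Linear combinations of the centred traces of w and w^*. -/

section Projection

variable {Ω : Type*} [MeasurableSpace Ω] {P : Measure Ω}

theorem prod_pairColour {n : ℕ} {j : Fin (n + 2)} (hj : j ≠ 0) (X : Ω → ℂ) :
    ∏ c : Bool, ∫ ω, ∏ _i ∈ Finset.univ.filter (fun i => pairColour 0 j i = c), X ω ∂P =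
      (∫ ω, X ω ^ 2 ∂P) * ∫ ω, X ω ^ n ∂P := by
  have h1 : (Finset.univ.filter fun i : Fin (n + 2) => pairColour 0 j i = true) = {0, j} := by
    ext i; simp [pairColour]
  have h2 : (Finset.univ.filter fun i : Fin (n + 2) => pairColour 0 j i = false) = {0, j}ᶜ := by
    rw [← h1]; ext i; simp
  rw [Fintype.prod_bool, h1, h2]
  simp_rw [Finset.prod_const, Finset.card_compl, Finset.card_pair hj.symm, Fintype.card_fin,
    Nat.add_sub_cancel]

variable [IsProbabilityMeasure P]

/-- Multilinearity of a product of expectations of products. -/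
theorem prod_integral_prod_sum {B C : Type*} [Fintype B] [Fintype C] [DecidableEq C] {n : ℕ}
    (col : Fin n → C) (a : B → ℂ) {Y : B → Ω → ℂ} (hY : ∀ ε, AllMoments (Y ε) P) :
    ∏ c, ∫ ω, ∏ _j ∈ Finset.univ.filter (fun j => col j = c), ∑ ε, a ε * Y ε ω ∂P =
      ∑ e : Fin n → B, (∏ j, a (e j)) *
        ∏ c, ∫ ω, ∏ j ∈ Finset.univ.filter (fun j => col j = c), Y (e j) ω ∂P := by
  classical
  rw [← integral_pi_coloured Finset.univ col (fun _ ω => ∑ ε, a ε * Y ε ω)]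
  simp_rw [fun e : Fin n → B => (integral_pi_coloured (P := P) Finset.univ col
    (fun j ω => Y (e j) ω)).symm]
  simp_rw [Finset.prod_univ_sum, Fintype.piFinset_univ, Finset.prod_mul_distrib]
  rw [integral_finsetSum]
  · simp_rw [integral_const_mul]
  · intro e _
    exact (integrable_pi_coloured Finset.univ col fun j => hY (e j)).const_mul _

variable {N b : ℕ} {Z : ℕ × Fin N × Fin N → Ω → ℂ}

/-- The linear combination `a_false F_w + a_true F_{w^*}` of the centred traces `F`. -/
noncomputable def traceCombination (P : Measure Ω) (b : ℕ) (Z : ℕ × Fin N × Fin N → Ω → ℂ)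
    (w : List Letter) (a : Bool → ℂ) (ω : Ω) : ℂ :=
  ∑ ε, a ε * centredTrace P b Z (signedWord w ε) ω

theorem allMoments_centredTrace (hlaw : ∀ q, HasLaw (Z q) stdComplexGaussian P) {w : List Letter}
    (hw : w ≠ []) : AllMoments (centredTrace P b Z w) P :=
  (allMoments_traceVar hlaw hw).sub_const _

theorem allMoments_traceCombination (hlaw : ∀ q, HasLaw (Z q) stdComplexGaussian P)
    {w : List Letter} (hw : w ≠ []) (a : Bool → ℂ) :
    AllMoments (traceCombination P b Z w a) P :=
  AllMoments.sum _ fun ε _ =>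
    (allMoments_centredTrace hlaw (signedWord_ne_nil hw ε)).const_mul _

theorem integral_centredTrace (hlaw : ∀ q, HasLaw (Z q) stdComplexGaussian P) {w : List Letter}
    (hw : w ≠ []) : ∫ ω, centredTrace P b Z w ω ∂P = 0 := by
  simp_rw [centredTrace]
  rw [integral_sub (allMoments_traceVar hlaw hw).integrable (integrable_const _)]
  simp

theorem integral_traceCombination (hlaw : ∀ q, HasLaw (Z q) stdComplexGaussian P)
    {w : List Letter} (hw : w ≠ []) (a : Bool → ℂ) :
    ∫ ω, traceCombination P b Z w a ω ∂P = 0 := by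
  simp_rw [traceCombination]
  rw [integral_finsetSum _ fun ε _ => ((allMoments_centredTrace hlaw
    (signedWord_ne_nil hw ε)).const_mul (a ε)).integrable]
  simp_rw [integral_const_mul, fun ε => integral_centredTrace (b := b) hlaw
    (signedWord_ne_nil hw ε), mul_zero, Finset.sum_const_zero]

/-- The asymptotic Wick recursion for the moments of `traceCombination`. -/
theorem norm_moment_recursion_le (hN : N ≠ 0) (b : ℕ) {w : List Letter} (hw : w ≠ [])
    (hlaw : ∀ q, HasLaw (Z q) stdComplexGaussian P) (hindep : iIndepFun Z P) (a : Bool → ℂ)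
    (n : ℕ) :
    ‖((√(bandCount N b / N) : ℝ) : ℂ) ^ (n + 2) *
        ((∫ ω, traceCombination P b Z w a ω ^ (n + 2) ∂P) -
          (n + 1) * ((∫ ω, traceCombination P b Z w a ω ^ 2 ∂P) *
            ∫ ω, traceCombination P b Z w a ω ^ n ∂P))‖ ≤
      (∑ e : Fin (n + 2) → Bool, ‖∏ j, a (e j)‖ *
        Fintype.card (Equiv.Perm (Edge fun j => signedWord w (e j)))) * (bandCount N b : ℝ)⁻¹ := by
  have hY : ∀ ε, AllMoments (centredTrace P b Z (signedWord w ε)) P := fun ε =>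
    allMoments_centredTrace hlaw (signedWord_ne_nil hw ε)
  have h1 : (∫ ω, traceCombination P b Z w a ω ^ (n + 2) ∂P) =
      ∑ e : Fin (n + 2) → Bool, (∏ j, a (e j)) *
        ∫ ω, ∏ j, centredTrace P b Z (signedWord w (e j)) ω ∂P := by
    have := prod_integral_prod_sum (P := P) (n := n + 2) (fun _ => ()) a hY
    simpa [traceCombination] using this
  have h2 : (n + 1 : ℂ) * ((∫ ω, traceCombination P b Z w a ω ^ 2 ∂P) *
      ∫ ω, traceCombination P b Z w a ω ^ n ∂P) =
      ∑ e : Fin (n + 2) → Bool, (∏ j, a (e j)) * ∑ j ∈ Finset.univ.erase 0, ∏ c : Bool,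
        ∫ ω, ∏ i ∈ Finset.univ.filter (fun i => pairColour 0 j i = c),
          centredTrace P b Z (signedWord w (e i)) ω ∂P := by
    simp_rw [Finset.mul_sum]
    rw [Finset.sum_comm]
    -- After summation over the signs all factors are alike, so each of the n + 1 partners of the
    -- face 0 gives the same product.
    have : ∀ j ∈ Finset.univ.erase (0 : Fin (n + 2)),
        (∑ e : Fin (n + 2) → Bool, (∏ j, a (e j)) * ∏ c : Bool,
          ∫ ω, ∏ i ∈ Finset.univ.filter (fun i => pairColour 0 j i = c),
            centredTrace P b Z (signedWord w (e i)) ω ∂P) =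
        (∫ ω, traceCombination P b Z w a ω ^ 2 ∂P) *
          ∫ ω, traceCombination P b Z w a ω ^ n ∂P := by
      intro j hj
      rw [← prod_pairColour (Finset.ne_of_mem_erase hj)]
      exact (prod_integral_prod_sum (pairColour 0 j) a hY).symm
    rw [Finset.sum_congr rfl this, Finset.sum_const, Finset.card_erase_of_mem (Finset.mem_univ _),
      Finset.card_univ, Fintype.card_fin, nsmul_eq_mul]
    simp
  rw [h1, h2, ← Finset.sum_sub_distrib, Finset.mul_sum, Finset.sum_mul]
  refine (norm_sum_le _ _).trans (Finset.sum_le_sum fun e _ => ?_)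
  rw [← mul_sub, mul_left_comm, norm_mul, mul_assoc]
  exact mul_le_mul_of_nonneg_left
    (norm_recursion_le hN b (fun j => signedWord_ne_nil hw (e j)) hlaw hindep 0) (norm_nonneg _)

end Projection

/-! ### Convergence of moments. -/

section Limit

variable {Ω : ℕ → Type*} [∀ N, MeasurableSpace (Ω N)]
  {P : (N : ℕ) → Measure (Ω N)} [∀ N, IsProbabilityMeasure (P N)]
  {Z : (N : ℕ) → ℕ × Fin N × Fin N → Ω N → ℂ} {b : ℕ → ℕ} {w : List Letter} {lam : ℝ}

/-- The limits of the rescaled covariances of the centred traces of `w` and `w^*`. -/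
noncomputable def covarianceLimit (lam : ℝ) (w : List Letter) (ε ε' : Bool) : ℝ :=
  if ε = ε' then cParam lam w else bParam lam w

/-- Only the pairs (w, w) and (w, w^*) need the genus expansion. The others follow by symmetry and
conjugation, the limits being real. -/
theorem tendsto_covariance_signedWord (hw : w ≠ []) (hlam : 0 ≤ lam) (hlam' : lam ≤ 1 / 2)
    (hl : Tendsto (fun N => (bandCount N (b N) : ℝ)) atTop atTop)
    (hr : Tendsto (fun N : ℕ => (bandCount N (b N) : ℝ) / N) atTop (𝓝 (2 * lam)))
    (hlaw : ∀ N q, HasLaw (Z N q) stdComplexGaussian (P N))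
    (hindep : ∀ N, iIndepFun (Z N) (P N)) (ε ε' : Bool) :
    Tendsto (fun N : ℕ => ((bandCount N (b N) / N : ℝ) : ℂ) *
      ∫ ω, centredTrace (P N) (b N) (Z N) (signedWord w ε) ω *
        centredTrace (P N) (b N) (Z N) (signedWord w ε') ω ∂(P N)) atTop
      (𝓝 (covarianceLimit lam w ε ε' : ℂ)) := by
  have hff := tendsto_covariance hw hw hlam hlam' hl hr hlaw hindep
  have hft := tendsto_covariance hw (starWord_ne_nil hw) hlam hlam' hl hr hlaw hindep
  cases ε <;> cases ε'
  · exact hff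
  · exact hft
  · refine hft.congr fun N => ?_
    simp_rw [mul_comm (centredTrace (P N) (b N) (Z N) w _)]
    rfl
  · have := (Complex.continuous_conj.tendsto _).comp hff
    rw [Complex.conj_ofReal] at this
    refine this.congr fun N => ?_
    simp only [Function.comp_apply, map_mul, Complex.conj_ofReal, ← integral_conj,
      ← centredTrace_starWord]
    rfl

theorem tendsto_second_moment (hw : w ≠ []) (hlam : 0 ≤ lam) (hlam' : lam ≤ 1 / 2)
    (hl : Tendsto (fun N => (bandCount N (b N) : ℝ)) atTop atTop)
    (hr : Tendsto (fun N : ℕ => (bandCount N (b N) : ℝ) / N) atTop (𝓝 (2 * lam)))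
    (hlaw : ∀ N q, HasLaw (Z N q) stdComplexGaussian (P N))
    (hindep : ∀ N, iIndepFun (Z N) (P N)) (a : Bool → ℂ) :
    Tendsto (fun N : ℕ => ((√(bandCount N (b N) / N) : ℝ) : ℂ) ^ 2 *
      ∫ ω, traceCombination (P N) (b N) (Z N) w a ω ^ 2 ∂(P N)) atTop
      (𝓝 (∑ ε, ∑ ε', a ε * a ε' * (covarianceLimit lam w ε ε' : ℂ))) := by
  have h := tendsto_finsetSum Finset.univ fun (ε : Bool) _ =>
    tendsto_finsetSum Finset.univ fun (ε' : Bool) _ =>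
      (tendsto_covariance_signedWord hw hlam hlam' hl hr hlaw hindep ε ε').const_mul (a ε * a ε')
  refine h.congr fun N => ?_
  rw [← Complex.ofReal_pow, Real.sq_sqrt (by positivity)]
  have hY : ∀ ε, AllMoments (centredTrace (P N) (b N) (Z N) (signedWord w ε)) (P N) := fun ε =>
    allMoments_centredTrace (hlaw N) (signedWord_ne_nil hw ε)
  have h2 : ∀ ω, traceCombination (P N) (b N) (Z N) w a ω ^ 2 = ∑ ε, ∑ ε', a ε * a ε' *
      (centredTrace (P N) (b N) (Z N) (signedWord w ε) ω *
        centredTrace (P N) (b N) (Z N) (signedWord w ε') ω) := by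
    intro ω
    rw [sq, traceCombination, Finset.sum_mul_sum]
    refine Finset.sum_congr rfl fun ε _ => Finset.sum_congr rfl fun ε' _ => by ring
  simp_rw [h2]
  rw [integral_finsetSum _ fun ε _ => integrable_finsetSum _ fun ε' _ =>
    (((hY ε).mul (hY ε')).const_mul _).integrable, Finset.mul_sum]
  refine Finset.sum_congr rfl fun ε _ => ?_
  rw [integral_finsetSum _ fun ε' _ => (((hY ε).mul (hY ε')).const_mul _).integrable,
    Finset.mul_sum]
  refine Finset.sum_congr rfl fun ε' _ => ?_
  rw [integral_const_mul]
  ring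

/-- Strong induction in steps of two: the recursion error is O(1/l), so the limits obey the
recursion defining `gaussMoment`, starting from total mass 1 and mean 0. -/
theorem tendsto_moment (hw : w ≠ []) (hlam : 0 ≤ lam) (hlam' : lam ≤ 1 / 2)
    (hl : Tendsto (fun N => (bandCount N (b N) : ℝ)) atTop atTop)
    (hr : Tendsto (fun N : ℕ => (bandCount N (b N) : ℝ) / N) atTop (𝓝 (2 * lam)))
    (hlaw : ∀ N q, HasLaw (Z N q) stdComplexGaussian (P N))
    (hindep : ∀ N, iIndepFun (Z N) (P N)) (a : Bool → ℂ) {v : ℝ}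
    (hv : ∑ ε, ∑ ε', a ε * a ε' * (covarianceLimit lam w ε ε' : ℂ) = v) (k : ℕ) :
    Tendsto (fun N : ℕ => ∫ ω, (((√(bandCount N (b N) / N) : ℝ) : ℂ) *
      traceCombination (P N) (b N) (Z N) w a ω) ^ k ∂(P N)) atTop (𝓝 (gaussMoment v k : ℂ)) := by
  simp_rw [mul_pow, integral_const_mul]
  have h2 := tendsto_second_moment hw hlam hlam' hl hr hlaw hindep a
  rw [hv] at h2
  induction k using Nat.strong_induction_on with
  | _ k ih =>
    match k, ih with
    | 0, _ => simp [gaussMoment]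
    | 1, _ =>
      simp_rw [pow_one, fun N => integral_traceCombination (b := b N) (hlaw N) hw a, mul_zero]
      simp [gaussMoment]
    | k + 2, ih =>
      have h3 := (h2.mul (ih k (by omega))).const_mul ((k : ℂ) + 1)
      rw [← mul_assoc] at h3
      have h4 : Tendsto (fun N : ℕ => ((√(bandCount N (b N) / N) : ℝ) : ℂ) ^ (k + 2) *
          ((∫ ω, traceCombination (P N) (b N) (Z N) w a ω ^ (k + 2) ∂(P N)) -
            (k + 1) * ((∫ ω, traceCombination (P N) (b N) (Z N) w a ω ^ 2 ∂(P N)) *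
              ∫ ω, traceCombination (P N) (b N) (Z N) w a ω ^ k ∂(P N)))) atTop (𝓝 0) := by
        refine squeeze_zero_norm' ((eventually_ne_atTop 0).mono fun N hN =>
          norm_moment_recursion_le hN (b N) hw (hlaw N) (hindep N) a k) ?_
        simpa using (tendsto_inv_atTop_zero.comp hl).const_mul _
      have h5 := h4.add h3
      rw [zero_add] at h5
      have h6 : (gaussMoment v (k + 2) : ℂ) = ((k : ℂ) + 1) * v * (gaussMoment v k : ℂ) := by
        rw [gaussMoment]; push_cast; ring
      rw [h6]
      refine h5.congr fun N => ?_
      ring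

end Limit

/-! ### The band count under the growth hypotheses -/

section Growth

variable {b : ℕ → ℕ}

theorem tendsto_bandCount_div_rpow
    (hb : Tendsto (fun N : ℕ => (b N : ℝ) / (N : ℝ) ^ (1 / 3 : ℝ)) atTop atTop) :
    Tendsto (fun N : ℕ => (bandCount N (b N) : ℝ) / (N : ℝ) ^ (1 / 3 : ℝ)) atTop atTop := by
  have h1 : Tendsto (fun N : ℕ => (N : ℝ) ^ (2 / 3 : ℝ)) atTop atTop :=
    (tendsto_rpow_atTop (by norm_num)).comp tendsto_natCast_atTop_atTop
  refine tendsto_atTop.2 fun M => ?_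
  filter_upwards [tendsto_atTop.1 hb M, tendsto_atTop.1 h1 M, eventually_gt_atTop 0] with N h2 h3 hN
  have hN' : (0 : ℝ) < N := by exact_mod_cast hN
  have hp : (0 : ℝ) < (N : ℝ) ^ (1 / 3 : ℝ) := Real.rpow_pos_of_pos hN' _
  rw [le_div_iff₀ hp] at h2 ⊢
  have h4 : M * (N : ℝ) ^ (1 / 3 : ℝ) ≤ N := by
    refine (mul_le_mul_of_nonneg_right h3 hp.le).trans (le_of_eq ?_)
    rw [← Real.rpow_add hN']; norm_num
  rw [bandCount, Nat.cast_min]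
  push_cast
  exact le_min (by linarith [(Nat.cast_nonneg (b N) : (0 : ℝ) ≤ b N)]) h4

theorem tendsto_bandCount_atTop
    (hb : Tendsto (fun N : ℕ => (b N : ℝ) / (N : ℝ) ^ (1 / 3 : ℝ)) atTop atTop) :
    Tendsto (fun N : ℕ => (bandCount N (b N) : ℝ)) atTop atTop := by
  have h1 : Tendsto (fun N : ℕ => (N : ℝ) ^ (1 / 3 : ℝ)) atTop atTop :=
    (tendsto_rpow_atTop (by norm_num)).comp tendsto_natCast_atTop_atTop
  refine ((tendsto_bandCount_div_rpow hb).atTop_mul_atTop₀ h1).congr' ?_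
  filter_upwards [eventually_gt_atTop 0] with N hN
  have hp : (0 : ℝ) < (N : ℝ) ^ (1 / 3 : ℝ) := Real.rpow_pos_of_pos (by exact_mod_cast hN) _
  exact div_mul_cancel₀ _ hp.ne'

/-- The expression equals √(N/l³), a negative power of l/N^(1/3). This is where the exponent 1/3
comes from. -/
theorem tendsto_sqrt_mul_div_sq
    (hb : Tendsto (fun N : ℕ => (b N : ℝ) / (N : ℝ) ^ (1 / 3 : ℝ)) atTop atTop) :
    Tendsto (fun N : ℕ => √((bandCount N (b N) : ℝ) / N) *
      ((N : ℝ) / (bandCount N (b N) : ℝ) ^ 2)) atTop (𝓝 0) := by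
  have h1 : Tendsto (fun N : ℕ => √(((bandCount N (b N) : ℝ) / (N : ℝ) ^ (1 / 3 : ℝ)) ^ 3)⁻¹)
      atTop (𝓝 0) := by
    have := (tendsto_inv_atTop_zero.comp ((tendsto_pow_atTop (n := 3) (by norm_num)).comp
      (tendsto_bandCount_div_rpow hb))).sqrt
    simpa using this
  refine h1.congr' ?_
  filter_upwards [eventually_gt_atTop 0] with N hN
  have hN' : (0 : ℝ) < N := by exact_mod_cast hN
  have hl : (0 : ℝ) < bandCount N (b N) := by exact_mod_cast bandCount_pos hN.ne' (b N)
  have h2 : ((N : ℝ) ^ (1 / 3 : ℝ)) ^ 3 = N := by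
    rw [← Real.rpow_natCast, ← Real.rpow_mul hN'.le]; norm_num
  rw [div_pow, h2, ← Real.sqrt_sq (by positivity : (0 : ℝ) ≤ N / (bandCount N (b N) : ℝ) ^ 2),
    ← Real.sqrt_mul (by positivity)]
  congr 1
  field_simp

/-- The truncation of l at N is what replaces λ by min(λ, 1/2). -/
theorem tendsto_bandCount_div {lam : ℝ}
    (hr : Tendsto (fun N : ℕ => (b N : ℝ) / (N : ℝ)) atTop (𝓝 lam)) :
    Tendsto (fun N : ℕ => (bandCount N (b N) : ℝ) / N) atTop (𝓝 (2 * min lam (1 / 2))) := by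
  have h1 : Tendsto (fun N : ℕ => min (2 * ((b N : ℝ) / N) + (N : ℝ)⁻¹) 1) atTop
      (𝓝 (min (2 * lam + 0) 1)) :=
    ((hr.const_mul 2).add (tendsto_inv_atTop_zero.comp tendsto_natCast_atTop_atTop)).min
      tendsto_const_nhds
  have h2 : min (2 * lam + 0) 1 = 2 * min lam (1 / 2) := by
    rw [mul_min_of_nonneg _ _ zero_le_two]; norm_num
  rw [h2] at h1
  refine h1.congr' ?_
  filter_upwards [eventually_gt_atTop 0] with N hN
  have hN' : (0 : ℝ) < N := by exact_mod_cast hN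
  rw [bandCount, Nat.cast_min, ← min_div_div_right hN'.le, div_self hN'.ne']
  congr 1
  push_cast
  field_simp

end Growth

/-! ### The limiting Gaussian law -/

section GaussianLimit

theorem alpha_nonneg {k : ℕ} {ws : Fin k → List Letter} (lam : ℝ)
    (φ : Equiv.Perm (Edge ws)) : 0 ≤ alpha lam φ := by
  rw [alpha]; split_ifs <;> simp

theorem bParam_nonneg (lam : ℝ) (w : List Letter) : 0 ≤ bParam lam w :=
  Finset.sum_nonneg fun φ _ => alpha_nonneg lam φ

theorem cParam_nonneg (lam : ℝ) (w : List Letter) : 0 ≤ cParam lam w :=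
  Finset.sum_nonneg fun φ _ => alpha_nonneg lam φ

theorem charFun_gaussian_prod (v₁ v₂ : NNReal) (t : ℂ) :
    charFun (((gaussianReal 0 v₁).prod (gaussianReal 0 v₂)).map
      fun p : ℝ × ℝ => (p.1 : ℂ) + (p.2 : ℂ) * Complex.I) t =
      Complex.exp (-((t.re ^ 2 * v₁ + t.im ^ 2 * v₂ : ℝ) : ℂ) / 2) := by
  have hmeas : Measurable fun p : ℝ × ℝ => (p.1 : ℂ) + (p.2 : ℂ) * Complex.I := by fun_prop
  rw [charFun_apply, integral_map hmeas.aemeasurable (by fun_prop)]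
  have h1 : ∀ p : ℝ × ℝ, Complex.exp ((inner ℝ ((p.1 : ℂ) + (p.2 : ℂ) * Complex.I) t : ℝ) *
      Complex.I) = Complex.exp (t.re * p.1 * Complex.I) * Complex.exp (t.im * p.2 * Complex.I) := by
    intro p
    rw [← Complex.exp_add, Complex.inner]
    congr 1
    simp
    ring
  simp_rw [h1]
  rw [integral_prod_mul (fun x : ℝ => Complex.exp (t.re * x * Complex.I))
    (fun x : ℝ => Complex.exp (t.im * x * Complex.I)), ← charFun_apply_real, ← charFun_apply_real,
    charFun_gaussianReal, charFun_gaussianReal, ← Complex.exp_add]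
  congr 1
  push_cast
  ring

/-- The coefficients of the functional `z ↦ ⟪z, t⟫` in terms of `z` and its conjugate. -/
noncomputable def innerCoeff (t : ℂ) (ε : Bool) : ℂ := if ε then t / 2 else starRingEnd ℂ t / 2

theorem sum_innerCoeff_covarianceLimit (lam : ℝ) (w : List Letter) (t : ℂ) :
    ∑ ε, ∑ ε', innerCoeff t ε * innerCoeff t ε' * (covarianceLimit lam w ε ε' : ℂ) =
      ((t.re ^ 2 * ((bParam lam w + cParam lam w) / 2) +
        t.im ^ 2 * ((bParam lam w - cParam lam w) / 2) : ℝ) : ℂ) := by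
  simp only [Fintype.sum_bool, innerCoeff, covarianceLimit]
  apply Complex.ext
  · simp [sq]; ring
  · simp [sq]; ring

section

variable {Ω : Type*} [MeasurableSpace Ω] {P : Measure Ω} {N b : ℕ}
  {Z : ℕ × Fin N × Fin N → Ω → ℂ} {w : List Letter}

/-- The real inner product of z and t is (z conj t + t conj z)/2, and the conjugate of the centred
trace of w is that of w^*. -/
theorem inner_centredTrace (s : ℝ) (t : ℂ) (ω : Ω) :
    ((inner ℝ ((s : ℂ) * centredTrace P b Z w ω) t : ℝ) : ℂ) =
      (s : ℂ) * traceCombination P b Z w (innerCoeff t) ω := by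
  rw [traceCombination, Fintype.sum_bool, signedWord, signedWord, if_pos rfl,
    if_neg Bool.false_ne_true, centredTrace_starWord, Complex.inner]
  generalize centredTrace P b Z w ω = z
  apply Complex.ext
  · simp [innerCoeff, -mul_eq_mul_left_iff]; ring
  · simp [innerCoeff, -zero_eq_mul]; ring

end

variable {Ω : ℕ → Type*} [∀ N, MeasurableSpace (Ω N)]
  {P : (N : ℕ) → Measure (Ω N)} [∀ N, IsProbabilityMeasure (P N)]
  {Z : (N : ℕ) → ℕ × Fin N × Fin N → Ω N → ℂ} {b : ℕ → ℕ} {w : List Letter} {lam : ℝ}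

/-- Taking t = i, the second moments of the rescaled imaginary part are nonnegative and tend to (b'
- c')/2. -/
theorem cParam_le_bParam (hw : w ≠ []) (hlam : 0 ≤ lam) (hlam' : lam ≤ 1 / 2)
    (hl : Tendsto (fun N => (bandCount N (b N) : ℝ)) atTop atTop)
    (hr : Tendsto (fun N : ℕ => (bandCount N (b N) : ℝ) / N) atTop (𝓝 (2 * lam)))
    (hlaw : ∀ N q, HasLaw (Z N q) stdComplexGaussian (P N))
    (hindep : ∀ N, iIndepFun (Z N) (P N)) : cParam lam w ≤ bParam lam w := by
  have h := tendsto_moment hw hlam hlam' hl hr hlaw hindep (innerCoeff Complex.I)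
    (sum_innerCoeff_covarianceLimit lam w Complex.I) 2
  have h2 := (Complex.continuous_re.tendsto _).comp h
  have h3 := ge_of_tendsto' h2 (b := 0) fun N => by
    simp only [Function.comp_apply, ← inner_centredTrace, ← Complex.ofReal_pow,
      integral_complex_ofReal, Complex.ofReal_re]
    exact integral_nonneg fun ω => sq_nonneg _
  simp [gaussMoment] at h3
  linarith

theorem tendsto_charFun_centredTrace (hw : w ≠ []) (hlam : 0 ≤ lam) (hlam' : lam ≤ 1 / 2)
    (hl : Tendsto (fun N => (bandCount N (b N) : ℝ)) atTop atTop)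
    (hr : Tendsto (fun N : ℕ => (bandCount N (b N) : ℝ) / N) atTop (𝓝 (2 * lam)))
    (hlaw : ∀ N q, HasLaw (Z N q) stdComplexGaussian (P N))
    (hindep : ∀ N, iIndepFun (Z N) (P N)) (t : ℂ) :
    Tendsto (fun N => ∫ ω, Complex.exp (Complex.I * ((inner ℝ
      (((√(bandCount N (b N) / N) : ℝ) : ℂ) * centredTrace (P N) (b N) (Z N) w ω) t : ℝ) : ℂ))
        ∂(P N)) atTop
      (𝓝 (Complex.exp (-((t.re ^ 2 * ((bParam lam w + cParam lam w) / 2) +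
        t.im ^ 2 * ((bParam lam w - cParam lam w) / 2) : ℝ) : ℂ) / 2))) := by
  refine tendsto_integral_exp_of_moments (fun N => ?_) fun k => ?_
  · simp_rw [inner_centredTrace]
    exact (allMoments_traceCombination (hlaw N) hw _).const_mul _
  · simp_rw [inner_centredTrace]
    exact tendsto_moment hw hlam hlam' hl hr hlaw hindep _
      (sum_innerCoeff_covarianceLimit lam w t) k

end GaussianLimit

/-! ### The main theorem -/

theorem isBigO_integral_trace
    {w : List Letter} (hw : w ≠ []) (b : ℕ → ℕ)
    {Ω : ℕ → Type*} [∀ N, MeasurableSpace (Ω N)]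
    {P : (N : ℕ) → Measure (Ω N)} [∀ N, IsProbabilityMeasure (P N)]
    {Z : (N : ℕ) → ℕ × Fin N × Fin N → Ω N → ℂ}
    (hlaw : ∀ N q, HasLaw (Z N q) stdComplexGaussian (P N))
    (hindep : ∀ N, iIndepFun (Z N) (P N)) :
    (fun N : ℕ => (∫ ω, traceVar (b N) (fun q => Z N q ω) w ∂(P N)) - (aParam w : ℂ) * (N : ℂ))
        =O[atTop] fun N : ℕ => (N : ℝ) / (bandCount N (b N) : ℝ) ^ 2 := by
  refine IsBigO.of_bound (Fintype.card (Equiv.Perm (Edge ![w]))) ?_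
  filter_upwards [eventually_ne_atTop 0] with N hN
  rw [Real.norm_of_nonneg (by positivity)]
  exact norm_integral_traceVar_sub_le hN (b N) hw (hlaw N) (hindep N)

end BandCLT

theorem mainTheorem8
    (w : List BandCLT.Letter) (hw : w ≠ [])
    -- the band parameter
    (b : ℕ → ℕ)
    (hb : Tendsto (fun N : ℕ => (b N : ℝ) / (N : ℝ) ^ (1 / 3 : ℝ)) atTop atTop)
    -- for every `N`, i.i.d. standard complex Gaussian variables `Z N (r, i, j)`
    {Ω : ℕ → Type*} [∀ N, MeasurableSpace (Ω N)]
    (P : (N : ℕ) → Measure (Ω N)) [∀ N, IsProbabilityMeasure (P N)]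
    (Z : (N : ℕ) → ℕ × Fin N × Fin N → Ω N → ℂ)
    (hlaw : ∀ N q, HasLaw (Z N q) BandCLT.stdComplexGaussian (P N))
    (hindep : ∀ N, iIndepFun (Z N) (P N))
    -- the trace of the word `w` in the `N × N` band matrices `G_r`
    (T : (N : ℕ) → Ω N → ℂ)
    (hT : ∀ N ω, T N ω = Matrix.trace (BandCLT.wordMatrix
      (fun r => BandCLT.bandMatrix (b N) (fun i j => Z N (r, i, j) ω)) w)) :
    -- first order
    ((∀ N, Integrable (T N) (P N)) ∧
      (fun N : ℕ => (∫ ω, T N ω ∂(P N)) - (BandCLT.aParam w : ℂ) * (N : ℂ))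
        =O[atTop] fun N : ℕ => (N : ℝ) / (BandCLT.bandCount N (b N) : ℝ) ^ 2) ∧
    -- second order
    ∀ lam : ℝ, Tendsto (fun N : ℕ => (b N : ℝ) / (N : ℝ)) atTop (𝓝 lam) →
      BandCLT.cParam (min lam (1 / 2)) w ≤ BandCLT.bParam (min lam (1 / 2)) w ∧
      TendstoInDistribution
        (fun (N : ℕ) (ω : Ω N) =>
          ((Real.sqrt ((BandCLT.bandCount N (b N) : ℝ) / (N : ℝ)) : ℝ) : ℂ) *
            (T N ω - (BandCLT.aParam w : ℂ) * (N : ℂ)))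
        atTop
        (fun p : ℝ × ℝ => (p.1 : ℂ) + (p.2 : ℂ) * Complex.I)
        P
        ((gaussianReal 0 (Real.toNNReal
            ((BandCLT.bParam (min lam (1 / 2)) w + BandCLT.cParam (min lam (1 / 2)) w) / 2))).prod
          (gaussianReal 0 (Real.toNNReal
            ((BandCLT.bParam (min lam (1 / 2)) w - BandCLT.cParam (min lam (1 / 2)) w) / 2)))) := by
  obtain rfl : T = fun N ω => BandCLT.traceVar (b N) (fun q => Z N q ω) w :=
    funext fun N => funext fun ω => hT N ω
  have hO := BandCLT.isBigO_integral_trace hw b hlaw hindep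
  refine ⟨⟨fun N => (BandCLT.allMoments_traceVar (hlaw N) hw).integrable, hO⟩, fun lam hlam => ?_⟩
  have hlam0 : 0 ≤ min lam (1 / 2) :=
    le_min (ge_of_tendsto' hlam fun N => by positivity) (by norm_num)
  have hl := BandCLT.tendsto_bandCount_atTop hb
  have hr := BandCLT.tendsto_bandCount_div hlam
  have hlam1 : min lam (1 / 2) ≤ 1 / 2 := min_le_right _ _
  generalize min lam (1 / 2) = mu at hlam0 hlam1 hr ⊢
  have hcb := BandCLT.cParam_le_bParam hw hlam0 hlam1 hl hr hlaw hindep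
  have hmeas : ∀ N, AEMeasurable (fun ω => ((√((BandCLT.bandCount N (b N) : ℝ) / N) : ℝ) : ℂ) *
      (BandCLT.traceVar (b N) (fun q => Z N q ω) w - (BandCLT.aParam w : ℂ) * N)) (P N) := fun N =>
    (((BandCLT.allMoments_traceVar (hlaw N) hw).sub_const _).const_mul _).aemeasurable
  refine ⟨hcb, hmeas, by fun_prop, ProbabilityMeasure.tendsto_iff_tendsto_charFun.2 fun t => ?_⟩
  change Tendsto (fun N => charFun ((P N).map _) t) atTop (𝓝 (charFun (Measure.map _ _) t))
  rw [BandCLT.charFun_gaussian_prod, Real.coe_toNNReal _ (by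
      linarith [BandCLT.bParam_nonneg mu w, BandCLT.cParam_nonneg mu w]),
    Real.coe_toNNReal _ (by linarith)]
  -- The deterministic shift between centring at the mean and at a_w N; it multiplies the
  -- characteristic function by a phase that tends to 1.
  set δ : ℕ → ℂ := fun N => ((√((BandCLT.bandCount N (b N) : ℝ) / N) : ℝ) : ℂ) *
    ((∫ ω, BandCLT.traceVar (b N) (fun q => Z N q ω) w ∂(P N)) - (BandCLT.aParam w : ℂ) * N)
    with hδ
  have hδ0 : Tendsto δ atTop (𝓝 0) := by
    have hs : (fun N : ℕ => ((√((BandCLT.bandCount N (b N) : ℝ) / N) : ℝ) : ℂ)) =O[atTop]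
        fun N : ℕ => √((BandCLT.bandCount N (b N) : ℝ) / N) := isBigO_of_le _ fun N => by simp
    exact (hs.mul hO).trans_tendsto (BandCLT.tendsto_sqrt_mul_div_sq hb)
  have hphase : Tendsto (fun N => Complex.exp (((inner ℝ (δ N) t : ℝ) : ℂ) * Complex.I)) atTop
      (𝓝 1) := by
    have hcont : Continuous fun z : ℂ =>
        Complex.exp (((inner ℝ z t : ℝ) : ℂ) * Complex.I) := by fun_prop
    have := (hcont.tendsto 0).comp hδ0
    simpa [Function.comp_def] using this
  have hlim := hphase.mul
    (BandCLT.tendsto_charFun_centredTrace hw hlam0 hlam1 hl hr hlaw hindep t)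
  rw [one_mul] at hlim
  refine hlim.congr fun N => ?_
  rw [charFun_apply, integral_map (hmeas N) (by fun_prop), ← integral_const_mul]
  refine integral_congr_ae (Eventually.of_forall fun ω => ?_)
  simp only
  rw [← Complex.exp_add]
  congr 1
  rw [mul_comm Complex.I, ← add_mul, ← Complex.ofReal_add, ← inner_add_left, hδ]
  congr 3
  simp only [BandCLT.centredTrace]
  ring
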